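/- **Setting.** Let $n=3$, $s\in(0,1)$, and let $C_{3,t}=\frac{2^{t}\Gamma((3+t)/2)}{\pi^{3/2}|\Gamma(-t/2)|}$. $H^r=H^r(\mathbb R^3)$, $r\in\mathbb R$, is the Bessel potential space of (scalar or vector valued) tempered distributions $u$ with $\langle\xi\rangle^r\hat u\in L^2$. For $0<\sigma<1$ let $I_\sigma=(-\Delta)^{-\sigma/2}$ be the Riesz potential, i.e. $\widehat{I_\sigma u}=|\xi|^{-\sigma}\hat u$, and for functions $I_\sigma g(x)=C_{3,-\sigma}\int_{\mathbb R^3}\frac{g(y)}{|x-y|^{3-\sigma}}\,dy$. Put $$\alpha(x,y)=\frac{C_{3,s}^{1/2}}{\sqrt2}\,\frac{y-x}{|y-x|^{3/2+s+1}},\qquad \mathcal D^*u(x,y)=-(u(y)-u(x))\,\alpha(x,y),\qquad \mathcal C^*w(x,y)=\alpha(x,y)\times(w(y)-w(x)),$$ $$\Pi v(x)=c\int_{\mathbb R^3}\frac{v(x,y)}{|x-y|^{3/2}}\,dy,\qquad c=\frac{\sqrt2\,(s+2)\,C_{3,s-1}}{C_{3,s}^{1/2}}>0 .$$ On Sobolev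 spaces, $\Pi\mathcal D^*,\Pi\mathcal C^*:H^r\to H^{r-s}$, as well as $\mathcal D^*,\mathcal C^*$ (from $H^r$ to tempered distributions on $\mathbb R^3\times\mathbb R^3$, continuously), denote the continuous extensions of these operators from $C_c^\infty$. Let $$H^r_{fHd}=\{\mathcal D^*\varphi+\mathcal C^*A:\ \varphi,A\in H^{r+s},\ \nabla\cdot A=0\},$$ with norm $\|v\|=\inf\{\|\varphi\|_{H^{r+s}}+\|A\|_{H^{r+s}}: v=\mathcal D^*\varphi+\mathcal C^*A,\ \nabla\cdot A=0\}$, and on $H^r_{fHd}$ let $\Pi(\mathcal D^*\varphi+\mathcal C^*A):=(\Pi\mathcal D^*)\varphi+(\Pi\mathcal C^*)A$. **Proposition (Pi mapping property).** Let $s\in(0,1)$ and $r\in\mathbb R$. The extensions above exist and are unique, and: 1. $\Pi\mathcal D^*f=-I_{1-s}\nabla f$ (scalar $f$) and $\Pi\mathcal C^*f=I_{1-s}(\nabla\times f)$ (vector $f$), pointwise and with absolutely convergent integrals for $f\in C_c^\infty(\mathbb R^3)$, and in $H^{r-s}$ for $f\in H^r$. 2. $\Pi\mathcal C^*\,\Pi\mathcal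 D^*=0$, as a map $H^r\to H^{r-2s}$. 3. $\Pi:H^r_{fHd}\to H^r$, $\ \mathcal D^*\varphi+\mathcal C^*A\mapsto I_{1-s}(-\nabla\varphi+\nabla\times A)$, is a well-defined bounded linear operator. 4. For every $f\in H^r$, $\lim_{s\to1^-}\Pi\mathcal D^*f=-\nabla f$ and $\lim_{s\to1^-}\Pi\mathcal C^*f=\nabla\times f$ in $H^{r-1}$. 5. $(\Pi\mathcal C^*)^*=\Pi\mathcal C^*$: for $f\in H^r$ and $\psi\in H^{s-r}$, $\langle\Pi\mathcal C^*f,\psi\rangle=\langle f,\Pi\mathcal C^*\psi\rangle$, where $\langle\cdot,\cdot\rangle$ is the duality pairing extending the $L^2$ inner product. -/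

import Mathlib

open MeasureTheory Filter Topology FourierTransform TemperedDistribution
open scoped SchwartzMap LineDeriv ENNReal

noncomputable section

namespace FracMaxwell

/-- Physical space `ℝ³`. -/
abbrev E3 : Type := EuclideanSpace ℝ (Fin 3)

/-- Values of vector fields, `ℂ³` (real vector fields are a special case). -/
abbrev V3 : Type := EuclideanSpace ℂ (Fin 3)

/-! ### Vector algebra -/

/-- The vector product on `ℂ³`. -/
def cross (a b : V3) : V3 :=
  !₂[a 1 * b 2 - a 2 * b 1, a 2 * b 0 - a 0 * b 2, a 0 * b 1 - a 1 * b 0]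

/-- A real vector, regarded as a vector of `ℂ³`. -/
def toV3 (a : E3) : V3 := WithLp.toLp 2 (fun i => (a i : ℂ))

/-- The `j`-th standard basis vector of `ℝ³`. -/
def basisE (j : Fin 3) : E3 := EuclideanSpace.single j 1

/-- `z ↦ z e_j`. -/
def embedCLM (j : Fin 3) : ℂ →L[ℂ] V3 :=
  LinearMap.toContinuousLinearMap
    { toFun := fun z => z • toV3 (basisE j)
      map_add' := fun _ _ => add_smul _ _ _
      map_smul' := fun _ _ => by simp [mul_smul] }

/-- `v ↦ v_j`. -/
def coordCLM (j : Fin 3) : V3 →L[ℂ] ℂ :=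
  LinearMap.toContinuousLinearMap
    { toFun := fun v => v j
      map_add' := fun _ _ => rfl
      map_smul' := fun _ _ => rfl }

/-- `v ↦ e_j × v`. -/
def crossCLM (j : Fin 3) : V3 →L[ℂ] V3 :=
  LinearMap.toContinuousLinearMap
    { toFun := fun v => cross (toV3 (basisE j)) v
      map_add' := fun v w => by
        ext i; fin_cases i <;> simp [cross] <;> ring
      map_smul' := fun c v => by
        ext i; fin_cases i <;> simp [cross] <;> ring }

/-! ### Classical differential operators on functions -/

/-- The gradient of a scalar function. -/
def gradFun (f : E3 → ℂ) (x : E3) : V3 :=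
  WithLp.toLp 2 (fun j => fderiv ℝ f x (basisE j))

/-- The curl of a vector field, `∑ⱼ eⱼ × ∂ⱼ f`. -/
def curlFun (f : E3 → V3) (x : E3) : V3 :=
  ∑ j : Fin 3, cross (toV3 (basisE j)) (fderiv ℝ f x (basisE j))

/-! ### Differential operators on tempered distributions -/

/-- The gradient of a scalar tempered distribution. -/
def grad (u : 𝓢'(E3, ℂ)) : 𝓢'(E3, V3) :=
  ∑ j : Fin 3, PointwiseConvergenceCLM.postcomp 𝓢(E3, ℂ) (embedCLM j) (∂_{basisE j} u)

/-- The curl of a vector-valued tempered distribution, `∑ⱼ eⱼ × ∂ⱼ u`. -/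
def curl (u : 𝓢'(E3, V3)) : 𝓢'(E3, V3) :=
  ∑ j : Fin 3, PointwiseConvergenceCLM.postcomp 𝓢(E3, ℂ) (crossCLM j) (∂_{basisE j} u)

/-- The divergence of a vector-valued tempered distribution. -/
def divergence (u : 𝓢'(E3, V3)) : 𝓢'(E3, ℂ) :=
  ∑ j : Fin 3, PointwiseConvergenceCLM.postcomp 𝓢(E3, ℂ) (coordCLM j) (∂_{basisE j} u)

/-! ### Sobolev spaces -/

section Sobolev

variable (F : Type) [NormedAddCommGroup F] [InnerProductSpace ℂ F] [CompleteSpace F]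

/-- The tempered distributions in `H^r(ℝ³; F)`, as a submodule. -/
def sobSubmodule (r : ℝ) : Submodule ℂ 𝓢'(E3, F) where
  carrier := {u | MemSobolev r 2 u}
  add_mem' hu hv := hu.add hv
  zero_mem' := memSobolev_fun_zero E3 F r 2
  smul_mem' c _ hu := hu.smul c

/-- The Sobolev space `H^r(ℝ³; F)`, `r ∈ ℝ` (normed below by `‖⟨D⟩^r u‖_{L²}`). -/
def Sob (r : ℝ) : Type := sobSubmodule F r

instance (r : ℝ) : AddCommGroup (Sob F r) := inferInstanceAs (AddCommGroup (sobSubmodule F r))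

instance (r : ℝ) : Module ℂ (Sob F r) := inferInstanceAs (Module ℂ (sobSubmodule F r))

variable {F}

/-- The tempered distribution underlying an element of `H^r`. -/
def Sob.dist {r : ℝ} : Sob F r →ₗ[ℂ] 𝓢'(E3, F) := (sobSubmodule F r).subtype

theorem Sob.dist_injective {r : ℝ} : Function.Injective (Sob.dist (F := F) (r := r)) :=
  Subtype.val_injective

theorem Sob.memSobolev {r : ℝ} (u : Sob F r) : MemSobolev r 2 u.dist := u.2

theorem lp_dist_injective :
    Function.Injective (Lp.toTemperedDistributionCLM F (volume : Measure E3) 2) :=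
  LinearMap.ker_eq_bot.mp Lp.ker_toTemperedDistributionCLM_eq_bot

theorem Sob.exists_l2 {r : ℝ} (u : Sob F r) : ∃ g : Lp F 2 (volume : Measure E3),
    besselPotential E3 F r u.dist = Lp.toTemperedDistributionCLM F volume 2 g := u.2

/-- The `L²` function `⟨D⟩^r u` for `u ∈ H^r`. -/
def Sob.toL2 {r : ℝ} : Sob F r →ₗ[ℂ] Lp F 2 (volume : Measure E3) where
  toFun u := u.exists_l2.choose
  map_add' u v := lp_dist_injective <| by
    refine (u + v).exists_l2.choose_spec.symm.trans ?_
    rw [map_add Sob.dist, map_add, map_add]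
    exact congrArg₂ _ u.exists_l2.choose_spec v.exists_l2.choose_spec
  map_smul' c u := lp_dist_injective <| by
    refine (c • u).exists_l2.choose_spec.symm.trans ?_
    rw [map_smul Sob.dist, map_smul, RingHom.id_apply, map_smul]
    exact congrArg _ u.exists_l2.choose_spec

theorem Sob.toL2_spec {r : ℝ} (u : Sob F r) :
    besselPotential E3 F r u.dist = Lp.toTemperedDistributionCLM F volume 2 u.toL2 :=
  u.exists_l2.choose_spec

theorem Sob.toL2_injective {r : ℝ} : Function.Injective (Sob.toL2 (F := F) (r := r)) := by
  intro u v h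
  apply Sob.dist_injective
  have h1 : besselPotential E3 F r u.dist = besselPotential E3 F r v.dist := by
    rw [Sob.toL2_spec, Sob.toL2_spec, h]
  have h2 := congrArg (besselPotential E3 F (-r)) h1
  simpa using h2

instance (r : ℝ) : NormedAddCommGroup (Sob F r) :=
  NormedAddCommGroup.induced _ _ Sob.toL2 Sob.toL2_injective

instance (r : ℝ) : NormedSpace ℂ (Sob F r) := NormedSpace.induced ℂ _ _ Sob.toL2

/-- The `H^r` norm of an arbitrary tempered distribution (`∞` outside of `H^r`). -/
def sobENorm (r : ℝ) (u : 𝓢'(E3, F)) : ℝ≥0∞ :=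
  ⨅ (g : Lp F 2 (volume : Measure E3))
    (_ : besselPotential E3 F r u = Lp.toTemperedDistributionCLM F volume 2 g), ‖g‖ₑ

theorem sobENorm_dist {r : ℝ} (u : Sob F r) : sobENorm r u.dist = ‖u‖ₑ := by
  have h : ‖u‖ₑ = ‖u.toL2‖ₑ := rfl
  rw [h]
  refine le_antisymm (iInf₂_le (κ := fun g => besselPotential E3 F r u.dist =
    Lp.toTemperedDistributionCLM F volume 2 g) (f := fun g _ => ‖g‖ₑ) u.toL2 u.toL2_spec) (le_iInf₂ fun g hg => ?_)
  rw [lp_dist_injective (u.toL2_spec.symm.trans hg)]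

/-- A Schwartz function as an element of `H^r`. -/
def ofSchwartz (r : ℝ) (w : 𝓢(E3, F)) : Sob F r :=
  ⟨(w : 𝓢'(E3, F)), w.memSobolev⟩

/-- The duality pairing `⟨u, v⟩` of `H^a` and `H^b = (H^a)*`, `a + b = 0`, extending the `L²`
inner product `∫ u · v̄`. -/
def dualityPairing {a b : ℝ} (_h : a + b = 0) (u : Sob F a) (v : Sob F b) : ℂ :=
  inner ℂ v.toL2 u.toL2

end Sobolev

/-! ### Distributions given by functions, Riesz potentials -/

/-- The tempered distribution `u` is the function `h`: `u(φ) = ∫ φ h` for Schwartz `φ`, with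
absolutely convergent integrals. -/
def IsFun {X F : Type} [NormedAddCommGroup X] [NormedSpace ℝ X] [MeasureSpace X]
    [NormedAddCommGroup F] [NormedSpace ℂ F] (u : 𝓢'(X, F)) (h : X → F) : Prop :=
  ∀ φ : 𝓢(X, ℂ), Integrable (fun x => φ x • h x) ∧ u φ = ∫ x, φ x • h x

/-- `v = I_σ u = (-Δ)^{-σ/2} u`: the Fourier transform of `u` is a function `g` and that of `v` is
`|ξ|^{-σ} g`. With Mathlib's normalisation of the Fourier transform (`e^{-2πi x·ξ}`) the symbol
`|ξ|` is `2π‖ξ‖`. -/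
def IsRieszPotential {F : Type} [NormedAddCommGroup F] [InnerProductSpace ℂ F]
    (σ : ℝ) (u v : 𝓢'(E3, F)) : Prop :=
  ∃ g : E3 → F, IsFun (𝓕 u) g ∧
    IsFun (𝓕 v) (fun ξ => (((2 * Real.pi * ‖ξ‖) ^ (-σ) : ℝ) : ℂ) • g ξ)

/-- The constant `C_{n,t} = 2^t Γ((n+t)/2) / (π^{n/2} |Γ(-t/2)|)` for `n = 3`. -/
def fracConst (t : ℝ) : ℝ :=
  2 ^ t * Real.Gamma ((3 + t) / 2) / (Real.pi ^ (3 / 2 : ℝ) * |Real.Gamma (-t / 2)|)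

/-- The integrand of the Riesz potential `I_σ g(x) = C_{3,-σ} ∫ g(y) / |x-y|^{3-σ} dy`. -/
def rieszIntegrand (σ : ℝ) (g : E3 → V3) (x y : E3) : V3 :=
  ((fracConst (-σ) / ‖x - y‖ ^ (3 - σ) : ℝ) : ℂ) • g y

/-- The Riesz potential of a function, as a convolution. -/
def rieszFun (σ : ℝ) (g : E3 → V3) (x : E3) : V3 :=
  ∫ y, rieszIntegrand σ g x y

/-! ### Fractional gradient and curl, and the projection `Π`, on functions -/

/-- The antisymmetric kernel
`α(x,y) = (C_{3,s}^{1/2} / √2) (y-x) / |y-x|^{3/2+s+1}`. -/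
def alpha (s : ℝ) (x y : E3) : E3 :=
  (Real.sqrt (fracConst s) / Real.sqrt 2 / ‖y - x‖ ^ (3 / 2 + s + 1)) • (y - x)

/-- `D*u(x,y) = -(u(y) - u(x)) α(x,y)`. -/
def dStar (s : ℝ) (u : E3 → ℂ) (x y : E3) : V3 :=
  -((u y - u x) • toV3 (alpha s x y))

/-- `C*w(x,y) = α(x,y) × (w(y) - w(x))`. -/
def cStar (s : ℝ) (w : E3 → V3) (x y : E3) : V3 :=
  cross (toV3 (alpha s x y)) (w y - w x)

/-- The positive normalising constant `c = √2 (s+2) C_{3,s-1} / C_{3,s}^{1/2}` of `Π`. -/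
def piConst (s : ℝ) : ℝ :=
  Real.sqrt 2 * (s + 2) * fracConst (s - 1) / Real.sqrt (fracConst s)

/-- The integrand of `Πv(x)`. -/
def piIntegrand (s : ℝ) (v : E3 → E3 → V3) (x y : E3) : V3 :=
  ((piConst s / ‖x - y‖ ^ (3 / 2 : ℝ) : ℝ) : ℂ) • v x y

/-- `Πv(x) = c ∫ v(x,y) / |x-y|^{3/2} dy`. -/
def piFun (s : ℝ) (v : E3 → E3 → V3) (x : E3) : V3 :=
  ∫ y, piIntegrand s v x y

/-! ### Extension by density to Sobolev spaces -/

/-- The bounded operator `T : H^r → H^t` extends the operator `P`, given on `C_c^∞` functions. -/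
def ExtendsOne {F : Type} [NormedAddCommGroup F] [InnerProductSpace ℂ F] [CompleteSpace F]
    {r t : ℝ} (P : (E3 → F) → E3 → V3) (T : Sob F r →L[ℂ] Sob V3 t) : Prop :=
  ∀ w : 𝓢(E3, F), HasCompactSupport w → IsFun (T (ofSchwartz r w)).dist (P w)

/-- The continuous operator `T` from `H^t` to the two-point distributions extends the operator `P`,
given on `C_c^∞` functions. -/
def ExtendsTwo {F : Type} [NormedAddCommGroup F] [InnerProductSpace ℂ F] [CompleteSpace F]
    {t : ℝ} (P : (E3 → F) → E3 → E3 → V3) (T : Sob F t →L[ℂ] 𝓢'(E3 × E3, V3)) : Prop :=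
  ∀ w : 𝓢(E3, F), HasCompactSupport w →
    IsFun (T (ofSchwartz t w)) (fun p : E3 × E3 => P w p.1 p.2)

/-- `ΠD* : H^r → H^{r-s}`, the extension by density of `w ↦ Π(D*w)` (the theorem asserts that
there is exactly one such extension; likewise for the next three operators). -/
def PiD (s r : ℝ) : Sob ℂ r →L[ℂ] Sob V3 (r - s) :=
  Classical.epsilon (ExtendsOne (fun w => piFun s (dStar s w)))

/-- `ΠC* : H^r → H^{r-s}`, the extension by density of `w ↦ Π(C*w)`. -/
def PiC (s r : ℝ) : Sob V3 r →L[ℂ] Sob V3 (r - s) :=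
  Classical.epsilon (ExtendsOne (fun w => piFun s (cStar s w)))

/-- `D*` on `H^t`, with values in the two-point distributions, extended by density from `C_c^∞`. -/
def DStar (s t : ℝ) : Sob ℂ t →L[ℂ] 𝓢'(E3 × E3, V3) :=
  Classical.epsilon (ExtendsTwo (dStar s))

/-- `C*` on `H^t`, with values in the two-point distributions, extended by density from `C_c^∞`. -/
def CStar (s t : ℝ) : Sob V3 t →L[ℂ] 𝓢'(E3 × E3, V3) :=
  Classical.epsilon (ExtendsTwo (cStar s))

/-! ### Fields with a fractional Helmholtz decomposition -/

/-- `φ, A ∈ H^{r+s}` with `∇·A = 0` are potentials of the two-point field `W = D*φ + C*A`. -/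
def IsPotential (s r : ℝ) (φ : Sob ℂ (r + s)) (A : Sob V3 (r + s)) (W : 𝓢'(E3 × E3, V3)) : Prop :=
  divergence A.dist = 0 ∧ W = DStar s (r + s) φ + CStar s (r + s) A

theorem divergence_zero : divergence 0 = 0 := by
  simp only [divergence, ← LineDeriv.lineDerivOpCLM_apply (R := ℂ), map_zero, Finset.sum_const_zero]

theorem divergence_add (u v : 𝓢'(E3, V3)) :
    divergence (u + v) = divergence u + divergence v := by
  simp only [divergence, ← LineDeriv.lineDerivOpCLM_apply (R := ℂ), map_add, Finset.sum_add_distrib]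

theorem divergence_smul (c : ℂ) (u : 𝓢'(E3, V3)) : divergence (c • u) = c • divergence u := by
  simp only [divergence, ← LineDeriv.lineDerivOpCLM_apply (R := ℂ), map_smul, Finset.smul_sum]

/-- The space `H^r_{fHd}(ℝ³ × ℝ³) = {D*φ + C*A : φ, A ∈ H^{r+s}, ∇·A = 0}`. -/
def fHd (s r : ℝ) : Submodule ℂ 𝓢'(E3 × E3, V3) where
  carrier := {W | ∃ φ A, IsPotential s r φ A W}
  zero_mem' := ⟨0, 0, by simp [divergence_zero], by simp⟩
  add_mem' := by
    rintro W W' ⟨φ, A, hA, rfl⟩ ⟨φ', A', hA', rfl⟩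
    refine ⟨φ + φ', A + A', ?_, ?_⟩
    · rw [map_add, divergence_add, hA, hA', add_zero]
    · rw [map_add, map_add]; abel
  smul_mem' := by
    rintro c W ⟨φ, A, hA, rfl⟩
    refine ⟨c • φ, c • A, ?_, ?_⟩
    · rw [map_smul, divergence_smul, hA]
      ext φ
      exact smul_zero c
    · rw [map_smul, map_smul, smul_add]

/-- The norm of `H^r_{fHd}`, induced by the norms of the potentials:
`‖W‖ = inf {‖φ‖_{H^{r+s}} + ‖A‖_{H^{r+s}} : W = D*φ + C*A, ∇·A = 0}`. -/
def fHdNorm (s r : ℝ) (W : fHd s r) : ℝ :=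
  sInf {ρ : ℝ | ∃ φ A, IsPotential s r φ A (W : 𝓢'(E3 × E3, V3)) ∧ ρ = ‖φ‖ + ‖A‖}

end FracMaxwell

end

open FracMaxwell

set_option linter.unusedSectionVars false

noncomputable section

namespace FracMaxwell


/-! ### Distributions given by functions -/

namespace IsFun

variable {X F G : Type} [NormedAddCommGroup X] [NormedSpace ℝ X] [MeasureSpace X]
  [NormedAddCommGroup F] [NormedSpace ℂ F] [NormedAddCommGroup G] [NormedSpace ℂ G]

/-! Both `dStar` and `cStar` have the form `∑ⱼ αⱼ(x,y) Bⱼ (w(y) - w(x))` with constant matrices `Bⱼ`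
(`z ↦ -z eⱼ`, respectively `v ↦ eⱼ × v`), and almost everything is proved once for general `B`.

In the variable `z = y - x`, the weight of `Π` times `α` is `(2+s) C_{3,s-1} z |z|^{-4-s}`, which is
minus the gradient of `C_{3,s-1} |z|^{-2-s}`. Integration by parts moves this gradient onto `w` and
leaves the Riesz kernel of order `1-s`, since `3 - (1-s) = 2+s`. This gives the pointwise formulas
(`integral_rpow_smul_lineDeriv`, `pi_starB`). The kernel is not integrable without the difference
`w(y) - w(x)`, so the integration by parts is done for `(|z|² + ε)^{-a}` and `ε` is sent to 0.

Convolution with the Riesz kernel is multiplication by `|ξ|^{-σ}` on the Fourier side: both kernels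
are superpositions of Gaussians, for which Parseval is explicit (`integral_riesz_kernel`). Hence the
operator has the symbol `(2π|ξ|)^{s-1} ∑ⱼ 2πi ξⱼ Bⱼ`, which is `O(⟨ξ⟩^s)`. It is bounded from `H^r`
to `H^{r-s}`, and density of compactly supported functions makes the extension unique. The remaining
properties of `ΠD*` and `ΠC*` are read off the symbol: `ξ × ξ = 0` gives `ΠC*ΠD* = 0`, the matrix of
`iξ ×` is Hermitian, and the limit `s → 1` is dominated convergence.

That `Π` is well defined on `H^r_{fHd}` is a separate matter: the two-point field has to determine
its potentials (`potentials_eq_zero`). By duality, `D*` and `C*` are transposes of maps of Schwartz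
spaces (`marginal`). Testing a vanishing field with `κ(y-x) ρ(x)`, `κ` arbitrary, shows `∑ⱼ hⱼ Bⱼ
(difference of the potentials by h) = 0` for every `h`. For `h = e_k` the scalar part is parallel to
`e_k` and the vector part is orthogonal to it, so both vanish. On the Fourier side the factor
`e^{2πi ξ_k} - 1` is nonzero almost everywhere and can be divided out. -/

theorem congr_ae {u : 𝓢'(X, F)} {h h' : X → F} (hu : IsFun u h) (hh : h =ᵐ[volume] h') :
    IsFun u h' := by
  intro φ
  have e : (fun x => φ x • h x) =ᵐ[volume] fun x => φ x • h' x := by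
    filter_upwards [hh] with x hx
    rw [hx]
  exact ⟨(hu φ).1.congr e, (hu φ).2.trans (integral_congr_ae e)⟩

theorem add {u v : 𝓢'(X, F)} {h k : X → F} (hu : IsFun u h) (hv : IsFun v k) :
    IsFun (u + v) (fun x => h x + k x) := by
  intro φ
  simp only [smul_add]
  refine ⟨(hu φ).1.add (hv φ).1, ?_⟩
  rw [integral_add (hu φ).1 (hv φ).1, ← (hu φ).2, ← (hv φ).2]
  rfl

theorem neg {u : 𝓢'(X, F)} {h : X → F} (hu : IsFun u h) : IsFun (-u) (fun x => -h x) := by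
  intro φ
  simp only [smul_neg]
  refine ⟨(hu φ).1.neg, ?_⟩
  rw [integral_neg, ← (hu φ).2]
  rfl

theorem sub {u v : 𝓢'(X, F)} {h k : X → F} (hu : IsFun u h) (hv : IsFun v k) :
    IsFun (u - v) (fun x => h x - k x) := by
  simpa only [sub_eq_add_neg] using hu.add hv.neg

theorem zero : IsFun (0 : 𝓢'(X, F)) (fun _ => 0) := by
  intro φ
  simp

theorem sum {ι : Type} {s : Finset ι} {u : ι → 𝓢'(X, F)} {h : ι → X → F}
    (hu : ∀ i ∈ s, IsFun (u i) (h i)) : IsFun (∑ i ∈ s, u i) (fun x => ∑ i ∈ s, h i x) := by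
  classical
  induction s using Finset.induction_on with
  | empty => simpa using zero
  | insert a s ha ih =>
    simp only [Finset.sum_insert ha]
    exact (hu a (by simp)).add (ih fun i hi => hu i (by simp [hi]))

theorem smul {u : 𝓢'(X, F)} {h : X → F} (c : ℂ) (hu : IsFun u h) :
    IsFun (c • u) (fun x => c • h x) := by
  intro φ
  simp only [smul_comm (_ : ℂ) c]
  refine ⟨(hu φ).1.smul c, ?_⟩
  rw [integral_smul, ← (hu φ).2]
  rfl

theorem smulLeft {u : 𝓢'(X, F)} {h : X → F} {g : X → ℂ} (hg : g.HasTemperateGrowth)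
    (hu : IsFun u h) : IsFun (smulLeftCLM F g u) (fun x => g x • h x) := by
  intro φ
  have := hu (SchwartzMap.smulLeftCLM ℂ g φ)
  simp only [SchwartzMap.smulLeftCLM_apply_apply hg, smul_eq_mul, mul_comm (g _), mul_smul] at this
  exact this

theorem postcomp [CompleteSpace F] [CompleteSpace G] {u : 𝓢'(X, F)} {h : X → F} (L : F →L[ℂ] G)
    (hu : IsFun u h) :
    IsFun (PointwiseConvergenceCLM.postcomp 𝓢(X, ℂ) L u) (fun x => L (h x)) := by
  intro φ
  simp only [← L.map_smul]
  refine ⟨L.integrable_comp (hu φ).1, ?_⟩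
  rw [L.integral_comp_comm (hu φ).1, ← (hu φ).2]
  rfl

theorem eq_of_ae {u v : 𝓢'(X, F)} {h k : X → F} (hu : IsFun u h) (hv : IsFun v k)
    (hk : h =ᵐ[volume] k) : u = v := by
  ext φ
  rw [(hu φ).2, ((hv.congr_ae hk.symm) φ).2]

/-- Testing with a bump that equals 1 near a point shows that the difference is locally integrable;
the fundamental lemma of the calculus of variations then applies. -/
theorem ae_eq [FiniteDimensional ℝ X] [BorelSpace X] [CompleteSpace F]
    {u : 𝓢'(X, F)} {h k : X → F} (hu : IsFun u h) (hv : IsFun u k) :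
    h =ᵐ[volume] k := by
  have hd := hu.sub hv
  rw [sub_self] at hd
  have key : (fun x => h x - k x) =ᵐ[volume] 0 := by
    refine ae_eq_zero_of_integral_contDiff_smul_eq_zero ?_ ?_
    · intro x
      obtain ⟨f, hf⟩ : ∃ f : ContDiffBump x, True := ⟨⟨1, 2, one_pos, one_lt_two⟩, trivial⟩
      have hg₁ : HasCompactSupport (Complex.ofRealCLM ∘ f) := f.hasCompactSupport.comp_left rfl
      have hg₂ : ContDiff ℝ (⊤ : ℕ∞) (Complex.ofRealCLM ∘ f) :=
        Complex.ofRealCLM.contDiff.comp f.contDiff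
      refine ⟨Metric.closedBall x f.rIn, Metric.closedBall_mem_nhds x f.rIn_pos, ?_⟩
      refine ((hd (hg₁.toSchwartzMap hg₂)).1.integrableOn
        (s := Metric.closedBall x f.rIn)).congr_fun ?_ Metric.isClosed_closedBall.measurableSet
      intro y hy
      have : f y = 1 := f.one_of_mem_closedBall hy
      simp [this]
    · intro g g_smooth g_cpt
      have hg₁ : HasCompactSupport (Complex.ofRealCLM ∘ g) := g_cpt.comp_left rfl
      have hg₂ : ContDiff ℝ (⊤ : ℕ∞) (Complex.ofRealCLM ∘ g) :=
        Complex.ofRealCLM.contDiff.comp g_smooth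
      have := (hd (hg₁.toSchwartzMap hg₂)).2
      simpa using this.symm
  filter_upwards [key] with x hx
  exact sub_eq_zero.mp hx

end IsFun

/-! ### Sobolev spaces on the Fourier side -/

section SobolevIso

variable {F : Type} [NormedAddCommGroup F] [InnerProductSpace ℂ F] [CompleteSpace F]

theorem isFun_schwartz (w : 𝓢(E3, F)) : IsFun (w : 𝓢'(E3, F)) w := by
  intro φ
  refine ⟨?_, by simp⟩
  exact (SchwartzMap.pairing (ContinuousLinearMap.lsmul ℂ ℂ) φ w).integrable

theorem isFun_lp (g : Lp F 2 (volume : Measure E3)) :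
    IsFun (Lp.toTemperedDistributionCLM F volume 2 g) g := by
  intro φ
  refine ⟨?_, by simp⟩
  exact memLp_one_iff_integrable.mp ((Lp.memLp g).smul (p := 2) (q := 2) (r := 1) (φ.memLp 2))

/-- The Bessel weight `⟨ξ⟩^r`, with the frequency normalised as in Mathlib. -/
def weight (r : ℝ) (ξ : E3) : ℂ := ((1 + ‖ξ‖ ^ 2) ^ (r / 2) : ℝ)

theorem weight_temperate (r : ℝ) : (weight r).HasTemperateGrowth := by
  unfold weight
  fun_prop

theorem weight_mul (r t : ℝ) (ξ : E3) : weight r ξ * weight t ξ = weight (r + t) ξ := by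
  unfold weight
  rw [← Complex.ofReal_mul, ← Real.rpow_add (by positivity), add_div]

theorem weight_zero (ξ : E3) : weight 0 ξ = 1 := by simp [weight]

theorem norm_weight (r : ℝ) (ξ : E3) : ‖weight r ξ‖ = (1 + ‖ξ‖ ^ 2) ^ (r / 2) := by
  rw [weight, Complex.norm_real, Real.norm_of_nonneg (by positivity)]

theorem continuous_weight (r : ℝ) : Continuous (weight r) := (weight_temperate r).1.continuous

variable (F) in
/-- The isometry `⟨D⟩^r : H^r → L²`. -/
def sobEquiv (r : ℝ) : Sob F r ≃ₗᵢ[ℂ] Lp F 2 (volume : Measure E3) where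
  __ := LinearEquiv.ofBijective Sob.toL2 ⟨Sob.toL2_injective, by
    intro g
    have h : besselPotential E3 F r
        (besselPotential E3 F (-r) (Lp.toTemperedDistributionCLM F volume 2 g)) =
        Lp.toTemperedDistributionCLM F volume 2 g := by simp
    refine ⟨⟨besselPotential E3 F (-r) (Lp.toTemperedDistributionCLM F volume 2 g), g, h⟩, ?_⟩
    exact lp_dist_injective ((Sob.toL2_spec _).symm.trans h)⟩
  norm_map' u := rfl

@[simp]
theorem sobEquiv_apply {r : ℝ} (u : Sob F r) : sobEquiv F r u = u.toL2 := rfl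

/-- The Fourier transform of `u ∈ H^r`, as a function. -/
def Sob.hat {r : ℝ} (u : Sob F r) (ξ : E3) : F :=
  weight (-r) ξ • (𝓕 u.toL2 : Lp F 2 (volume : Measure E3)) ξ

theorem Sob.isFun_hat {r : ℝ} (u : Sob F r) : IsFun (𝓕 u.dist) u.hat := by
  have h : u.dist = besselPotential E3 F (-r) (Lp.toTemperedDistributionCLM F volume 2 u.toL2) := by
    rw [← u.toL2_spec]; simp
  rw [h, fourier_besselPotential_eq_smulLeftCLM_fourier_apply]
  have := (isFun_lp (𝓕 u.toL2)).smulLeft (weight_temperate (-r))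
  rw [Lp.toTemperedDistributionCLM_apply, ← Lp.fourier_toTemperedDistribution_eq] at this
  exact this

theorem Sob.dist_eq_of_hat {r t : ℝ} {u : Sob F r} {v : Sob F t} (h : u.hat =ᵐ[volume] v.hat) :
    u.dist = v.dist := by
  have := u.isFun_hat.eq_of_ae v.isFun_hat h
  simpa using congrArg 𝓕⁻ this

theorem Sob.ext_hat {r : ℝ} {u v : Sob F r} (h : u.hat =ᵐ[volume] v.hat) : u = v :=
  Sob.dist_injective (Sob.dist_eq_of_hat h)

theorem hat_ofSchwartz (r : ℝ) (w : 𝓢(E3, F)) :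
    (ofSchwartz r w).hat =ᵐ[volume] (𝓕 w : 𝓢(E3, F)) := by
  refine (ofSchwartz r w).isFun_hat.ae_eq ?_
  have := isFun_schwartz (𝓕 w)
  rw [← TemperedDistribution.fourier_toTemperedDistributionCLM_eq] at this
  exact this

theorem isFun_dist_apply {u : 𝓢'(E3, F)} {h : E3 → F} (hu : IsFun (𝓕 u) h) (φ : 𝓢(E3, ℂ)) :
    u φ = ∫ ξ, (𝓕⁻ φ) ξ • h ξ := by
  rw [← (hu (𝓕⁻ φ)).2, TemperedDistribution.fourier_apply, fourier_fourierInv_eq]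

/-- The `H^t` norm of a distribution is the `L²` norm of `⟨ξ⟩^t` times its Fourier transform. -/
theorem sobENorm_le_of_isFun {t : ℝ} {u : 𝓢'(E3, F)} {h : E3 → F} (hu : IsFun (𝓕 u) h)
    (hh : MemLp (fun ξ => weight t ξ • h ξ) 2) :
    sobENorm t u ≤ eLpNorm (fun ξ => weight t ξ • h ξ) 2 := by
  have h1 : besselPotential E3 F t u = Lp.toTemperedDistributionCLM F volume 2 (𝓕⁻ hh.toLp) := by
    have h2 : 𝓕 (besselPotential E3 F t u) = Lp.toTemperedDistributionCLM F volume 2 hh.toLp := by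
      rw [fourier_besselPotential_eq_smulLeftCLM_fourier_apply]
      exact (hu.smulLeft (weight_temperate t)).eq_of_ae (isFun_lp hh.toLp) hh.coeFn_toLp.symm
    have h3 := congrArg 𝓕⁻ h2
    rw [fourierInv_fourier_eq, Lp.toTemperedDistributionCLM_apply,
      Lp.fourierInv_toTemperedDistribution_eq] at h3
    exact h3
  refine (iInf₂_le (κ := fun g => besselPotential E3 F t u =
    Lp.toTemperedDistributionCLM F volume 2 g) (f := fun g _ => ‖g‖ₑ) (𝓕⁻ hh.toLp) h1).trans ?_
  have h4 : ‖(𝓕⁻ hh.toLp : Lp F 2 (volume : Measure E3))‖ = ‖hh.toLp‖ :=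
    (Lp.fourierTransformₗᵢ E3 F).symm.norm_map _
  rw [← ofReal_norm, h4, Lp.norm_toLp, ENNReal.ofReal_toReal hh.2.ne]

end SobolevIso

/-! ### Density of compactly supported functions -/

section Density

variable {E F : Type} [NormedAddCommGroup E] [InnerProductSpace ℝ E] [FiniteDimensional ℝ E]
  [NormedAddCommGroup F] [NormedSpace ℝ F]

/-- The cutoff `w ↦ χ(x/(N+1)) w`. -/
def cutoff (χ : ContDiffBump (0 : E)) (N : ℕ) (w : 𝓢(E, F)) : 𝓢(E, F) :=
  SchwartzMap.smulLeftCLM F (fun x => χ (((N : ℝ) + 1)⁻¹ • x)) w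

theorem cutoff_temperate (χ : ContDiffBump (0 : E)) (N : ℕ) :
    (fun x : E => χ (((N : ℝ) + 1)⁻¹ • x)).HasTemperateGrowth := by
  have h : (χ : E → ℝ).HasTemperateGrowth := χ.hasCompactSupport.hasTemperateGrowth χ.contDiff
  exact h.comp ((((N : ℝ) + 1)⁻¹ • ContinuousLinearMap.id ℝ E).hasTemperateGrowth)

theorem cutoff_apply (χ : ContDiffBump (0 : E)) (N : ℕ) (w : 𝓢(E, F)) (x : E) :
    cutoff χ N w x = χ (((N : ℝ) + 1)⁻¹ • x) • w x :=
  SchwartzMap.smulLeftCLM_apply_apply (cutoff_temperate χ N) w x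

theorem hasCompactSupport_cutoff (χ : ContDiffBump (0 : E)) (N : ℕ) (w : 𝓢(E, F)) :
    HasCompactSupport (cutoff χ N w) := by
  have h : HasCompactSupport (fun x : E => χ (((N : ℝ) + 1)⁻¹ • x)) :=
    χ.hasCompactSupport.comp_smul (by positivity)
  have : (cutoff χ N w : E → F) = (fun x : E => χ (((N : ℝ) + 1)⁻¹ • x)) • (w : E → F) := by
    ext x
    exact cutoff_apply χ N w x
  rw [this]
  exact h.smul_right

/-- The dilation factor `1/(N+1)` is at most 1, so differentiating the dilated bump only improves
the bounds of the bump itself. -/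
theorem exists_bound_cutoff (χ : ContDiffBump (0 : E)) (i : ℕ) :
    ∃ C, ∀ (N : ℕ) (x : E), ‖iteratedFDeriv ℝ i (fun x : E => χ (((N : ℝ) + 1)⁻¹ • x)) x‖ ≤ C := by
  obtain ⟨C, hC⟩ := (χ.hasCompactSupport.iteratedFDeriv (𝕜 := ℝ) i).exists_bound_of_continuous
    ((χ.contDiff (n := i)).continuous_iteratedFDeriv le_rfl)
  refine ⟨C, fun N x => ?_⟩
  have hc : ‖((N : ℝ) + 1)⁻¹ • ContinuousLinearMap.id ℝ E‖ ≤ 1 := by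
    refine ContinuousLinearMap.opNorm_le_bound _ zero_le_one fun y => ?_
    have h0 : (0 : ℝ) ≤ N := N.cast_nonneg
    have : ((N : ℝ) + 1)⁻¹ ≤ 1 := inv_le_one_of_one_le₀ (by linarith)
    simp only [smul_apply, ContinuousLinearMap.id_apply, norm_smul, norm_inv]
    rw [Real.norm_of_nonneg (by positivity)]
    gcongr
  have h := (((N : ℝ) + 1)⁻¹ • ContinuousLinearMap.id ℝ E).iteratedFDeriv_comp_right
    (χ.contDiff (n := i)) x (i := i) le_rfl
  have h' : (χ : E → ℝ) ∘ (((N : ℝ) + 1)⁻¹ • ContinuousLinearMap.id ℝ E) =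
    fun x : E => χ (((N : ℝ) + 1)⁻¹ • x) := rfl
  rw [h'] at h
  rw [h]
  refine (ContinuousMultilinearMap.norm_compContinuousLinearMap_le _ _).trans ?_
  refine (mul_le_of_le_one_right (norm_nonneg _) ?_).trans (hC _)
  exact Finset.prod_le_one (fun _ _ => norm_nonneg _) fun _ _ => hc

/-- The error vanishes for `‖x‖ < N + 1`, because the bump is 1 on the unit ball. Elsewhere `1 ≤
‖x‖/(N+1)`, so one more power of `‖x‖` in the seminorms of `w` buys the rate `K/(N+1)`; the Leibniz
rule gives `K`. -/
theorem tendsto_cutoff (χ : ContDiffBump (0 : E)) (hχ : χ.rIn = 1) (w : 𝓢(E, F)) :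
    Tendsto (fun N => cutoff χ N w) atTop (𝓝 w) := by
  rw [(schwartz_withSeminorms ℝ E F).tendsto_nhds]
  rintro ⟨k, n⟩ ε hε
  choose C hC using exists_bound_cutoff χ
  set K : ℝ := (∑ i ∈ Finset.range (n + 1), (n.choose i : ℝ) * C i *
    SchwartzMap.seminorm ℝ (k + 1) (n - i) w) + SchwartzMap.seminorm ℝ (k + 1) n w with hK
  have hC0 : ∀ i, 0 ≤ C i := fun i => (norm_nonneg _).trans (hC i 0 0)
  have hK0 : 0 ≤ K := by
    refine add_nonneg (Finset.sum_nonneg fun i _ => ?_) (apply_nonneg _ _)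
    exact mul_nonneg (mul_nonneg (by positivity) (hC0 i)) (apply_nonneg _ _)
  have key : ∀ N : ℕ, SchwartzMap.seminorm ℝ k n (cutoff χ N w - w) ≤ K / (N + 1) := by
    intro N
    have hN : (0 : ℝ) < N + 1 := by positivity
    refine SchwartzMap.seminorm_le_bound ℝ k n _ (by positivity) fun x => ?_
    have e1 : ((cutoff χ N w - w : 𝓢(E, F)) : E → F) =
        (fun y => χ (((N : ℝ) + 1)⁻¹ • y) • w y) - fun y => w y := by
      ext y
      simp [cutoff_apply]
    rcases lt_or_ge ‖x‖ (N + 1) with hx | hx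
    · have e2 : ((cutoff χ N w - w : 𝓢(E, F)) : E → F) =ᶠ[𝓝 x] fun _ => 0 := by
        have : ∀ᶠ y in 𝓝 x, ‖y‖ < N + 1 := continuous_norm.continuousAt.eventually_lt_const hx
        filter_upwards [this] with y hy
        rw [e1]
        have : χ (((N : ℝ) + 1)⁻¹ • y) = 1 := by
          apply χ.one_of_mem_closedBall
          rw [mem_closedBall_zero_iff, hχ, norm_smul, norm_inv, Real.norm_of_nonneg hN.le,
            inv_mul_le_iff₀ hN]
          linarith
        simp [this]
      rw [(e2.iteratedFDeriv ℝ n).eq_of_nhds]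
      have : iteratedFDeriv ℝ n (fun _ : E => (0 : F)) x = 0 := by
        simp
      rw [this, norm_zero, mul_zero]
      positivity
    · have hs1 : ContDiff ℝ n (fun y : E => χ (((N : ℝ) + 1)⁻¹ • y)) :=
        χ.contDiff.comp (contDiff_const_smul _)
      have hs2 : ContDiff ℝ n (fun y => w y) := w.smooth n
      have h1 : ‖iteratedFDeriv ℝ n ((cutoff χ N w - w : 𝓢(E, F)) : E → F) x‖ ≤
          (∑ i ∈ Finset.range (n + 1), (n.choose i : ℝ) * C i *
            ‖iteratedFDeriv ℝ (n - i) w x‖) + ‖iteratedFDeriv ℝ n w x‖ := by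
        have e3 := iteratedFDeriv_sub_apply (hs1.smul hs2).contDiffAt
          (hs2.contDiffAt (x := x))
        rw [e1]
        change ‖iteratedFDeriv ℝ n (((fun y => χ (((N : ℝ) + 1)⁻¹ • y)) • fun y => w y) -
          fun y => w y) x‖ ≤ _
        rw [e3]
        refine (norm_sub_le _ _).trans (add_le_add ?_ le_rfl)
        refine (norm_iteratedFDeriv_smul_le hs1 hs2 x le_rfl).trans ?_
        gcongr with i hi
        exact hC i N x
      rw [le_div_iff₀ hN]
      calc ‖x‖ ^ k * ‖iteratedFDeriv ℝ n ((cutoff χ N w - w : 𝓢(E, F)) : E → F) x‖ * (N + 1)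
          ≤ ‖x‖ ^ k * ((∑ i ∈ Finset.range (n + 1), (n.choose i : ℝ) * C i *
            ‖iteratedFDeriv ℝ (n - i) w x‖) + ‖iteratedFDeriv ℝ n w x‖) * ‖x‖ := by
            refine mul_le_mul (mul_le_mul_of_nonneg_left h1 (by positivity)) hx hN.le ?_
            exact mul_nonneg (by positivity) ((norm_nonneg _).trans h1)
        _ = (∑ i ∈ Finset.range (n + 1), (n.choose i : ℝ) * C i *
            (‖x‖ ^ (k + 1) * ‖iteratedFDeriv ℝ (n - i) w x‖)) +
            ‖x‖ ^ (k + 1) * ‖iteratedFDeriv ℝ n w x‖ := by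
            rw [mul_add, add_mul, Finset.mul_sum, Finset.sum_mul]
            congr 1
            · refine Finset.sum_congr rfl fun i _ => ?_
              ring
            · ring
        _ ≤ K := by
            rw [hK]
            gcongr with i hi
            · have := hC0 i
              positivity
            · exact SchwartzMap.le_seminorm ℝ _ _ w x
            · exact SchwartzMap.le_seminorm ℝ _ _ w x
  have hlim : Tendsto (fun N : ℕ => K / ((N : ℝ) + 1)) atTop (𝓝 0) := by
    have := (tendsto_one_div_add_atTop_nhds_zero_nat (𝕜 := ℝ)).const_mul K
    simpa [div_eq_mul_inv] using this
  filter_upwards [hlim.eventually_lt_const hε] with N hN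
  exact (key N).trans_lt hN

theorem dense_hasCompactSupport : Dense {w : 𝓢(E, F) | HasCompactSupport w} := by
  intro w
  obtain ⟨χ, hχ⟩ : ∃ χ : ContDiffBump (0 : E), χ.rIn = 1 := ⟨⟨1, 2, one_pos, one_lt_two⟩, rfl⟩
  exact mem_closure_of_tendsto (tendsto_cutoff χ hχ w)
    (Eventually.of_forall fun N => hasCompactSupport_cutoff χ N w)

end Density

/-! ### Density of test functions in `H^r` and uniqueness of extensions -/

section DensitySob

variable {F : Type} [NormedAddCommGroup F] [InnerProductSpace ℂ F] [CompleteSpace F]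

/-- `⟨D⟩^r` on Schwartz functions. -/
def besselSchwartz (r : ℝ) : 𝓢(E3, F) →L[ℂ] 𝓢(E3, F) :=
  SchwartzMap.fourierMultiplierCLM F (weight r)

theorem toL2_ofSchwartz (r : ℝ) (w : 𝓢(E3, F)) :
    (ofSchwartz r w).toL2 = (besselSchwartz r w).toLp 2 := by
  apply lp_dist_injective
  rw [← Sob.toL2_spec]
  change besselPotential E3 F r (w : 𝓢'(E3, F)) = _
  change fourierMultiplierCLM F (weight r) (w : 𝓢'(E3, F)) = _
  rw [fourierMultiplierCLM_toTemperedDistributionCLM_eq (weight_temperate r),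
    Lp.toTemperedDistributionCLM_apply, Lp.toTemperedDistribution_toLp_eq]
  rfl

theorem besselSchwartz_neg (r : ℝ) (w : 𝓢(E3, F)) :
    besselSchwartz r (besselSchwartz (-r) w) = w := by
  unfold besselSchwartz
  rw [SchwartzMap.fourierMultiplierCLM_fourierMultiplierCLM_apply (weight_temperate r)
    (weight_temperate (-r))]
  have : weight r * weight (-r) = fun _ => 1 := by
    ext ξ
    rw [Pi.mul_apply, weight_mul, add_neg_cancel, weight_zero]
  rw [this, SchwartzMap.fourierMultiplierCLM_const]
  simp

theorem ofSchwartz_eq (r : ℝ) :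
    (ofSchwartz r : 𝓢(E3, F) → Sob F r) =
      fun w => (sobEquiv F r).symm ((besselSchwartz r w).toLp 2) := by
  ext w : 1
  rw [LinearIsometryEquiv.eq_symm_apply, sobEquiv_apply, toL2_ofSchwartz]

theorem continuous_ofSchwartz (r : ℝ) : Continuous (ofSchwartz r : 𝓢(E3, F) → Sob F r) := by
  rw [ofSchwartz_eq]
  exact (sobEquiv F r).symm.continuous.comp
    (SchwartzMap.continuous_toLp.comp (besselSchwartz r).continuous)

/-- `⟨D⟩^r` maps the Schwartz space onto itself, so density in `H^r` reduces to density of Schwartz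
functions in `L²`. -/
theorem denseRange_ofSchwartz (r : ℝ) : DenseRange (ofSchwartz r : 𝓢(E3, F) → Sob F r) := by
  have h1 : DenseRange (fun w : 𝓢(E3, F) => (sobEquiv F r).symm (w.toLp 2)) :=
    (sobEquiv F r).symm.surjective.denseRange.comp
      (SchwartzMap.denseRange_toLpCLM (E := E3) (F := F) ENNReal.ofNat_ne_top)
      (sobEquiv F r).symm.continuous
  refine h1.mono ?_
  rintro _ ⟨w, rfl⟩
  refine ⟨besselSchwartz (-r) w, ?_⟩
  simp only [ofSchwartz_eq, besselSchwartz_neg]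

theorem dense_compactSupport_sob (r : ℝ) :
    Dense (ofSchwartz r '' {w : 𝓢(E3, F) | HasCompactSupport w}) :=
  (denseRange_ofSchwartz r).dense_image (continuous_ofSchwartz r) dense_hasCompactSupport

theorem sob_clm_ext {Y : Type} [TopologicalSpace Y] [AddCommGroup Y] [Module ℂ Y] [T2Space Y]
    {r : ℝ} {S T : Sob F r →L[ℂ] Y}
    (h : ∀ w : 𝓢(E3, F), HasCompactSupport w → S (ofSchwartz r w) = T (ofSchwartz r w)) :
    S = T := by
  ext u
  refine congrFun (Continuous.ext_on (dense_compactSupport_sob r) S.continuous T.continuous ?_) u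
  rintro _ ⟨w, hw, rfl⟩
  exact h w hw

end DensitySob

/-! ### Singular kernels -/

section Kernel

/-- The model kernel `|z|^{-p} (1 + |z|)^{-q}`. -/
def decay (p q : ℝ) (z : E3) : ℝ := ‖z‖ ^ (-p) * (1 + ‖z‖) ^ (-q)

/-- In polar coordinates the integrand is `r^{2-p} (1+r)^{-q}`: `p < 3` settles the origin and `p +
q > 3` settles infinity. -/
theorem integrable_decay {p q : ℝ} (hq : 0 ≤ q) (hp : p < 3) (hpq : 3 < p + q) :
    Integrable (decay p q) := by
  unfold decay
  rw [integrable_fun_norm_addHaar (volume : Measure E3)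
    (f := fun r : ℝ => r ^ (-p) * (1 + r) ^ (-q))]
  have hd : Module.finrank ℝ E3 - 1 = 2 := by simp
  rw [hd, ← Set.Ioc_union_Ioi_eq_Ioi zero_le_one]
  have hm : Measurable fun y : ℝ => y ^ 2 • (y ^ (-p) * (1 + y) ^ (-q)) := by fun_prop
  have hpow : ∀ y : ℝ, 0 < y → y ^ 2 * y ^ (-p) = y ^ (2 - p) := by
    intro y hy
    rw [← Real.rpow_natCast, ← Real.rpow_add hy]
    norm_num [sub_eq_add_neg]
  refine IntegrableOn.union ?_ ?_
  · have h : IntegrableOn (fun y : ℝ => y ^ (2 - p)) (Set.Ioc 0 1) :=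
      (intervalIntegrable_iff_integrableOn_Ioc_of_le zero_le_one).mp
        (intervalIntegral.intervalIntegrable_rpow' (by linarith))
    refine h.mono' hm.aestronglyMeasurable ?_
    filter_upwards [ae_restrict_mem measurableSet_Ioc] with y hy
    have hy0 : 0 < y := hy.1
    rw [Real.norm_of_nonneg (by positivity), smul_eq_mul, ← mul_assoc, hpow y hy0]
    refine mul_le_of_le_one_right (by positivity) ?_
    exact Real.rpow_le_one_of_one_le_of_nonpos (by linarith) (neg_nonpos.mpr hq)
  · have h : IntegrableOn (fun y : ℝ => y ^ (2 - p - q)) (Set.Ioi 1) :=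
      integrableOn_Ioi_rpow_of_lt (by linarith) one_pos
    refine h.mono' hm.aestronglyMeasurable ?_
    filter_upwards [ae_restrict_mem measurableSet_Ioi] with y hy
    have hy0 : 0 < y := one_pos.trans hy
    rw [Real.norm_of_nonneg (by positivity), smul_eq_mul, ← mul_assoc, hpow y hy0,
      show 2 - p - q = (2 - p) + -q by ring, Real.rpow_add hy0]
    refine mul_le_mul_of_nonneg_left ?_ (by positivity)
    exact Real.rpow_le_rpow_of_nonpos hy0 (by linarith) (by linarith)

/-- Peetre's inequality: it trades decay in `x + z` for decay in `z` at the price of growth in `x`.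
-/
theorem one_add_norm_rpow_sub_le {E : Type} [NormedAddCommGroup E] {q : ℝ} (hq : 0 ≤ q) (x z : E) :
    (1 + ‖x + z‖) ^ (-q) ≤ (1 + ‖x‖) ^ q * (1 + ‖z‖) ^ (-q) := by
  have h : 1 + ‖z‖ ≤ (1 + ‖x‖) * (1 + ‖x + z‖) := by
    have := norm_sub_le (x + z) x
    rw [add_sub_cancel_left] at this
    nlinarith [norm_nonneg x, norm_nonneg (x + z)]
  rw [Real.rpow_neg (by positivity), Real.rpow_neg (by positivity), inv_le_iff_one_le_mul₀
    (by positivity), mul_assoc, ← div_eq_inv_mul, mul_div_assoc', ← Real.mul_rpow (by positivity)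
    (by positivity), one_le_div (by positivity)]
  exact Real.rpow_le_rpow (by positivity) h hq

theorem schwartz_decay {E F : Type} [NormedAddCommGroup E] [NormedSpace ℝ E]
    [NormedAddCommGroup F] [NormedSpace ℝ F] (f : 𝓢(E, F)) (q : ℝ) :
    ∃ C, 0 ≤ C ∧ ∀ x, ‖f x‖ ≤ C * (1 + ‖x‖) ^ (-q) := by
  set k := ⌈q⌉₊
  have h := SchwartzMap.one_add_le_sup_seminorm_apply (𝕜 := ℝ) (m := (k, 0)) (k := k) (n := 0)
    le_rfl le_rfl f
  refine ⟨_, (mul_nonneg (by positivity) (norm_nonneg _)).trans (h 0), fun x => ?_⟩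
  have h1 := h x
  rw [norm_iteratedFDeriv_zero] at h1
  have h2 : (1 + ‖x‖) ^ q ≤ (1 + ‖x‖) ^ k := by
    rw [← Real.rpow_natCast]
    exact Real.rpow_le_rpow_of_exponent_le (by linarith [norm_nonneg x]) (Nat.le_ceil q)
  rw [Real.rpow_neg (by positivity), ← div_eq_mul_inv, le_div_iff₀ (by positivity), mul_comm]
  exact (mul_le_mul_of_nonneg_right h2 (norm_nonneg _)).trans h1

variable {F : Type} [NormedAddCommGroup F] [NormedSpace ℝ F]

theorem schwartz_decay_shift (f : 𝓢(E3, F)) {q : ℝ} (hq : 0 ≤ q) :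
    ∃ C, 0 ≤ C ∧ ∀ x z, ‖f (x + z)‖ ≤ C * (1 + ‖x‖) ^ q * (1 + ‖z‖) ^ (-q) := by
  obtain ⟨C, hC, h⟩ := schwartz_decay f q
  refine ⟨C, hC, fun x z => (h _).trans ?_⟩
  rw [mul_assoc]
  exact mul_le_mul_of_nonneg_left (one_add_norm_rpow_sub_le hq x z) hC

/-- The Lipschitz bound `L‖z‖` serves near 0 and the sup bound `2M` far away; `‖z‖/(1+‖z‖)` encodes
both. -/
theorem schwartz_diff_bound (f : 𝓢(E3, F)) :
    ∃ C, 0 ≤ C ∧ ∀ x z, ‖f (x + z) - f x‖ ≤ C * (‖z‖ * (1 + ‖z‖) ^ (-1 : ℝ)) := by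
  set M := SchwartzMap.seminorm ℝ 0 0 f
  set L := SchwartzMap.seminorm ℝ 0 1 f
  have hM : 0 ≤ M := apply_nonneg _ _
  have hL : 0 ≤ L := apply_nonneg _ _
  refine ⟨L + 2 * M, by positivity, fun x z => ?_⟩
  have h1 : ‖f (x + z) - f x‖ ≤ 2 * M := by
    refine (norm_sub_le _ _).trans ?_
    linarith [SchwartzMap.norm_le_seminorm ℝ f (x + z), SchwartzMap.norm_le_seminorm ℝ f x]
  have h2 : ‖f (x + z) - f x‖ ≤ L * ‖z‖ := by
    have := Convex.norm_image_sub_le_of_norm_fderiv_le (𝕜 := ℝ) (f := f) (s := Set.univ) (C := L)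
      (x := x) (y := x + z) (fun y _ => f.differentiableAt) (fun y _ => ?_) convex_univ
      (Set.mem_univ _) (Set.mem_univ _)
    · simpa using this
    · have := SchwartzMap.norm_iteratedFDeriv_le_seminorm ℝ f 1 y
      rwa [norm_iteratedFDeriv_one] at this
  rw [Real.rpow_neg_one, ← div_eq_mul_inv, mul_div_assoc', le_div_iff₀ (by positivity)]
  nlinarith [norm_nonneg z]

theorem ae_ne_zero : ∀ᵐ z : E3, z ≠ 0 := by
  simp [ae_iff, measure_singleton]

/-- `|z|^{-p} f(x+z)` is integrable. -/
theorem integrable_rpow_smul_schwartz (f : 𝓢(E3, F)) {p : ℝ} (hp : p < 3) (x : E3) :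
    Integrable fun z => ‖z‖ ^ (-p) • f (x + z) := by
  -- The exponent `|p| + 4` makes `p + q > 3` whatever the sign of `p`.
  obtain ⟨C, hC, h⟩ := schwartz_decay_shift f (q := |p| + 4) (by positivity)
  have hi := (integrable_decay (p := p) (q := |p| + 4) (by positivity) hp
    (by linarith [neg_abs_le p])).const_mul (C * (1 + ‖x‖) ^ (|p| + 4))
  refine hi.mono' ?_ (Eventually.of_forall fun z => ?_)
  · have h1 : Measurable fun z : E3 => ‖z‖ ^ (-p) := by fun_prop
    have h2 : Continuous fun z : E3 => f (x + z) := f.continuous.comp (by fun_prop)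
    exact h1.aestronglyMeasurable.smul h2.aestronglyMeasurable
  · rw [norm_smul, Real.norm_of_nonneg (by positivity)]
    have := mul_le_mul_of_nonneg_left (h x z) (a := ‖z‖ ^ (-p)) (by positivity)
    simp only [decay]
    linarith

/-- `⟨z, v⟩ |z|^{-(4+s)} (f(x+z) - f(x))` is integrable. -/
theorem integrable_diff_kernel (f : 𝓢(E3, F)) {s : ℝ} (hs : 0 < s) (hs1 : s < 1) (x v : E3) :
    Integrable fun z : E3 => (inner ℝ z v * ‖z‖ ^ (-(4 + s))) • (f (x + z) - f x) := by
  obtain ⟨C, hC, h⟩ := schwartz_diff_bound f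
  -- The inner product and the difference each supply one factor `‖z‖`, which lowers the singularity
  -- from order `4 + s` to `2 + s < 3`. At infinity the factor `(1+‖z‖)^{-1}` gives total decay `3 +
  -- s > 3`.
  have hi := (integrable_decay (p := 2 + s) (q := 1) zero_le_one (by linarith)
    (by linarith)).const_mul (‖v‖ * C)
  refine hi.mono' ?_ ?_
  · have h1 : Measurable fun z : E3 => inner ℝ z v * ‖z‖ ^ (-(4 + s)) := by fun_prop
    have h2 : Continuous fun z : E3 => f (x + z) - f x :=
      (f.continuous.comp (by fun_prop)).sub continuous_const
    exact h1.aestronglyMeasurable.smul h2.aestronglyMeasurable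
  · filter_upwards [ae_ne_zero] with z hz
    have hz0 : 0 < ‖z‖ := norm_pos_iff.mpr hz
    rw [norm_smul, norm_mul, Real.norm_of_nonneg (by positivity : 0 ≤ ‖z‖ ^ (-(4 + s)))]
    have e : ‖z‖ * ‖z‖ * ‖z‖ ^ (-(4 + s)) = ‖z‖ ^ (-(2 + s)) := by
      rw [← pow_two, ← Real.rpow_natCast, ← Real.rpow_add hz0]
      congr 1
      push_cast
      ring
    calc ‖inner ℝ z v‖ * ‖z‖ ^ (-(4 + s)) * ‖f (x + z) - f x‖
        ≤ (‖z‖ * ‖v‖) * ‖z‖ ^ (-(4 + s)) * (C * (‖z‖ * (1 + ‖z‖) ^ (-1 : ℝ))) := by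
          gcongr
          · exact norm_inner_le_norm z v
          · exact h x z
      _ = ‖v‖ * C * ((‖z‖ * ‖z‖ * ‖z‖ ^ (-(4 + s))) * (1 + ‖z‖) ^ (-1 : ℝ)) := by ring
      _ = ‖v‖ * C * decay (2 + s) 1 z := by rw [e, decay]

end Kernel

/-! ### Integration by parts against the singular kernel -/

section PartialIntegration

variable {F : Type} [NormedAddCommGroup F] [NormedSpace ℝ F]

/-- The regularised kernel `(|z|² + ε)^{-a}`. -/
def regKernel (ε a : ℝ) (z : E3) : ℝ := (‖z‖ ^ 2 + ε) ^ (-a)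

theorem continuous_regKernel {ε : ℝ} (hε : 0 < ε) (a : ℝ) : Continuous (regKernel ε a) := by
  unfold regKernel
  exact Continuous.rpow_const (by fun_prop) fun z => Or.inl (by positivity)

theorem rpow_eq_normSq_rpow (p : ℝ) (z : E3) : ‖z‖ ^ (-p) = (‖z‖ ^ 2) ^ (-(p / 2)) := by
  rw [← Real.rpow_natCast, ← Real.rpow_mul (norm_nonneg z)]
  congr 1
  push_cast
  ring

theorem regKernel_le {ε p : ℝ} (hε : 0 < ε) (hp : 0 ≤ p) {z : E3} (hz : z ≠ 0) :
    regKernel ε (p / 2) z ≤ ‖z‖ ^ (-p) := by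
  have hz0 : 0 < ‖z‖ := norm_pos_iff.mpr hz
  rw [rpow_eq_normSq_rpow, regKernel]
  exact Real.rpow_le_rpow_of_nonpos (by positivity) (by linarith) (by linarith)

theorem tendsto_regKernel (p : ℝ) {z : E3} (hz : z ≠ 0) :
    Tendsto (fun ε => regKernel ε (p / 2) z) (𝓝[>] 0) (𝓝 (‖z‖ ^ (-p))) := by
  have hz0 : 0 < ‖z‖ := norm_pos_iff.mpr hz
  rw [rpow_eq_normSq_rpow, ← add_zero (‖z‖ ^ 2)]
  refine Tendsto.mono_left ?_ nhdsWithin_le_nhds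
  have : ContinuousAt (fun ε : ℝ => (‖z‖ ^ 2 + ε) ^ (-(p / 2))) 0 :=
    ContinuousAt.rpow_const (by fun_prop) (Or.inl (by positivity))
  exact this

theorem hasLineDerivAt_regKernel {ε : ℝ} (hε : 0 < ε) (a : ℝ) (z v : E3) :
    HasLineDerivAt ℝ (regKernel ε a) (-(2 * a) * (inner ℝ z v * regKernel ε (a + 1) z)) z v := by
  have h1 : HasFDerivAt (fun z : E3 => ‖z‖ ^ 2 + ε) ((2 : ℝ) • innerSL ℝ z) z := by
    have := (hasStrictFDerivAt_norm_sq z).hasFDerivAt.add_const ε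
    simpa only [two_smul] using this
  have h2 := (h1.rpow_const (p := -a) (Or.inl (by positivity))).hasLineDerivAt v
  have e : (-a * (‖z‖ ^ 2 + ε) ^ (-a - 1)) • ((2 : ℝ) • innerSL ℝ z) v =
      -(2 * a) * (inner ℝ z v * regKernel ε (a + 1) z) := by
    simp only [regKernel, smul_apply, innerSL_apply_apply, smul_eq_mul, neg_add']
    ring
  rw [← e]
  exact h2

/-- For `ε ≤ 1` one has `‖z‖² + ε ≥ ε (1 + ‖z‖²)`, so the integrand is dominated by a multiple of
`(1 + ‖z‖²)^{-(3+s)/2}`. -/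
theorem integrable_regKernel_mul {ε : ℝ} (hε : 0 < ε) (hε1 : ε ≤ 1) {s : ℝ} (hs : 0 < s) (v : E3) :
    Integrable fun z : E3 => inner ℝ z v * regKernel ε ((4 + s) / 2) z := by
  have h0 : Integrable fun z : E3 => (1 + ‖z‖ ^ 2) ^ (-(3 + s) / 2) :=
    integrable_rpow_neg_one_add_norm_sq (by simp; linarith)
  refine (h0.const_mul (‖v‖ * ε ^ (-((4 + s) / 2)))).mono' ?_ (Eventually.of_forall fun z => ?_)
  · exact ((by fun_prop : Continuous fun z : E3 => inner ℝ z v).mul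
      (continuous_regKernel hε _)).aestronglyMeasurable
  · have hb : (0 : ℝ) < 1 + ‖z‖ ^ 2 := by positivity
    have h1 : regKernel ε ((4 + s) / 2) z ≤
        ε ^ (-((4 + s) / 2)) * (1 + ‖z‖ ^ 2) ^ (-((4 + s) / 2)) := by
      rw [← Real.mul_rpow hε.le hb.le, regKernel]
      refine Real.rpow_le_rpow_of_nonpos (by positivity) ?_ (by linarith)
      nlinarith [sq_nonneg ‖z‖]
    have h2 : ‖z‖ ≤ (1 + ‖z‖ ^ 2) ^ (1 / 2 : ℝ) := by
      rw [← Real.sqrt_eq_rpow]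
      exact Real.le_sqrt_of_sq_le (by linarith)
    have hk : 0 ≤ regKernel ε ((4 + s) / 2) z := by unfold regKernel; positivity
    rw [norm_mul, Real.norm_of_nonneg hk]
    calc ‖inner ℝ z v‖ * regKernel ε ((4 + s) / 2) z
        ≤ ((1 + ‖z‖ ^ 2) ^ (1 / 2 : ℝ) * ‖v‖) *
          (ε ^ (-((4 + s) / 2)) * (1 + ‖z‖ ^ 2) ^ (-((4 + s) / 2))) := by
          gcongr
          exact (norm_inner_le_norm z v).trans (by gcongr)
      _ = ‖v‖ * ε ^ (-((4 + s) / 2)) *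
          ((1 + ‖z‖ ^ 2) ^ (1 / 2 : ℝ) * (1 + ‖z‖ ^ 2) ^ (-((4 + s) / 2))) := by ring
      _ = _ := by
          rw [← Real.rpow_add hb]
          congr 2
          ring

/-- For `ε > 0` there is no singularity and the integration by parts is legitimate. The
differentiated kernel is odd and integrable, hence has integral zero, so `f x` may be subtracted for
free. Only the subtracted form survives `ε → 0`. -/
theorem integral_regKernel_smul_lineDeriv [CompleteSpace F] (f : 𝓢(E3, F)) {ε s : ℝ} (hε : 0 < ε)
    (hε1 : ε ≤ 1) (hs : 0 < s) (x v : E3) :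
    ∫ z, regKernel ε ((2 + s) / 2) z • (∂_{v} f) (x + z) =
      (2 + s) • ∫ z, (inner ℝ z v * regKernel ε ((4 + s) / 2) z) • (f (x + z) - f x) := by
  have hfx : Integrable fun z => f (x + z) := f.integrable.comp_add_left x
  have hfx' : Integrable fun z => (∂_{v} f) (x + z) := (∂_{v} f).integrable.comp_add_left x
  have hbd : ∀ a : ℝ, 0 ≤ a → ∀ z : E3, ‖regKernel ε a z‖ ≤ ε ^ (-a) := by
    intro a ha z
    rw [Real.norm_of_nonneg (by unfold regKernel; positivity), regKernel]
    exact Real.rpow_le_rpow_of_nonpos hε (by linarith [sq_nonneg ‖z‖]) (by linarith)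
  have hbd' : ∃ C, ∀ z, ‖f z‖ ≤ C := ⟨_, fun z => SchwartzMap.norm_le_seminorm ℝ f z⟩
  obtain ⟨C, hC⟩ := hbd'
  have hk := integrable_regKernel_mul hε hε1 hs v
  have hcont : Continuous fun z => f (x + z) := f.continuous.comp (by fun_prop)
  have i1 : Integrable fun z : E3 =>
      (inner ℝ z v * regKernel ε ((4 + s) / 2) z) • f (x + z) :=
    hk.smul_of_top_left (memLp_top_of_bound hcont.aestronglyMeasurable C
      (Eventually.of_forall fun z => hC _))
  have i2 : Integrable fun z : E3 =>
      (inner ℝ z v * regKernel ε ((4 + s) / 2) z) • f x := hk.smul_const _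
  have odd : ∫ z : E3, inner ℝ z v * regKernel ε ((4 + s) / 2) z = 0 := by
    have := integral_neg_eq_self
      (fun z : E3 => inner ℝ z v * regKernel ε ((4 + s) / 2) z) volume
    simp only [regKernel, norm_neg, inner_neg_left, neg_mul, integral_neg] at this ⊢
    linarith
  have ibp := integral_bilinear_hasLineDerivAt_right_eq_neg_left_of_integrable
    (μ := (volume : Measure E3)) (B := ContinuousLinearMap.lsmul ℝ ℝ (E := F))
    (f := regKernel ε ((2 + s) / 2)) (g := fun z => f (x + z)) (v := v)
    (f' := fun z => -(2 * ((2 + s) / 2)) * (inner ℝ z v * regKernel ε ((4 + s) / 2) z))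
    (g' := fun z => (∂_{v} f) (x + z)) ?_ ?_ ?_ ?_ ?_
  · simp only [ContinuousLinearMap.lsmul_apply, mul_smul, integral_smul] at ibp
    rw [ibp]
    simp only [smul_sub, ← mul_smul]
    rw [integral_sub i1 i2, integral_smul_const, odd, zero_smul, sub_zero, ← neg_smul]
    congr 1
    ring
  · simp only [ContinuousLinearMap.lsmul_apply, mul_smul (-(2 * ((2 + s) / 2)))]
    exact i1.smul (-(2 * ((2 + s) / 2)))
  · simp only [ContinuousLinearMap.lsmul_apply]
    exact hfx'.bdd_smul _ (continuous_regKernel hε _).aestronglyMeasurable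
      (Eventually.of_forall (hbd _ (by linarith)))
  · simp only [ContinuousLinearMap.lsmul_apply]
    exact hfx.bdd_smul _ (continuous_regKernel hε _).aestronglyMeasurable
      (Eventually.of_forall (hbd _ (by linarith)))
  · intro z _
    have := hasLineDerivAt_regKernel hε ((2 + s) / 2) z v
    rwa [show (2 + s) / 2 + 1 = (4 + s) / 2 by ring] at this
  · intro z _
    have h1 : HasFDerivAt (fun z => f (x + z)) (fderiv ℝ f (x + z)) z := by
      rw [hasFDerivAt_comp_add_left]
      exact f.hasFDerivAt (x + z)
    rw [SchwartzMap.lineDerivOp_apply_eq_fderiv]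
    exact h1.hasLineDerivAt v

/-- `∫ |z|^{-2-s} ∂_v f(x+z) dz = (2+s) ∫ ⟨z,v⟩ |z|^{-4-s} (f(x+z) - f(x)) dz`. -/
theorem integral_rpow_smul_lineDeriv [CompleteSpace F] (f : 𝓢(E3, F)) {s : ℝ} (hs : 0 < s)
    (hs1 : s < 1) (x v : E3) :
    ∫ z, ‖z‖ ^ (-(2 + s)) • (∂_{v} f) (x + z) =
      (2 + s) • ∫ z, (inner ℝ z v * ‖z‖ ^ (-(4 + s))) • (f (x + z) - f x) := by
  have hcont : Continuous fun z => f (x + z) - f x :=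
    (f.continuous.comp (by fun_prop)).sub continuous_const
  have hcont' : Continuous fun z => (∂_{v} f) (x + z) := (∂_{v} f).continuous.comp (by fun_prop)
  have hev : ∀ᶠ ε : ℝ in 𝓝[>] 0, 0 < ε ∧ ε ≤ 1 :=
    (Ioc_mem_nhdsGT one_pos : Set.Ioc (0 : ℝ) 1 ∈ 𝓝[>] 0)
  -- In both limits the integrand at `ε = 0` is itself the majorant, because the regularised kernel
  -- lies below the singular one.
  have l1 : Tendsto (fun ε => ∫ z, regKernel ε ((2 + s) / 2) z • (∂_{v} f) (x + z)) (𝓝[>] 0)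
      (𝓝 (∫ z, ‖z‖ ^ (-(2 + s)) • (∂_{v} f) (x + z))) := by
    refine tendsto_integral_filter_of_dominated_convergence _ ?_ ?_
      (integrable_rpow_smul_schwartz (∂_{v} f) (p := 2 + s) (by linarith) x).norm ?_
    · filter_upwards [hev] with ε hε
      exact ((continuous_regKernel hε.1 _).smul hcont').aestronglyMeasurable
    · filter_upwards [hev] with ε hε
      filter_upwards [ae_ne_zero] with z hz
      rw [norm_smul, norm_smul]
      gcongr
      rw [Real.norm_of_nonneg (by unfold regKernel; have := hε.1; positivity),
        Real.norm_of_nonneg (by positivity)]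
      exact regKernel_le hε.1 (by linarith) hz
    · filter_upwards [ae_ne_zero] with z hz
      exact (tendsto_regKernel _ hz).smul_const _
  have l2 : Tendsto (fun ε => (2 + s) •
      ∫ z, (inner ℝ z v * regKernel ε ((4 + s) / 2) z) • (f (x + z) - f x)) (𝓝[>] 0)
      (𝓝 ((2 + s) • ∫ z, (inner ℝ z v * ‖z‖ ^ (-(4 + s))) • (f (x + z) - f x))) := by
    refine Tendsto.const_smul ?_ _
    refine tendsto_integral_filter_of_dominated_convergence _ ?_ ?_
      (integrable_diff_kernel f hs hs1 x v).norm ?_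
    · filter_upwards [hev] with ε hε
      exact ((((by fun_prop : Continuous fun z : E3 => inner ℝ z v)).mul
        (continuous_regKernel hε.1 _)).smul hcont).aestronglyMeasurable
    · filter_upwards [hev] with ε hε
      filter_upwards [ae_ne_zero] with z hz
      rw [norm_smul, norm_smul, norm_mul, norm_mul]
      gcongr
      rw [Real.norm_of_nonneg (by unfold regKernel; have := hε.1; positivity),
        Real.norm_of_nonneg (by positivity)]
      exact regKernel_le hε.1 (by linarith) hz
    · filter_upwards [ae_ne_zero] with z hz
      exact ((tendsto_regKernel _ hz).const_mul _).smul_const _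
  refine tendsto_nhds_unique (l1.congr' ?_) l2
  filter_upwards [hev] with ε hε
  exact integral_regKernel_smul_lineDeriv f hε.1 hε.2 hs x v

end PartialIntegration

/-! ### Integrability on pairs in the coordinates `(x, y - x)` -/

section Shear

variable {F : Type} [NormedAddCommGroup F] [NormedSpace ℝ F]

theorem measurePreserving_shear :
    MeasurePreserving (MeasurableEquiv.shearAddRight E3) (volume : Measure (E3 × E3)) volume :=
  measurePreserving_prod_add volume volume

/-- The shear `(x, z) ↦ (x, x + z)` preserves volume, and in these coordinates a kernel in `y - x`
times a decaying function is dominated by a product. -/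
theorem integrable_of_shear {H : E3 × E3 → F} (hH : AEStronglyMeasurable H) {A B : E3 → ℝ}
    (hA : Integrable A) (hB : Integrable B) (h : ∀ x z, ‖H (x, x + z)‖ ≤ A x * B z) :
    Integrable H := by
  rw [← measurePreserving_shear.integrable_comp_emb
    (MeasurableEquiv.shearAddRight E3).measurableEmbedding]
  refine (hA.mul_prod hB).mono' ?_ (Eventually.of_forall fun p => h p.1 p.2)
  exact hH.comp_measurePreserving measurePreserving_shear

end Shear

/-! ### The Fourier transform of the Riesz kernel -/

section Riesz

variable {F : Type} [NormedAddCommGroup F] [InnerProductSpace ℂ F] [CompleteSpace F]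

theorem integrableOn_rpow_mul_exp {a r : ℝ} (ha : 0 < a) (hr : 0 < r) :
    IntegrableOn (fun t : ℝ => t ^ (a - 1) * Real.exp (-(r * t))) (Set.Ioi 0) := by
  have h := Real.integral_rpow_mul_exp_neg_mul_Ioi ha hr
  -- A non-integrable function has integral 0 by convention, whereas the known value is positive.
  by_contra hc
  rw [integral_undef hc] at h
  have : 0 < (1 / r) ^ a * Real.Gamma a := mul_pos (by positivity) (Real.Gamma_pos_of_pos ha)
  linarith

/-- Subordination: an integral against `K x = ∫₀^∞ k(t,x) dt` is a superposition. -/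
theorem integral_subordination {X : Type} [MeasureSpace X] [SFinite (volume : Measure X)]
    {k : ℝ → X → ℝ} {K : X → ℝ} {h : X → F} (hk : Measurable (Function.uncurry k))
    (hk0 : ∀ t x, 0 < t → 0 ≤ k t x)
    (hK : ∀ᵐ x, IntegrableOn (fun t => k t x) (Set.Ioi 0) ∧ ∫ t in Set.Ioi 0, k t x = K x)
    (hh : AEStronglyMeasurable h) (hi : Integrable fun x => K x • h x) :
    ∫ x, K x • h x = ∫ t in Set.Ioi 0, ∫ x, k t x • h x := by
  have hint : Integrable (fun p : X × ℝ => k p.2 p.1 • h p.1)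
      ((volume : Measure X).prod (volume.restrict (Set.Ioi 0))) := by
    refine (integrable_prod_iff ?_).mpr ⟨?_, ?_⟩
    · exact ((hk.comp measurable_swap).aestronglyMeasurable).smul hh.comp_fst
    · filter_upwards [hK] with x hx
      exact hx.1.smul_const (h x)
    -- Since `k ≥ 0`, integrating the norm over `t` gives exactly `‖K x • h x‖`, so integrability of
    -- the result suffices for Fubini.
    · refine hi.norm.congr ?_
      filter_upwards [hK] with x hx
      have e : ∀ᵐ t ∂(volume.restrict (Set.Ioi (0 : ℝ))), ‖k t x • h x‖ = k t x * ‖h x‖ := by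
        filter_upwards [ae_restrict_mem measurableSet_Ioi] with t ht
        rw [norm_smul, Real.norm_of_nonneg (hk0 t x ht)]
      rw [integral_congr_ae e, integral_mul_const, hx.2, norm_smul, Real.norm_of_nonneg]
      rw [← hx.2]
      exact setIntegral_nonneg measurableSet_Ioi fun t ht => hk0 t x ht
  have h1 : ∀ᵐ x, K x • h x = ∫ t in Set.Ioi 0, k t x • h x := by
    filter_upwards [hK] with x hx
    rw [integral_smul_const, hx.2]
  rw [integral_congr_ae h1]
  exact integral_integral_swap hint

/-- `∫₀^∞ t^{-b-1} e^{-r/t} dt = r^{-b} Γ(b)`. -/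
theorem integral_rpow_mul_exp_inv {b r : ℝ} (hb : 0 < b) (hr : 0 < r) :
    IntegrableOn (fun t : ℝ => t ^ (-b - 1) * Real.exp (-(r / t))) (Set.Ioi 0) ∧
      ∫ t in Set.Ioi (0 : ℝ), t ^ (-b - 1) * Real.exp (-(r / t)) =
        (1 / r) ^ b * Real.Gamma b := by
  -- The substitution `t ↦ 1/t` turns the integral into the Gamma integral.
  have e : ∀ t ∈ Set.Ioi (0 : ℝ), t ^ (-b - 1) * Real.exp (-(r / t)) =
      (|(-1 : ℝ)| * t ^ ((-1 : ℝ) - 1)) • ((t ^ (-1 : ℝ)) ^ (b - 1) *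
        Real.exp (-(r * t ^ (-1 : ℝ)))) := by
    intro t ht
    have ht0 : 0 < t := ht
    rw [abs_neg, abs_one, one_mul, smul_eq_mul, ← mul_assoc, ← Real.rpow_mul ht0.le,
      ← Real.rpow_add ht0, Real.rpow_neg_one, div_eq_mul_inv]
    congr 2
    ring
  have h := integral_comp_rpow_Ioi (fun u : ℝ => u ^ (b - 1) * Real.exp (-(r * u)))
    (p := -1) (by norm_num)
  rw [← setIntegral_congr_fun measurableSet_Ioi e, Real.integral_rpow_mul_exp_neg_mul_Ioi hb hr]
    at h
  refine ⟨?_, h⟩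
  by_contra hc
  rw [integral_undef hc] at h
  have : 0 < (1 / r) ^ b * Real.Gamma b := mul_pos (by positivity) (Real.Gamma_pos_of_pos hb)
  linarith

/-- Fourier inversion for Gaussians in dimension 3. Writing the Gaussian as a superposition of
characters of `z` lets a convolution split into a product of two Fourier integrals. -/
theorem exp_eq_integral_gaussian {t : ℝ} (ht : 0 < t) (z : E3) :
    (Real.exp (-(Real.pi * t * ‖z‖ ^ 2)) : ℂ) =
      ∫ ξ : E3, ((t ^ (-(3 / 2) : ℝ) * Real.exp (-(Real.pi * ‖ξ‖ ^ 2 / t)) : ℝ) : ℂ) *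
        Complex.exp (2 * Real.pi * Complex.I * (inner ℝ z ξ : ℝ)) := by
  have hb : 0 < ((Real.pi / t : ℝ) : ℂ).re := by
    rw [Complex.ofReal_re]
    positivity
  have h := GaussianFourier.integral_cexp_neg_mul_sq_norm_add hb (2 * Real.pi * Complex.I) z
  have htc : (t : ℂ) ≠ 0 := by exact_mod_cast ht.ne'
  have hpi : (Real.pi : ℂ) ≠ 0 := by exact_mod_cast Real.pi_ne_zero
  have e1 : ∀ ξ : E3, ((t ^ (-(3 / 2) : ℝ) * Real.exp (-(Real.pi * ‖ξ‖ ^ 2 / t)) : ℝ) : ℂ) *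
      Complex.exp (2 * Real.pi * Complex.I * (inner ℝ z ξ : ℝ)) = ((t ^ (-(3 / 2) : ℝ) : ℝ) : ℂ) *
      Complex.exp (-((Real.pi / t : ℝ) : ℂ) * (‖ξ‖ : ℂ) ^ 2 +
        2 * Real.pi * Complex.I * (inner ℝ z ξ : ℝ)) := by
    intro ξ
    rw [Complex.exp_add, Complex.ofReal_mul, mul_assoc]
    congr 2
    rw [Complex.ofReal_exp]
    congr 1
    push_cast
    ring
  simp only [e1]
  rw [integral_const_mul, h]
  have e2 : (Real.pi : ℂ) / ((Real.pi / t : ℝ) : ℂ) = (t : ℂ) := by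
    push_cast
    field_simp
  have e3 : (2 * Real.pi * Complex.I) ^ 2 * (‖z‖ : ℂ) ^ 2 / (4 * ((Real.pi / t : ℝ) : ℂ)) =
      ((-(Real.pi * t * ‖z‖ ^ 2) : ℝ) : ℂ) := by
    rw [mul_pow, Complex.I_sq]
    push_cast
    field_simp
    ring
  rw [e2, e3, ← mul_assoc]
  have e4 : (Module.finrank ℝ E3 / 2 : ℂ) = ((3 / 2 : ℝ) : ℂ) := by
    simp
  rw [e4, ← Complex.ofReal_cpow ht.le, ← Complex.ofReal_mul, ← Real.rpow_add ht,
    neg_add_cancel, Real.rpow_zero, Complex.ofReal_one, one_mul, Complex.ofReal_exp]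

theorem integrable_gaussian {t : ℝ} (ht : 0 < t) :
    Integrable fun ξ : E3 => t ^ (-(3 / 2) : ℝ) * Real.exp (-(Real.pi * ‖ξ‖ ^ 2 / t)) := by
  have hb : 0 < ((Real.pi / t : ℝ) : ℂ).re := by
    rw [Complex.ofReal_re]
    positivity
  have h := (GaussianFourier.integrable_cexp_neg_mul_sq_norm_add hb 0 (0 : E3)).norm
  refine (h.const_mul (t ^ (-(3 / 2) : ℝ))).congr (Eventually.of_forall fun ξ => ?_)
  simp only [Complex.norm_exp]
  congr 2
  simp [← Complex.ofReal_pow]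
  ring

/-- Parseval's identity for a Gaussian convolution. -/
theorem integral_gaussian_conv (g : 𝓢(E3, F)) (φ : 𝓢(E3, ℂ)) {t : ℝ} (ht : 0 < t) :
    ∫ p : E3 × E3, Real.exp (-(Real.pi * t * ‖p.1 - p.2‖ ^ 2)) • φ p.1 • g p.2 =
      ∫ ξ, (t ^ (-(3 / 2) : ℝ) * Real.exp (-(Real.pi * ‖ξ‖ ^ 2 / t))) • (𝓕⁻ φ) ξ • (𝓕 g) ξ := by
  set G : E3 → ℝ := fun ξ => t ^ (-(3 / 2) : ℝ) * Real.exp (-(Real.pi * ‖ξ‖ ^ 2 / t)) with hG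
  set e : E3 × E3 → E3 → ℂ := fun p ξ =>
    Complex.exp (2 * Real.pi * Complex.I * (inner ℝ (p.1 - p.2) ξ : ℝ)) with he
  have hen : ∀ p ξ, ‖e p ξ‖ = 1 := by
    intro p ξ
    rw [he, Complex.norm_exp]
    simp
  have hec : Continuous (Function.uncurry e) := by
    simp only [he, Function.uncurry_def]
    fun_prop
  have hGi : Integrable G := integrable_gaussian ht
  have hφg : Integrable fun p : E3 × E3 => φ p.1 • g p.2 := φ.integrable.smul_prod g.integrable
  have hint : Integrable (fun q : (E3 × E3) × E3 => ((G q.2 : ℂ) * e q.1 q.2) •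
      φ q.1.1 • g q.1.2) ((volume : Measure (E3 × E3)).prod volume) := by
    have h1 : Integrable (fun q : (E3 × E3) × E3 => (G q.2 : ℂ) • φ q.1.1 • g q.1.2)
        ((volume : Measure (E3 × E3)).prod volume) :=
      (hGi.ofReal.smul_prod hφg).swap
    have h2 := h1.bdd_smul 1 (hec.aestronglyMeasurable (μ := (volume : Measure (E3 × E3)).prod
      volume)) (Eventually.of_forall fun q => (hen q.1 q.2).le)
    refine h2.congr (Eventually.of_forall fun q => ?_)
    change e q.1 q.2 • (G q.2 : ℂ) • φ q.1.1 • g q.1.2 = _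
    rw [smul_smul, mul_comm]
  have h1 : ∀ p : E3 × E3, Real.exp (-(Real.pi * t * ‖p.1 - p.2‖ ^ 2)) • φ p.1 • g p.2 =
      ∫ ξ, ((G ξ : ℂ) * e p ξ) • φ p.1 • g p.2 := by
    intro p
    rw [integral_smul_const, ← Complex.coe_smul, exp_eq_integral_gaussian ht (p.1 - p.2)]
  rw [integral_congr_ae (Eventually.of_forall h1), integral_integral_swap hint]
  refine integral_congr_ae (Eventually.of_forall fun ξ => ?_)
  simp only [mul_smul (G ξ : ℂ)]
  rw [integral_smul, Complex.coe_smul]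
  refine congrArg (G ξ • ·) ?_
  -- The character of `x - y` factorises: `φ` receives the sign of the inverse transform and `g`
  -- that of the transform, so the integral over pairs is a product.
  have h2 : ∀ p : E3 × E3, e p ξ • φ p.1 • g p.2 =
      (Complex.exp ((2 * Real.pi * inner ℝ p.1 ξ : ℝ) * Complex.I) • φ p.1) •
        (Complex.exp ((-2 * Real.pi * inner ℝ p.2 ξ : ℝ) * Complex.I) • g p.2) := by
    intro p
    have hev : e p ξ = Complex.exp ((2 * Real.pi * inner ℝ p.1 ξ : ℝ) * Complex.I) *
        Complex.exp ((-2 * Real.pi * inner ℝ p.2 ξ : ℝ) * Complex.I) := by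
      rw [← Complex.exp_add]
      change Complex.exp _ = _
      congr 1
      rw [inner_sub_left]
      push_cast
      ring
    rw [hev, smul_smul, smul_smul, smul_eq_mul, mul_right_comm]
  refine (integral_congr_ae (Eventually.of_forall h2)).trans ?_
  rw [SchwartzMap.fourierInv_coe, SchwartzMap.fourier_coe, Real.fourierInv_eq', Real.fourier_eq']
  exact integral_prod_smul (μ := (volume : Measure E3)) (ν := (volume : Measure E3))
    (fun x => Complex.exp ((2 * Real.pi * inner ℝ x ξ : ℝ) * Complex.I) • φ x)
    (fun y => Complex.exp ((-2 * Real.pi * inner ℝ y ξ : ℝ) * Complex.I) • g y)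

theorem ae_sub_ne_zero : ∀ᵐ p : E3 × E3, p.1 - p.2 ≠ 0 := by
  have hm : MeasurableSet {p : E3 × E3 | p.1 - p.2 = 0} :=
    (isClosed_eq (by fun_prop) continuous_const).measurableSet
  rw [ae_iff, Measure.volume_eq_prod]
  simp only [ne_eq, not_not]
  rw [Measure.measure_prod_null hm]
  refine Eventually.of_forall fun x => ?_
  have : Prod.mk x ⁻¹' {p : E3 × E3 | p.1 - p.2 = 0} = {x} := by
    ext y
    simp [sub_eq_zero, eq_comm]
  simp [this]

/-- `|x-y|^{-p} φ(x) g(y)` is integrable. -/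
theorem integrable_rpow_pair (g : 𝓢(E3, F)) (φ : 𝓢(E3, ℂ)) {p : ℝ} (hp : p < 3) :
    Integrable fun q : E3 × E3 => ‖q.1 - q.2‖ ^ (-p) • φ q.1 • g q.2 := by
  have hq : 0 ≤ |p| + 4 := by positivity
  obtain ⟨C, hC, h⟩ := schwartz_decay_shift g hq
  -- Of this decay, `|p| + 4` absorbs the growth in `x` from Peetre's inequality and the remaining 4
  -- exceeds the dimension.
  obtain ⟨D, hD, h'⟩ := schwartz_decay φ (|p| + 4 + 4)
  have hA : Integrable fun x : E3 => D * C * (1 + ‖x‖) ^ (-4 : ℝ) :=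
    (integrable_one_add_norm (by simp; norm_num)).const_mul _
  refine integrable_of_shear ?_ hA
    (integrable_decay (p := p) (q := |p| + 4) hq hp (by linarith [neg_abs_le p])) ?_
  · have h1 : Measurable fun q : E3 × E3 => ‖q.1 - q.2‖ ^ (-p) := by fun_prop
    have h2 : Continuous fun q : E3 × E3 => φ q.1 • g q.2 :=
      (φ.continuous.comp continuous_fst).smul (g.continuous.comp continuous_snd)
    exact h1.aestronglyMeasurable.smul h2.aestronglyMeasurable
  · intro x z
    have e1 : x - (x + z) = -z := by abel
    have hx : (0 : ℝ) < 1 + ‖x‖ := by positivity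
    simp only [e1, norm_neg, norm_smul]
    rw [Real.norm_of_nonneg (by positivity)]
    calc ‖z‖ ^ (-p) * (‖φ x‖ * ‖g (x + z)‖)
        ≤ ‖z‖ ^ (-p) * ((D * (1 + ‖x‖) ^ (-(|p| + 4 + 4))) *
            (C * (1 + ‖x‖) ^ (|p| + 4) * (1 + ‖z‖) ^ (-(|p| + 4)))) := by
          gcongr
          · exact h' x
          · exact h x z
      _ = D * C * ((1 + ‖x‖) ^ (-(|p| + 4 + 4)) * (1 + ‖x‖) ^ (|p| + 4)) *
            decay p (|p| + 4) z := by
          rw [decay]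
          ring
      _ = _ := by
          rw [← Real.rpow_add hx]
          congr 3
          ring

theorem integrable_pow_smul_of_lt (f : 𝓢(E3, F)) {p : ℝ} (hp : p < 3) :
    Integrable fun ξ : E3 => ‖ξ‖ ^ (-p) • f ξ := by
  simpa using integrable_rpow_smul_schwartz f hp 0

/-- The Fourier transform of the Riesz kernel: `∬ C |x-y|^{σ-3} φ(x) g(y) = ∫ |ξ|^{-σ} φ̌ ĝ`. -/
theorem integral_riesz_kernel (g : 𝓢(E3, F)) (φ : 𝓢(E3, ℂ)) {σ : ℝ} (h0 : 0 < σ) (h3 : σ < 3) :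
    ∫ p : E3 × E3, (fracConst (-σ) / ‖p.1 - p.2‖ ^ (3 - σ)) • φ p.1 • g p.2 =
      ∫ ξ, (2 * Real.pi * ‖ξ‖) ^ (-σ) • (𝓕⁻ φ) ξ • (𝓕 g) ξ := by
  set a : ℝ := (3 - σ) / 2 with ha_def
  have ha : 0 < a := by rw [ha_def]; linarith
  have hb : 0 < σ / 2 := by linarith
  have hΓa := Real.Gamma_pos_of_pos ha
  have hΓb := Real.Gamma_pos_of_pos hb
  -- The normalisation of `fracConst` is exactly what makes both kernels, `C |z|^{σ-3}` and
  -- `(2π|ξ|)^{-σ}`, the same multiple `c` of Gamma integrals of Gaussians (`hK1`, `hK2`).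
  set c : ℝ := fracConst (-σ) * Real.pi ^ a / Real.Gamma a with hc
  have hrp : ∀ (b r : ℝ), 0 ≤ r →
      (1 / (Real.pi * r ^ 2)) ^ b = Real.pi ^ (-b) * r ^ (-(2 * b)) := by
    intro b r hr
    rw [one_div, Real.inv_rpow (by positivity), ← Real.rpow_neg (by positivity),
      Real.mul_rpow (by positivity) (by positivity), ← Real.rpow_natCast, ← Real.rpow_mul hr]
    congr 2
    push_cast
    ring
  have hK1 : ∀ r : ℝ, 0 ≤ r → fracConst (-σ) / r ^ (3 - σ) =
      c * ((1 / (Real.pi * r ^ 2)) ^ a * Real.Gamma a) := by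
    intro r hr
    rw [hrp a r hr, hc, show -(2 * a) = -(3 - σ) by rw [ha_def]; ring, Real.rpow_neg hr,
      Real.rpow_neg Real.pi_pos.le]
    field_simp
  have hc2 : c = 2 ^ (-σ) * Real.pi ^ (-(σ / 2)) / Real.Gamma (σ / 2) := by
    rw [hc, fracConst, neg_neg, abs_of_pos hΓb, show (3 + -σ) / 2 = a by rw [ha_def]; ring]
    rw [show Real.pi ^ (-(σ / 2)) = Real.pi ^ a / Real.pi ^ (3 / 2 : ℝ) by
      rw [← Real.rpow_sub Real.pi_pos, ha_def]; congr 1; ring]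
    field_simp
  have hK2 : ∀ r : ℝ, 0 ≤ r → (2 * Real.pi * r) ^ (-σ) =
      c * ((1 / (Real.pi * r ^ 2)) ^ (σ / 2) * Real.Gamma (σ / 2)) := by
    intro r hr
    have h2 : Real.pi ^ (-(σ / 2)) * Real.pi ^ (-(σ / 2)) = Real.pi ^ (-σ) := by
      rw [← Real.rpow_add Real.pi_pos]; congr 1; ring
    rw [hrp (σ / 2) r hr, hc2, Real.mul_rpow (by positivity) hr,
      Real.mul_rpow (by positivity) (by positivity), show 2 * (σ / 2) = σ by ring, ← h2]
    field_simp
  have i1 : Integrable fun p : E3 × E3 =>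
      (((1 / (Real.pi * ‖p.1 - p.2‖ ^ 2)) ^ a * Real.Gamma a)) • φ p.1 • g p.2 := by
    have := (integrable_rpow_pair g φ (p := 3 - σ) (by linarith)).smul
      (Real.pi ^ (-a) * Real.Gamma a)
    refine this.congr (Eventually.of_forall fun p => ?_)
    simp only [Pi.smul_apply]
    rw [smul_smul, hrp a _ (norm_nonneg _), show 2 * a = 3 - σ by rw [ha_def]; ring]
    congr 1
    ring
  have i2 : Integrable fun ξ : E3 => (((1 / (Real.pi * ‖ξ‖ ^ 2)) ^ (σ / 2) *
      Real.Gamma (σ / 2))) • (𝓕⁻ φ) ξ • (𝓕 g) ξ := by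
    have := (integrable_pow_smul_of_lt (SchwartzMap.pairing (ContinuousLinearMap.lsmul ℂ ℂ) (𝓕⁻ φ)
      (𝓕 g)) h3).smul (Real.pi ^ (-(σ / 2)) * Real.Gamma (σ / 2))
    refine this.congr (Eventually.of_forall fun ξ => ?_)
    simp only [Pi.smul_apply, SchwartzMap.pairing_apply_apply, ContinuousLinearMap.lsmul_apply]
    rw [smul_smul, hrp _ _ (norm_nonneg _), show 2 * (σ / 2) = σ by ring]
    congr 1
    ring
  have hdiag : ∀ᵐ p : E3 × E3, p.1 - p.2 ≠ 0 := ae_sub_ne_zero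
  have s1 := integral_subordination (X := E3 × E3)
    (k := fun t p => t ^ (a - 1) * Real.exp (-(Real.pi * ‖p.1 - p.2‖ ^ 2 * t)))
    (h := fun p => φ p.1 • g p.2) (by simp only [Function.uncurry_def]; fun_prop)
    (fun t x ht => by positivity) (by
      filter_upwards [hdiag] with p hp
      have hr : 0 < Real.pi * ‖p.1 - p.2‖ ^ 2 := by positivity
      exact ⟨integrableOn_rpow_mul_exp ha hr, Real.integral_rpow_mul_exp_neg_mul_Ioi ha hr⟩)
    (φ.integrable.smul_prod g.integrable).aestronglyMeasurable i1
  have s2 := integral_subordination (X := E3)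
    (k := fun t ξ => t ^ (-(σ / 2) - 1) * Real.exp (-(Real.pi * ‖ξ‖ ^ 2 / t)))
    (h := fun ξ => (𝓕⁻ φ) ξ • (𝓕 g) ξ) (by simp only [Function.uncurry_def]; fun_prop)
    (fun t x ht => by positivity) (by
      filter_upwards [ae_ne_zero] with ξ hξ
      have hr : 0 < Real.pi * ‖ξ‖ ^ 2 := by positivity
      exact integral_rpow_mul_exp_inv hb hr)
    ((𝓕⁻ φ).continuous.smul (𝓕 g).continuous).aestronglyMeasurable i2
  have l : ∫ p : E3 × E3, (fracConst (-σ) / ‖p.1 - p.2‖ ^ (3 - σ)) • φ p.1 • g p.2 =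
      c • ∫ p : E3 × E3, (((1 / (Real.pi * ‖p.1 - p.2‖ ^ 2)) ^ a * Real.Gamma a)) •
        φ p.1 • g p.2 := by
    rw [← integral_smul]
    refine integral_congr_ae (Eventually.of_forall fun p => ?_)
    simp only
    rw [hK1 _ (norm_nonneg _), mul_smul]
  have r : ∫ ξ, (2 * Real.pi * ‖ξ‖) ^ (-σ) • (𝓕⁻ φ) ξ • (𝓕 g) ξ =
      c • ∫ ξ, (((1 / (Real.pi * ‖ξ‖ ^ 2)) ^ (σ / 2) * Real.Gamma (σ / 2))) •
        (𝓕⁻ φ) ξ • (𝓕 g) ξ := by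
    rw [← integral_smul]
    refine integral_congr_ae (Eventually.of_forall fun ξ => ?_)
    simp only
    rw [hK2 _ (norm_nonneg _), mul_smul]
  rw [l, r, s1, s2]
  congr 1
  -- It remains to compare at fixed `t`. Parseval contributes `t^{-3/2}`, and `t^{a-1} t^{-3/2} =
  -- t^{-σ/2-1}` because `a = (3-σ)/2`.
  refine setIntegral_congr_fun measurableSet_Ioi fun t ht => ?_
  have ht0 : 0 < t := ht
  have h1 := integral_gaussian_conv g φ ht0
  have h2 := congrArg (fun v => t ^ (a - 1) • v) h1
  simp only [← integral_smul] at h2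
  refine Eq.trans ?_ (h2.trans ?_)
  · refine integral_congr_ae (Eventually.of_forall fun p => ?_)
    simp only [mul_smul, mul_right_comm Real.pi t]
  · refine integral_congr_ae (Eventually.of_forall fun ξ => ?_)
    simp only
    rw [smul_smul, ← mul_assoc, ← Real.rpow_add ht0]
    congr 3
    rw [ha_def]
    ring

end Riesz

/-! ### First-order systems `∑ⱼ Bⱼ ∂ⱼ` and their Riesz potentials -/

section System

variable {F : Type} [NormedAddCommGroup F] [InnerProductSpace ℂ F] [CompleteSpace F]

/-- The symbol `2πi ξⱼ` of `∂ⱼ`. -/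
def dSymbol (j : Fin 3) (ξ : E3) : ℂ := 2 * Real.pi * Complex.I * (ξ j : ℝ)

/-- The symbol of `I_{1-s} ∂ⱼ`. -/
def rSymbol (s : ℝ) (j : Fin 3) (ξ : E3) : ℂ := ((2 * Real.pi * ‖ξ‖) ^ (s - 1) : ℝ) * dSymbol j ξ

/-- The operator `∑ⱼ Bⱼ ∂ⱼ` on tempered distributions. -/
def gradB (B : Fin 3 → F →L[ℂ] V3) (u : 𝓢'(E3, F)) : 𝓢'(E3, V3) :=
  ∑ j : Fin 3, PointwiseConvergenceCLM.postcomp 𝓢(E3, ℂ) (B j) (∂_{basisE j} u)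

/-- The operator `∑ⱼ Bⱼ ∂ⱼ` on Schwartz functions. -/
def gradBSchwartz (B : Fin 3 → F →L[ℂ] V3) (w : 𝓢(E3, F)) : 𝓢(E3, V3) :=
  ∑ j : Fin 3, (∂_{basisE j} w).postcompCLM (B j)

/-- The two-point operator `∑ⱼ αⱼ(x,y) Bⱼ (w(y) - w(x))`. -/
def starB (B : Fin 3 → F →L[ℂ] V3) (s : ℝ) (w : E3 → F) (x y : E3) : V3 :=
  ∑ j : Fin 3, (alpha s x y j : ℂ) • B j (w y - w x)

theorem grad_eq_gradB (u : 𝓢'(E3, ℂ)) : -grad u = gradB (fun j => -embedCLM j) u := by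
  rw [grad, gradB, ← Finset.sum_neg_distrib]
  rfl

theorem curl_eq_gradB (u : 𝓢'(E3, V3)) : curl u = gradB crossCLM u := rfl

theorem inner_basisE (z : E3) (j : Fin 3) : inner ℝ z (basisE j) = z j := by
  rw [basisE, real_inner_comm, EuclideanSpace.inner_single_left]
  simp

theorem dStar_eq_starB (s : ℝ) : dStar s = starB (fun j => -embedCLM j) s := by
  ext w x y i
  fin_cases i <;> simp [dStar, starB, embedCLM, toV3, basisE, Fin.sum_univ_three] <;> ring

theorem cross_eq_sum (a : E3) (v : V3) : cross (toV3 a) v = ∑ j : Fin 3, (a j : ℂ) • crossCLM j v := by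
  ext i
  fin_cases i <;> simp [cross, crossCLM, toV3, basisE, Fin.sum_univ_three] <;> ring

theorem cStar_eq_starB (s : ℝ) : cStar s = starB crossCLM s := by
  ext w x y : 3
  exact cross_eq_sum _ _

theorem isFun_fourier_lineDeriv {u : 𝓢'(E3, F)} {h : E3 → F} (hu : IsFun (𝓕 u) h) (j : Fin 3) :
    IsFun (𝓕 (∂_{basisE j} u)) (fun ξ => dSymbol j ξ • h ξ) := by
  rw [TemperedDistribution.fourier_lineDerivOp_eq]
  have ht : (fun ξ : E3 => ((inner ℝ ξ (basisE j) : ℝ) : ℂ)).HasTemperateGrowth := by fun_prop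
  have := (hu.smulLeft ht).smul (2 * Real.pi * Complex.I)
  simpa only [smul_smul, inner_basisE, dSymbol] using this

theorem isFun_fourier_gradB (B : Fin 3 → F →L[ℂ] V3) {u : 𝓢'(E3, F)} {h : E3 → F}
    (hu : IsFun (𝓕 u) h) :
    IsFun (𝓕 (gradB B u)) (fun ξ => ∑ j : Fin 3, dSymbol j ξ • B j (h ξ)) := by
  have e : 𝓕 (gradB B u) = ∑ j : Fin 3, PointwiseConvergenceCLM.postcomp 𝓢(E3, ℂ) (B j)
      (𝓕 (∂_{basisE j} u)) := by
    ext φ : 1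
    simp only [TemperedDistribution.fourier_apply, gradB, sum_apply]
    rfl
  rw [e]
  refine IsFun.sum fun j _ => ?_
  simpa only [map_smul] using (isFun_fourier_lineDeriv hu j).postcomp (B j)

theorem gradB_schwartz (B : Fin 3 → F →L[ℂ] V3) (w : 𝓢(E3, F)) :
    gradB B (w : 𝓢'(E3, F)) = (gradBSchwartz B w : 𝓢'(E3, V3)) := by
  rw [gradB, gradBSchwartz, map_sum]
  refine Finset.sum_congr rfl fun j _ => ?_
  rw [TemperedDistribution.lineDerivOp_toTemperedDistributionCLM_eq]
  refine (IsFun.postcomp (B j) (isFun_schwartz _)).eq_of_ae (isFun_schwartz _) ?_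
  exact Eventually.of_forall fun x => rfl

theorem fourier_gradBSchwartz (B : Fin 3 → F →L[ℂ] V3) (w : 𝓢(E3, F)) :
    (𝓕 (gradBSchwartz B w) : 𝓢(E3, V3)) =ᵐ[volume]
      fun ξ => ∑ j : Fin 3, dSymbol j ξ • B j ((𝓕 w : 𝓢(E3, F)) ξ) := by
  have h1 := isFun_schwartz (𝓕 (gradBSchwartz B w))
  have h2 := isFun_schwartz (𝓕 w)
  rw [← TemperedDistribution.fourier_toTemperedDistributionCLM_eq] at h1 h2
  rw [← gradB_schwartz] at h1
  exact h1.ae_eq (isFun_fourier_gradB B h2)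

/-- The singularity `|ξ|^{s-1}` is absorbed by the factor `|ξⱼ| ≤ |ξ|`, leaving `(2π|ξ|)^s`. The
constant does not depend on `s`, and `s = 1` is included; the dominated convergence for `s → 1` uses
both. -/
theorem norm_rSymbol_le {s : ℝ} (hs : 0 < s) (hs1 : s ≤ 1) (j : Fin 3) (ξ : E3) :
    ‖rSymbol s j ξ‖ ≤ 2 * Real.pi * (1 + ‖ξ‖ ^ 2) ^ (s / 2) := by
  have hpi := Real.pi_gt_three
  have hj : |ξ j| ≤ ‖ξ‖ := by simpa using PiLp.norm_apply_le ξ j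
  rcases eq_or_ne ξ 0 with rfl | hξ
  · simp [rSymbol, dSymbol]
    positivity
  have hr : 0 < 2 * Real.pi * ‖ξ‖ := by positivity
  have e1 : ‖dSymbol j ξ‖ ≤ 2 * Real.pi * ‖ξ‖ := by
    simp only [dSymbol, norm_mul, Complex.norm_real, Complex.norm_I, mul_one, Real.norm_eq_abs,
      abs_of_pos Real.pi_pos, Complex.norm_ofNat]
    gcongr
  calc ‖rSymbol s j ξ‖ ≤ (2 * Real.pi * ‖ξ‖) ^ (s - 1) * (2 * Real.pi * ‖ξ‖) := by
        rw [rSymbol, norm_mul, Complex.norm_real, Real.norm_of_nonneg (by positivity)]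
        gcongr
    _ = (2 * Real.pi) ^ s * ‖ξ‖ ^ s := by
        rw [← Real.rpow_add_one hr.ne', sub_add_cancel, Real.mul_rpow (by positivity)
          (norm_nonneg _)]
    _ ≤ 2 * Real.pi * (1 + ‖ξ‖ ^ 2) ^ (s / 2) := by
        gcongr
        · have := Real.rpow_le_rpow_of_exponent_le (x := 2 * Real.pi) (by linarith) hs1
          rwa [Real.rpow_one] at this
        · have : ‖ξ‖ ^ s = (‖ξ‖ ^ 2) ^ (s / 2) := by
            rw [← Real.rpow_natCast, ← Real.rpow_mul (norm_nonneg _)]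
            congr 1
            push_cast
            ring
          rw [this]
          exact Real.rpow_le_rpow (by positivity) (by linarith) (by linarith)

theorem measurable_rSymbol (s : ℝ) (j : Fin 3) : Measurable (rSymbol s j) := by
  unfold rSymbol dSymbol
  fun_prop

/-- The symbol of `⟨D⟩^{-s} I_{1-s} ∑ⱼ Bⱼ ∂ⱼ`. -/
def opSymbol (B : Fin 3 → F →L[ℂ] V3) (s : ℝ) (ξ : E3) : F →L[ℂ] V3 :=
  ∑ j : Fin 3, (rSymbol s j ξ * weight (-s) ξ) • B j

theorem memLp_opSymbol (B : Fin 3 → F →L[ℂ] V3) {s : ℝ} (hs : 0 < s) (hs1 : s ≤ 1) :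
    MemLp (opSymbol B s) ∞ (volume : Measure E3) := by
  refine memLp_top_of_bound (C := ∑ j : Fin 3, 2 * Real.pi * ‖B j‖) ?_
    (Eventually.of_forall fun ξ => ?_)
  · unfold opSymbol
    refine Finset.aestronglyMeasurable_fun_sum _ fun j _ => ?_
    exact (((measurable_rSymbol s j).mul
      (continuous_weight (-s)).measurable).aestronglyMeasurable).smul_const _
  · refine (norm_sum_le _ _).trans (Finset.sum_le_sum fun j _ => ?_)
    rw [norm_smul]
    gcongr
    rw [norm_mul, norm_weight]
    refine (mul_le_mul_of_nonneg_right (norm_rSymbol_le hs hs1 j ξ) (by positivity)).trans ?_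
    rw [mul_assoc, ← Real.rpow_add (by positivity)]
    simp [neg_div]

/-- Multiplication by a bounded operator-valued function on `L²`. -/
def opMul {m : E3 → F →L[ℂ] V3} (hm : MemLp m ∞ (volume : Measure E3)) :
    Lp F 2 (volume : Measure E3) →L[ℂ] Lp V3 2 (volume : Measure E3) :=
  (ContinuousLinearMap.id ℂ (F →L[ℂ] V3)).holderL volume ∞ 2 2 hm.toLp

theorem coeFn_opMul {m : E3 → F →L[ℂ] V3} (hm : MemLp m ∞ (volume : Measure E3))
    (g : Lp F 2 (volume : Measure E3)) : opMul hm g =ᵐ[volume] fun ξ => m ξ (g ξ) := by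
  filter_upwards [(ContinuousLinearMap.id ℂ (F →L[ℂ] V3)).coeFn_holder (r := 2) hm.toLp g,
    hm.coeFn_toLp] with ξ h1 h2
  have h3 : opMul hm g = (ContinuousLinearMap.id ℂ (F →L[ℂ] V3)).holder 2 hm.toLp g := rfl
  rw [h3, h1, h2, ContinuousLinearMap.id_apply]

variable (F) in
/-- `u ↦ ⟨ξ⟩^r û`, as an isometry of `H^r` onto `L²`. -/
def fourierSob (r : ℝ) : Sob F r ≃ₗᵢ[ℂ] Lp F 2 (volume : Measure E3) :=
  (sobEquiv F r).trans (Lp.fourierTransformₗᵢ E3 F)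

theorem fourierSob_apply {r : ℝ} (u : Sob F r) :
    fourierSob F r u = (𝓕 u.toL2 : Lp F 2 (volume : Measure E3)) := rfl

/-- The bounded operator `I_{1-s} ∑ⱼ Bⱼ ∂ⱼ : H^r → H^{r-s}`. -/
def rieszGradB (B : Fin 3 → F →L[ℂ] V3) {s : ℝ} (hs : 0 < s) (hs1 : s ≤ 1) (r : ℝ) :
    Sob F r →L[ℂ] Sob V3 (r - s) :=
  (fourierSob V3 (r - s)).symm.toLinearIsometry.toContinuousLinearMap.comp
    ((opMul (memLp_opSymbol B hs hs1)).comp (fourierSob F r).toLinearIsometry.toContinuousLinearMap)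

theorem fourier_toL2_rieszGradB (B : Fin 3 → F →L[ℂ] V3) {s : ℝ} (hs : 0 < s) (hs1 : s ≤ 1)
    {r : ℝ} (u : Sob F r) :
    (𝓕 (rieszGradB B hs hs1 r u).toL2 : Lp V3 2 (volume : Measure E3)) =ᵐ[volume]
      fun ξ => opSymbol B s ξ ((𝓕 u.toL2 : Lp F 2 (volume : Measure E3)) ξ) := by
  have h : fourierSob V3 (r - s) (rieszGradB B hs hs1 r u) =
      opMul (memLp_opSymbol B hs hs1) (fourierSob F r u) :=
    (fourierSob V3 (r - s)).apply_symm_apply _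
  rw [← fourierSob_apply, h]
  exact coeFn_opMul _ _

theorem hat_rieszGradB (B : Fin 3 → F →L[ℂ] V3) {s : ℝ} (hs : 0 < s) (hs1 : s ≤ 1)
    {r : ℝ} (u : Sob F r) :
    (rieszGradB B hs hs1 r u).hat =ᵐ[volume]
      fun ξ => ∑ j : Fin 3, rSymbol s j ξ • B j (u.hat ξ) := by
  filter_upwards [fourier_toL2_rieszGradB B hs hs1 u] with ξ h
  simp only [Sob.hat]
  rw [h, opSymbol, sum_apply, Finset.smul_sum]
  refine Finset.sum_congr rfl fun j _ => ?_
  rw [smul_apply, map_smul, smul_smul, smul_smul]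
  congr 1
  rw [mul_left_comm, weight_mul]
  congr 2
  ring

theorem sum_rSymbol_eq (B : Fin 3 → F →L[ℂ] V3) (s : ℝ) (ξ : E3) (v : F) :
    ∑ j : Fin 3, rSymbol s j ξ • B j v =
      (((2 * Real.pi * ‖ξ‖) ^ (-(1 - s)) : ℝ) : ℂ) • ∑ j : Fin 3, dSymbol j ξ • B j v := by
  simp only [rSymbol, Finset.smul_sum, smul_smul, neg_sub]

theorem isRieszPotential_rieszGradB (B : Fin 3 → F →L[ℂ] V3) {s : ℝ} (hs : 0 < s) (hs1 : s ≤ 1)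
    {r : ℝ} (u : Sob F r) :
    IsRieszPotential (1 - s) (gradB B u.dist) (rieszGradB B hs hs1 r u).dist := by
  refine ⟨_, isFun_fourier_gradB B u.isFun_hat, ?_⟩
  refine (rieszGradB B hs hs1 r u).isFun_hat.congr_ae ?_
  filter_upwards [hat_rieszGradB B hs hs1 u] with ξ h
  rw [h, sum_rSymbol_eq]

/-- A distribution with Fourier transform `|ξ|^{-σ} ĝ` is the function `I_σ g`. -/
theorem isFun_rieszFun {σ : ℝ} (h0 : 0 < σ) (h3 : σ < 3) (g : 𝓢(E3, V3)) {u : 𝓢'(E3, V3)}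
    (hu : IsFun (𝓕 u) (fun ξ => (((2 * Real.pi * ‖ξ‖) ^ (-σ) : ℝ) : ℂ) • (𝓕 g : 𝓢(E3, V3)) ξ)) :
    IsFun u (rieszFun σ g) := by
  intro φ
  have hi : Integrable fun p : E3 × E3 =>
      (fracConst (-σ) / ‖p.1 - p.2‖ ^ (3 - σ)) • φ p.1 • g p.2 := by
    refine ((integrable_rpow_pair g φ (p := 3 - σ) (by linarith)).smul
      (fracConst (-σ))).congr (Eventually.of_forall fun p => ?_)
    simp only [Pi.smul_apply]
    rw [smul_smul, Real.rpow_neg (norm_nonneg _), div_eq_mul_inv]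
  have e : ∀ x, ∫ y, (fracConst (-σ) / ‖x - y‖ ^ (3 - σ)) • φ x • g y = φ x • rieszFun σ g x := by
    intro x
    rw [rieszFun, ← integral_smul]
    refine integral_congr_ae (Eventually.of_forall fun y => ?_)
    simp only [rieszIntegrand]
    rw [Complex.coe_smul, smul_comm]
  refine ⟨?_, ?_⟩
  · have := hi.integral_prod_left
    simpa only [e] using this
  · rw [isFun_dist_apply hu φ]
    have h1 := integral_riesz_kernel g φ h0 h3
    rw [Measure.volume_eq_prod, integral_prod _ hi] at h1
    simp only [e] at h1
    rw [h1]
    refine integral_congr_ae (Eventually.of_forall fun ξ => ?_)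
    simp only
    rw [Complex.coe_smul, smul_comm]

theorem isFun_rieszGradB (B : Fin 3 → F →L[ℂ] V3) {s : ℝ} (hs : 0 < s) (hs1 : s < 1)
    (r : ℝ) (w : 𝓢(E3, F)) :
    IsFun (rieszGradB B hs hs1.le r (ofSchwartz r w)).dist (rieszFun (1 - s) (gradBSchwartz B w)) := by
  refine isFun_rieszFun (by linarith) (by linarith) _ ?_
  refine (rieszGradB B hs hs1.le r _).isFun_hat.congr_ae ?_
  filter_upwards [hat_rieszGradB B hs hs1.le (ofSchwartz r w), hat_ofSchwartz r w,
    fourier_gradBSchwartz B w] with ξ h1 h2 h3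
  rw [h1, h2, h3, sum_rSymbol_eq]

end System

/-! ### The operators `Π D*` and `Π C*` -/

section PiOperators

variable {F : Type} [NormedAddCommGroup F] [InnerProductSpace ℂ F] [CompleteSpace F]

/-- For `0 < s < 1` the point `-s/2` is not a pole of Gamma. At a pole `Real.Gamma` is 0 by
convention and the constant would collapse to 0. -/
theorem fracConst_pos {s : ℝ} (hs : 0 < s) (hs1 : s < 1) : 0 < fracConst s := by
  have h1 : 0 < Real.Gamma ((3 + s) / 2) := Real.Gamma_pos_of_pos (by linarith)
  have h2 : Real.Gamma (-s / 2) ≠ 0 := by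
    refine Real.Gamma_ne_zero fun m h => ?_
    rcases Nat.eq_zero_or_pos m with rfl | hm
    · norm_num at h
      linarith
    · have : (1 : ℝ) ≤ m := by exact_mod_cast hm
      linarith
  unfold fracConst
  positivity

theorem integrable_of_add_left {G : Type} [NormedAddCommGroup G] {f : E3 → G} (x : E3)
    (h : Integrable fun z => f (x + z)) : Integrable f := by
  simpa using h.comp_add_left (-x)

theorem gradBSchwartz_apply (B : Fin 3 → F →L[ℂ] V3) (w : 𝓢(E3, F)) (x : E3) :
    gradBSchwartz B w x = ∑ j : Fin 3, B j ((∂_{basisE j} w) x) := by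
  simp [gradBSchwartz, sum_apply]

theorem rieszIntegrand_shift {s : ℝ} (g : E3 → V3) (x z : E3) :
    rieszIntegrand (1 - s) g x (x + z) = fracConst (s - 1) • ‖z‖ ^ (-(2 + s)) • g (x + z) := by
  have e : x - (x + z) = -z := by abel
  rw [rieszIntegrand, Complex.coe_smul, e, norm_neg, smul_smul, Real.rpow_neg (norm_nonneg _),
    div_eq_mul_inv]
  congr 3
  · ring_nf
  · ring_nf

/-- The factor `√C_{3,s}/√2` of `α` cancels against its inverse in `piConst`, and the powers of
`‖z‖` combine as `3/2 + (3/2 + s + 1) = 4 + s`. At `z = 0` both sides vanish because of the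
difference of `w`. -/
theorem piIntegrand_shift (B : Fin 3 → F →L[ℂ] V3) {s : ℝ} (hs : 0 < s) (hs1 : s < 1)
    (w : E3 → F) (x z : E3) :
    piIntegrand s (starB B s w) x (x + z) = (fracConst (s - 1) * (2 + s)) •
      ∑ j : Fin 3, B j ((inner ℝ z (basisE j) * ‖z‖ ^ (-(4 + s))) • (w (x + z) - w x)) := by
  rcases eq_or_ne z 0 with rfl | hz
  · simp [piIntegrand, starB]
  have hz0 : 0 < ‖z‖ := norm_pos_iff.mpr hz
  have e : x - (x + z) = -z := by abel
  have hC := Real.sqrt_pos.mpr (fracConst_pos hs hs1)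
  have h2 : (0 : ℝ) < Real.sqrt 2 := by positivity
  simp only [piIntegrand, starB, alpha, piConst, e, norm_neg, add_sub_cancel_left, Complex.coe_smul,
    Finset.smul_sum, PiLp.smul_apply, smul_eq_mul, ContinuousLinearMap.map_smul_of_tower,
    smul_smul, inner_basisE]
  refine Finset.sum_congr rfl fun j _ => ?_
  congr 1
  have e1 : ‖z‖ ^ (-(4 + s)) = (‖z‖ ^ (3 / 2 : ℝ))⁻¹ * (‖z‖ ^ (3 / 2 + s + 1))⁻¹ := by
    rw [← Real.rpow_neg hz0.le, ← Real.rpow_neg hz0.le, ← Real.rpow_add hz0]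
    congr 1
    ring
  rw [e1]
  field_simp
  ring

/-- Integration by parts in each coordinate; the factor `2 + s` built into `piConst` is the one
produced by differentiating `‖z‖^{-(2+s)}`. -/
theorem pi_starB (B : Fin 3 → F →L[ℂ] V3) {s : ℝ} (hs : 0 < s) (hs1 : s < 1) (w : 𝓢(E3, F))
    (x : E3) :
    Integrable (piIntegrand s (starB B s w) x) ∧
      Integrable (rieszIntegrand (1 - s) (gradBSchwartz B w) x) ∧
      piFun s (starB B s w) x = rieszFun (1 - s) (gradBSchwartz B w) x := by
  have i1 : ∀ j : Fin 3, Integrable fun z : E3 =>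
      B j ((inner ℝ z (basisE j) * ‖z‖ ^ (-(4 + s))) • (w (x + z) - w x)) := fun j =>
    (B j).integrable_comp (integrable_diff_kernel w hs hs1 x (basisE j))
  have i2 : ∀ j : Fin 3, Integrable fun z : E3 =>
      B j (‖z‖ ^ (-(2 + s)) • (∂_{basisE j} w) (x + z)) := fun j =>
    (B j).integrable_comp (integrable_rpow_smul_schwartz (∂_{basisE j} w) (by linarith) x)
  have e2 : ∀ z, rieszIntegrand (1 - s) (gradBSchwartz B w) x (x + z) =
      fracConst (s - 1) • ∑ j : Fin 3, B j (‖z‖ ^ (-(2 + s)) • (∂_{basisE j} w) (x + z)) := by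
    intro z
    rw [rieszIntegrand_shift, gradBSchwartz_apply, Finset.smul_sum]
    simp only [ContinuousLinearMap.map_smul_of_tower]
  refine ⟨?_, ?_, ?_⟩
  · refine integrable_of_add_left x ?_
    simp only [piIntegrand_shift B hs hs1]
    exact (integrable_finsetSum Finset.univ fun j _ => i1 j).smul (fracConst (s - 1) * (2 + s))
  · refine integrable_of_add_left x ?_
    simp only [e2]
    exact (integrable_finsetSum Finset.univ fun j _ => i2 j).smul (fracConst (s - 1))
  · rw [piFun, rieszFun, ← integral_add_left_eq_self _ x,
      ← integral_add_left_eq_self (rieszIntegrand _ _ _) x]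
    simp only [piIntegrand_shift B hs hs1, e2]
    rw [integral_smul, integral_smul, integral_finsetSum _ fun j _ => i1 j,
      integral_finsetSum _ fun j _ => i2 j, mul_smul, Finset.smul_sum]
    congr 1
    refine Finset.sum_congr rfl fun j _ => ?_
    rw [(B j).integral_comp_comm (integrable_diff_kernel w hs hs1 x (basisE j)),
      (B j).integral_comp_comm
        (integrable_rpow_smul_schwartz (∂_{basisE j} w) (by linarith) x),
      integral_rpow_smul_lineDeriv w hs hs1 x (basisE j), ContinuousLinearMap.map_smul_of_tower]

theorem extendsOne_rieszGradB (B : Fin 3 → F →L[ℂ] V3) {s : ℝ} (hs : 0 < s) (hs1 : s < 1)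
    (r : ℝ) : ExtendsOne (fun w => piFun s (starB B s w)) (rieszGradB B hs hs1.le r) := by
  intro w _
  have : piFun s (starB B s w) = rieszFun (1 - s) (gradBSchwartz B w) := by
    ext x : 1
    exact (pi_starB B hs hs1 w x).2.2
  change IsFun _ (piFun s (starB B s w))
  rw [this]
  exact isFun_rieszGradB B hs hs1 r w

theorem ExtendsOne.unique {r t : ℝ} {P : (E3 → F) → E3 → V3} {S T : Sob F r →L[ℂ] Sob V3 t}
    (hS : ExtendsOne P S) (hT : ExtendsOne P T) : S = T := by
  refine sob_clm_ext fun w hw => Sob.dist_injective ?_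
  exact (hS w hw).eq_of_ae (hT w hw) (ae_eq_refl _)

/-- An extension exists, so the operator chosen by `epsilon` is an extension, and uniqueness by
density identifies it with the explicit Fourier multiplier. -/
theorem piD_eq {s : ℝ} (hs : 0 < s) (hs1 : s < 1) (r : ℝ) :
    PiD s r = rieszGradB (fun j => -embedCLM j) hs hs1.le r := by
  have h := extendsOne_rieszGradB (fun j => -embedCLM j) hs hs1 r
  rw [← dStar_eq_starB] at h
  exact ExtendsOne.unique (Classical.epsilon_spec ⟨_, h⟩) h

theorem piC_eq {s : ℝ} (hs : 0 < s) (hs1 : s < 1) (r : ℝ) :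
    PiC s r = rieszGradB crossCLM hs hs1.le r := by
  have h := extendsOne_rieszGradB crossCLM hs hs1 r
  rw [← cStar_eq_starB] at h
  exact ExtendsOne.unique (Classical.epsilon_spec ⟨_, h⟩) h

theorem extendsOne_piD_iff {s : ℝ} (hs : 0 < s) (hs1 : s < 1) (r : ℝ)
    (T : Sob ℂ r →L[ℂ] Sob V3 (r - s)) :
    ExtendsOne (fun w => piFun s (dStar s w)) T ↔ T = PiD s r := by
  have h := extendsOne_rieszGradB (fun j => -embedCLM j) hs hs1 r
  rw [← dStar_eq_starB] at h
  rw [piD_eq hs hs1]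
  exact ⟨fun hT => hT.unique h, fun hT => hT ▸ h⟩

theorem extendsOne_piC_iff {s : ℝ} (hs : 0 < s) (hs1 : s < 1) (r : ℝ)
    (T : Sob V3 r →L[ℂ] Sob V3 (r - s)) :
    ExtendsOne (fun w => piFun s (cStar s w)) T ↔ T = PiC s r := by
  have h := extendsOne_rieszGradB crossCLM hs hs1 r
  rw [← cStar_eq_starB] at h
  rw [piC_eq hs hs1]
  exact ⟨fun hT => hT.unique h, fun hT => hT ▸ h⟩

theorem gradBSchwartz_embed (f : 𝓢(E3, ℂ)) (x : E3) :
    gradBSchwartz (fun j => -embedCLM j) f x = -gradFun f x := by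
  rw [gradBSchwartz_apply]
  ext i
  fin_cases i <;> simp [gradFun, SchwartzMap.lineDerivOp_apply_eq_fderiv, embedCLM, toV3, basisE,
    Fin.sum_univ_three]

theorem gradBSchwartz_cross (f : 𝓢(E3, V3)) : ⇑(gradBSchwartz crossCLM f) = curlFun f := by
  ext x : 1
  rw [gradBSchwartz_apply]
  rfl

theorem piFun_dStar {s : ℝ} (hs : 0 < s) (hs1 : s < 1) (f : 𝓢(E3, ℂ)) (x : E3) :
    Integrable (piIntegrand s (dStar s f) x) ∧
      Integrable (rieszIntegrand (1 - s) (gradFun f) x) ∧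
      piFun s (dStar s f) x = -rieszFun (1 - s) (gradFun f) x := by
  obtain ⟨h1, h2, h3⟩ := pi_starB (fun j => -embedCLM j) hs hs1 f x
  have e : rieszIntegrand (1 - s) (gradBSchwartz (fun j => -embedCLM j) f) x =
      -rieszIntegrand (1 - s) (gradFun f) x := by
    ext y : 1
    simp only [rieszIntegrand, gradBSchwartz_embed, smul_neg, Pi.neg_apply]
  rw [dStar_eq_starB]
  rw [e] at h2
  refine ⟨h1, by simpa using h2.neg, ?_⟩
  rw [h3, rieszFun, e]
  exact integral_neg _

theorem piFun_cStar {s : ℝ} (hs : 0 < s) (hs1 : s < 1) (f : 𝓢(E3, V3)) (x : E3) :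
    Integrable (piIntegrand s (cStar s f) x) ∧
      Integrable (rieszIntegrand (1 - s) (curlFun f) x) ∧
      piFun s (cStar s f) x = rieszFun (1 - s) (curlFun f) x := by
  rw [cStar_eq_starB, ← gradBSchwartz_cross]
  exact pi_starB crossCLM hs hs1 f x

theorem Sob.hat_zero {r : ℝ} : (0 : Sob F r).hat =ᵐ[volume] fun _ => 0 := by
  have h1 : (𝓕 (0 : Sob F r).toL2 : Lp F 2 (volume : Measure E3)) = 0 := by
    rw [← fourierSob_apply, map_zero]
  filter_upwards [Lp.coeFn_zero F 2 (volume : Measure E3)] with ξ h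
  simp only [Sob.hat]
  rw [h1, h, Pi.zero_apply, smul_zero]

/-- The scalar factors of the two symbols come out, and what is left is `ξ × ξ = 0`. -/
theorem piC_piD {s : ℝ} (hs : 0 < s) (hs1 : s < 1) (r : ℝ) (f : Sob ℂ r) :
    PiC s (r - s) (PiD s r f) = 0 := by
  rw [piC_eq hs hs1, piD_eq hs hs1]
  refine Sob.ext_hat (EventuallyEq.trans ?_ Sob.hat_zero.symm)
  filter_upwards [hat_rieszGradB crossCLM hs hs1.le (rieszGradB (fun j => -embedCLM j) hs hs1.le r f),
    hat_rieszGradB (fun j => -embedCLM j) hs hs1.le f] with ξ h1 h2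
  rw [h1, h2]
  ext i
  fin_cases i <;> simp [rSymbol, dSymbol, crossCLM, cross, embedCLM, toV3, basisE,
    Fin.sum_univ_three] <;> ring

/-- The cross product with a real vector is skew-symmetric, the factor `i` makes it Hermitian, and
all other factors of the symbol are real. -/
theorem inner_crossCLM_symbol (s : ℝ) (ξ : E3) (a b : V3) :
    inner ℂ b (opSymbol crossCLM s ξ a) = inner ℂ (opSymbol crossCLM s ξ b) a := by
  have hw : (starRingEnd ℂ) (weight (-s) ξ) = weight (-s) ξ := Complex.conj_ofReal _
  have h2 : (starRingEnd ℂ) (2 : ℂ) = 2 := Complex.conj_ofNat 2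
  simp only [opSymbol, rSymbol, dSymbol, crossCLM, cross, toV3, basisE, Fin.sum_univ_three,
    PiLp.inner_apply, add_apply, smul_apply, PiLp.add_apply, PiLp.smul_apply, smul_eq_mul, map_add,
    map_mul, RCLike.inner_apply, hw, h2, Complex.conj_ofReal, Complex.conj_I]
  simp
  ring

/-- By Plancherel both pairings become integrals over frequency. The normalised symbol `opSymbol`
does not involve the Sobolev order, so the same Hermitian matrix acts on both sides. -/
theorem pairing_piC {s : ℝ} (hs : 0 < s) (hs1 : s < 1) (r : ℝ) (f : Sob V3 r)
    (ψ : Sob V3 (s - r)) (h1 : r - s + (s - r) = 0) (h2 : r + (s - r - s) = 0) :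
    dualityPairing h1 (PiC s r f) ψ = dualityPairing h2 f (PiC s (s - r) ψ) := by
  rw [piC_eq hs hs1, piC_eq hs hs1, dualityPairing, dualityPairing, ← Lp.inner_fourier_eq,
    ← Lp.inner_fourier_eq (rieszGradB crossCLM hs hs1.le (s - r) ψ).toL2, L2.inner_def, L2.inner_def]
  refine integral_congr_ae ?_
  filter_upwards [fourier_toL2_rieszGradB crossCLM hs hs1.le f,
    fourier_toL2_rieszGradB crossCLM hs hs1.le ψ] with ξ e1 e2
  rw [e1, e2, inner_crossCLM_symbol]

/-! ### The limit `s → 1` -/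

/-- The symbol of `⟨D⟩^{-1} (I_{1-s} - 1) ∑ⱼ Bⱼ ∂ⱼ`. -/
def diffSymbol (B : Fin 3 → F →L[ℂ] V3) (s : ℝ) (ξ : E3) : F →L[ℂ] V3 :=
  ∑ j : Fin 3, ((rSymbol s j ξ - rSymbol 1 j ξ) * weight (-1) ξ) • B j

theorem rSymbol_one (j : Fin 3) (ξ : E3) : rSymbol 1 j ξ = dSymbol j ξ := by
  simp [rSymbol]

theorem norm_diffSymbol_le (B : Fin 3 → F →L[ℂ] V3) {s : ℝ} (hs : 0 < s) (hs1 : s ≤ 1) (ξ : E3) :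
    ‖diffSymbol B s ξ‖ ≤ ∑ j : Fin 3, 4 * Real.pi * ‖B j‖ := by
  refine (norm_sum_le _ _).trans (Finset.sum_le_sum fun j _ => ?_)
  rw [norm_smul]
  gcongr
  have hb : (1 : ℝ) ≤ 1 + ‖ξ‖ ^ 2 := by nlinarith [sq_nonneg ‖ξ‖]
  have h1 := norm_rSymbol_le hs hs1 j ξ
  have h2 := norm_rSymbol_le one_pos le_rfl j ξ
  have h3 : (1 + ‖ξ‖ ^ 2) ^ (s / 2) ≤ (1 + ‖ξ‖ ^ 2) ^ (1 / 2 : ℝ) :=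
    Real.rpow_le_rpow_of_exponent_le hb (by linarith)
  have h4 : ‖rSymbol s j ξ - rSymbol 1 j ξ‖ ≤ 4 * Real.pi * (1 + ‖ξ‖ ^ 2) ^ (1 / 2 : ℝ) := by
    refine (norm_sub_le _ _).trans ?_
    nlinarith [Real.pi_pos]
  rw [norm_mul, norm_weight]
  refine (mul_le_mul_of_nonneg_right h4 (by positivity)).trans ?_
  rw [mul_assoc, ← Real.rpow_add (by positivity)]
  norm_num

theorem tendsto_diffSymbol (B : Fin 3 → F →L[ℂ] V3) {ξ : E3} (hξ : ξ ≠ 0) :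
    Tendsto (fun s => diffSymbol B s ξ) (𝓝[<] 1) (𝓝 0) := by
  have h : ∀ j : Fin 3, Tendsto (fun s => ((rSymbol s j ξ - rSymbol 1 j ξ) * weight (-1) ξ) • B j)
      (𝓝[<] 1) (𝓝 0) := by
    intro j
    have hc : ContinuousAt (fun s => rSymbol s j ξ) 1 := by
      have hr : 0 < 2 * Real.pi * ‖ξ‖ := by
        have := norm_pos_iff.mpr hξ
        positivity
      have : ContinuousAt (fun s : ℝ => (2 * Real.pi * ‖ξ‖) ^ (s - 1)) 1 :=
        ContinuousAt.rpow continuousAt_const (by fun_prop) (Or.inl hr.ne')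
      exact (Complex.continuous_ofReal.continuousAt.comp this).mul continuousAt_const
    have h1 : Tendsto (fun s => rSymbol s j ξ) (𝓝[<] 1) (𝓝 (rSymbol 1 j ξ)) :=
      hc.tendsto.mono_left nhdsWithin_le_nhds
    have h2 := ((h1.sub_const (rSymbol 1 j ξ)).mul_const (weight (-1) ξ)).smul_const (B j)
    rw [sub_self, zero_mul] at h2
    exact (zero_smul ℂ (B j)) ▸ h2
  simpa [diffSymbol] using tendsto_finsetSum Finset.univ fun j _ => h j

theorem measurable_diffSymbol (B : Fin 3 → F →L[ℂ] V3) (s : ℝ) :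
    AEStronglyMeasurable (diffSymbol B s) (volume : Measure E3) := by
  unfold diffSymbol
  refine Finset.aestronglyMeasurable_fun_sum _ fun j _ => ?_
  exact ((((measurable_rSymbol s j).sub (measurable_rSymbol 1 j)).mul
    (continuous_weight (-1)).measurable).aestronglyMeasurable).smul_const _

theorem norm_diffSymbol_apply_le (B : Fin 3 → F →L[ℂ] V3) {s : ℝ} (hs : 0 < s) (hs1 : s ≤ 1)
    (ξ : E3) (v : F) :
    ‖diffSymbol B s ξ v‖ ≤ ‖(∑ j : Fin 3, 4 * Real.pi * ‖B j‖ : ℝ) • v‖ := by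
  rw [norm_smul, Real.norm_of_nonneg (by positivity)]
  exact ((diffSymbol B s ξ).le_opNorm v).trans
    (mul_le_mul_of_nonneg_right (norm_diffSymbol_le B hs hs1 ξ) (norm_nonneg _))

theorem aestronglyMeasurable_diffSymbol_apply (B : Fin 3 → F →L[ℂ] V3) (s : ℝ)
    (g : Lp F 2 (volume : Measure E3)) :
    AEStronglyMeasurable (fun ξ => diffSymbol B s ξ (g ξ)) (volume : Measure E3) :=
  (ContinuousLinearMap.id ℂ (F →L[ℂ] V3)).aestronglyMeasurable_comp₂
    (measurable_diffSymbol B s) (Lp.memLp g).1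

theorem memLp_diffSymbol (B : Fin 3 → F →L[ℂ] V3) {s : ℝ} (hs : 0 < s) (hs1 : s ≤ 1)
    (g : Lp F 2 (volume : Measure E3)) :
    MemLp (fun ξ => diffSymbol B s ξ (g ξ)) 2 (volume : Measure E3) :=
  ((Lp.memLp g).const_smul (∑ j : Fin 3, 4 * Real.pi * ‖B j‖ : ℝ)).mono
    (aestronglyMeasurable_diffSymbol_apply B s g)
    (Eventually.of_forall fun ξ => norm_diffSymbol_apply_le B hs hs1 ξ (g ξ))

/-- Dominated convergence: the symbol difference is bounded uniformly in `s` and `ξ`, and tends to 0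
at each `ξ ≠ 0`. -/
theorem tendsto_eLpNorm_diffSymbol (B : Fin 3 → F →L[ℂ] V3) (g : Lp F 2 (volume : Measure E3)) :
    Tendsto (fun s : ℝ => eLpNorm (fun ξ => diffSymbol B s ξ (g ξ)) 2 (volume : Measure E3))
      (𝓝[<] 1) (𝓝 0) := by
  have hev : ∀ᶠ s : ℝ in 𝓝[<] 1, 0 < s ∧ s < 1 := Ioo_mem_nhdsLT one_pos
  have key : Tendsto (fun s : ℝ => ∫⁻ ξ, ‖diffSymbol B s ξ (g ξ)‖ₑ ^ (2 : ℝ)) (𝓝[<] 1)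
      (𝓝 (∫⁻ _ : E3, 0)) := by
    refine tendsto_lintegral_filter_of_dominated_convergence'
      (fun ξ => ‖(∑ j : Fin 3, 4 * Real.pi * ‖B j‖ : ℝ) • g ξ‖ₑ ^ (2 : ℝ)) ?_ ?_ ?_ ?_
    · exact Eventually.of_forall fun s =>
        (aestronglyMeasurable_diffSymbol_apply B s g).enorm.pow_const _
    · filter_upwards [hev] with s hs
      refine Eventually.of_forall fun ξ => ?_
      gcongr
      exact enorm_le_iff_norm_le.mpr (norm_diffSymbol_apply_le B hs.1 hs.2.le ξ (g ξ))
    · have h1 := ((Lp.memLp g).const_smul (∑ j : Fin 3, 4 * Real.pi * ‖B j‖ : ℝ)).2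
      rw [eLpNorm_lt_top_iff_lintegral_rpow_enorm_lt_top two_ne_zero ENNReal.ofNat_ne_top] at h1
      simpa using h1.ne
    · filter_upwards [ae_ne_zero] with ξ hξ
      have h1 : Tendsto (fun s => diffSymbol B s ξ (g ξ)) (𝓝[<] 1) (𝓝 0) := by
        have h0 := ((ContinuousLinearMap.apply ℂ V3 (g ξ)).continuous.tendsto 0).comp
          (tendsto_diffSymbol B hξ)
        rwa [map_zero] at h0
      have h2 := (ENNReal.continuous_rpow_const (y := 2)).tendsto _ |>.comp h1.enorm
      simpa [Function.comp_def] using h2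
  simp only [eLpNorm_eq_lintegral_rpow_enorm_toReal two_ne_zero ENNReal.ofNat_ne_top]
  have h2 := (ENNReal.continuous_rpow_const (y := 1 / 2)).tendsto _ |>.comp key
  simpa [Function.comp_def] using h2

theorem fourier_sub (u v : 𝓢'(E3, F)) : 𝓕 (u - v) = 𝓕 u - 𝓕 v :=
  map_sub (FourierTransform.fourierCLM ℂ 𝓢'(E3, F)) u v

/-- The target `H^{r-s}` moves with `s`, so the comparison is made between distributions, in the
norm of `H^{r-1}`. There the Fourier transform of the error is `diffSymbol` applied to the `L²`
representative of `f`. -/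
theorem tendsto_rieszGradB (B : Fin 3 → F →L[ℂ] V3) (r : ℝ) (f : Sob F r)
    (T : ∀ s : ℝ, Sob F r →L[ℂ] Sob V3 (r - s))
    (hT : ∀ s (hs : 0 < s) (hs1 : s < 1), T s = rieszGradB B hs hs1.le r) :
    Tendsto (fun s : ℝ => sobENorm (r - 1) ((T s f).dist - gradB B f.dist)) (𝓝[<] 1) (𝓝 0) := by
  have hev : ∀ᶠ s : ℝ in 𝓝[<] 1, 0 < s ∧ s < 1 := Ioo_mem_nhdsLT one_pos
  refine tendsto_of_tendsto_of_tendsto_of_le_of_le' tendsto_const_nhds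
    (tendsto_eLpNorm_diffSymbol B (𝓕 f.toL2)) (Eventually.of_forall fun _ => zero_le) ?_
  filter_upwards [hev] with s hs
  rw [hT s hs.1 hs.2]
  have h1 := (rieszGradB B hs.1 hs.2.le r f).isFun_hat.sub (isFun_fourier_gradB B f.isFun_hat)
  rw [← fourier_sub] at h1
  have h2 : (fun ξ => weight (r - 1) ξ • ((rieszGradB B hs.1 hs.2.le r f).hat ξ -
      ∑ j : Fin 3, dSymbol j ξ • B j (f.hat ξ))) =ᵐ[volume]
      fun ξ => diffSymbol B s ξ ((𝓕 f.toL2 : Lp F 2 (volume : Measure E3)) ξ) := by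
    filter_upwards [hat_rieszGradB B hs.1 hs.2.le f] with ξ h
    rw [h, ← Finset.sum_sub_distrib, Finset.smul_sum, diffSymbol, sum_apply]
    refine Finset.sum_congr rfl fun j _ => ?_
    rw [← sub_smul, Sob.hat, map_smul, smul_apply, smul_smul, smul_smul, rSymbol_one]
    congr 1
    rw [mul_comm (weight (r - 1) ξ), mul_assoc, weight_mul]
    congr 2
    ring
  have h3 := memLp_diffSymbol B hs.1 hs.2.le (𝓕 f.toL2)
  rw [← eLpNorm_congr_ae h2]
  exact sobENorm_le_of_isFun h1 ((memLp_congr_ae h2).mpr h3)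

end PiOperators

/-! ### Partial integration of two-point test functions against a singular kernel -/

section PartialIntegral

variable {F : Type} [NormedAddCommGroup F] [NormedSpace ℝ F]

/-- `y ↦ ∫ a(h) Φ(y, h) dh`. -/
def partialInt (a : E3 → ℝ) (Φ : E3 × E3 → F) (y : E3) : F := ∫ h, a h • Φ (y, h)

variable (F) in
/-- Restriction of a linear map on `ℝ³ × ℝ³` to the first factor. -/
def precompInl : (E3 × E3 →L[ℝ] F) →L[ℝ] (E3 →L[ℝ] F) :=
  ContinuousLinearMap.precomp F (ContinuousLinearMap.inl ℝ E3 E3)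

/-- The partial derivative in the first variable. -/
def fderivFst (Φ : 𝓢(E3 × E3, F)) : 𝓢(E3 × E3, E3 →L[ℝ] F) :=
  (SchwartzMap.fderivCLM ℝ (E3 × E3) F Φ).postcompCLM (precompInl F)

theorem hasFDerivAt_fst (Φ : 𝓢(E3 × E3, F)) (y h : E3) :
    HasFDerivAt (fun y => Φ (y, h)) (fderivFst Φ (y, h)) y :=
  (Φ.hasFDerivAt (y, h)).comp y (hasFDerivAt_prodMk_left y h)

theorem norm_iteratedFDeriv_fderivFst_le (Φ : 𝓢(E3 × E3, F)) (n : ℕ) (p : E3 × E3) :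
    ‖iteratedFDeriv ℝ n (fderivFst Φ) p‖ ≤ ‖iteratedFDeriv ℝ (n + 1) Φ p‖ := by
  have h1 := (precompInl F).norm_iteratedFDeriv_comp_left
    (f := SchwartzMap.fderivCLM ℝ (E3 × E3) F Φ) (x := p) (n := n)
    ((SchwartzMap.fderivCLM ℝ (E3 × E3) F Φ).smooth n).contDiffAt le_rfl
  have h2 : ‖precompInl F‖ ≤ 1 := by
    refine ContinuousLinearMap.opNorm_le_bound _ zero_le_one fun L => ?_
    refine (ContinuousLinearMap.opNorm_comp_le _ _).trans ?_
    rw [mul_comm]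
    gcongr
    exact ContinuousLinearMap.norm_inl_le_one ℝ E3 E3
  have h3 : ‖iteratedFDeriv ℝ n (SchwartzMap.fderivCLM ℝ (E3 × E3) F Φ) p‖ =
      ‖iteratedFDeriv ℝ (n + 1) Φ p‖ := norm_iteratedFDeriv_fderiv
  rw [← h3]
  exact h1.trans (mul_le_of_le_one_left (norm_nonneg _) h2)

/-- A Schwartz seminorm that controls the derivatives of order `n` with weight `(1 + |p|)^N`. -/
def pairBound (𝕜 : Type) [RCLike 𝕜] [NormedSpace 𝕜 F] [SMulCommClass ℝ 𝕜 F] (N n : ℕ)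
    (Φ : 𝓢(E3 × E3, F)) : ℝ :=
  2 ^ N * (Finset.Iic (N, n)).sup (fun m => SchwartzMap.seminorm 𝕜 m.1 m.2) Φ

/-- The weight `(1 + ‖(y,h)‖)^{k+q}` is split: `k` powers pay for `‖y‖^k`, and `q` powers give the
decay in `h` that makes the kernel integrable. -/
theorem norm_iteratedFDeriv_pair_le (𝕜 : Type) [RCLike 𝕜] [NormedSpace 𝕜 F]
    [SMulCommClass ℝ 𝕜 F] (Φ : 𝓢(E3 × E3, F)) (k q n : ℕ) (y h : E3) :
    ‖y‖ ^ k * ‖iteratedFDeriv ℝ n Φ (y, h)‖ ≤ pairBound 𝕜 (k + q) n Φ * ((1 + ‖h‖) ^ q)⁻¹ := by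
  have h1 := SchwartzMap.one_add_le_sup_seminorm_apply (𝕜 := 𝕜) (m := (k + q, n)) (k := k + q)
    (n := n) le_rfl le_rfl Φ (y, h)
  rw [le_mul_inv_iff₀ (by positivity)]
  refine le_trans ?_ h1
  have hy : ‖y‖ ≤ 1 + ‖(y, h)‖ := (norm_fst_le (y, h)).trans (by linarith)
  have hh : 1 + ‖h‖ ≤ 1 + ‖(y, h)‖ := by linarith [norm_snd_le (y, h)]
  rw [pow_add, mul_right_comm]
  gcongr

theorem norm_kernel_smul_le (𝕜 : Type) [RCLike 𝕜] [NormedSpace 𝕜 F]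
    [SMulCommClass ℝ 𝕜 F] (a : E3 → ℝ) (Φ : 𝓢(E3 × E3, F)) (k q n : ℕ) (y h : E3) :
    ‖a h‖ * (‖y‖ ^ k * ‖iteratedFDeriv ℝ n Φ (y, h)‖) ≤ pairBound 𝕜 (k + q) n Φ *
      (‖a h‖ * ((1 + ‖h‖) ^ q)⁻¹) := by
  refine (mul_le_mul_of_nonneg_left (norm_iteratedFDeriv_pair_le 𝕜 Φ k q n y h)
    (norm_nonneg _)).trans_eq ?_
  ring

variable {a : E3 → ℝ} {q : ℕ}

theorem integrable_partialInt (hm : Measurable a)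
    (ha : Integrable fun h => ‖a h‖ * ((1 + ‖h‖) ^ q)⁻¹) (Φ : 𝓢(E3 × E3, F)) (y : E3) :
    Integrable fun h => a h • Φ (y, h) := by
  refine (ha.const_mul (pairBound ℝ (0 + q) 0 Φ)).mono' (hm.aestronglyMeasurable.smul
    (Φ.continuous.comp (by fun_prop)).aestronglyMeasurable) (Eventually.of_forall fun h => ?_)
  have := norm_kernel_smul_le ℝ a Φ 0 q 0 y h
  rwa [norm_iteratedFDeriv_zero, pow_zero, one_mul, ← norm_smul] at this

theorem hasFDerivAt_partialInt (hm : Measurable a)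
    (ha : Integrable fun h => ‖a h‖ * ((1 + ‖h‖) ^ q)⁻¹) (Φ : 𝓢(E3 × E3, F)) (y : E3) :
    HasFDerivAt (partialInt a Φ) (partialInt a (fderivFst Φ) y) y := by
  refine hasFDerivAt_integral_of_dominated_of_fderiv_le (s := Set.univ) (𝕜 := ℝ)
    (F := fun y h => a h • Φ (y, h)) (F' := fun y h => a h • fderivFst Φ (y, h)) univ_mem
    (Eventually.of_forall fun y => (integrable_partialInt hm ha Φ y).1)
    (integrable_partialInt hm ha Φ y) (integrable_partialInt hm ha (fderivFst Φ) y).1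
    (Eventually.of_forall fun h y _ => ?_) (ha.const_mul (pairBound ℝ (0 + q) 0 (fderivFst Φ)))
    (Eventually.of_forall fun h y _ => (hasFDerivAt_fst Φ y h).const_smul (a h))
  have := norm_kernel_smul_le ℝ a (fderivFst Φ) 0 q 0 y h
  rwa [norm_iteratedFDeriv_zero, pow_zero, one_mul, ← norm_smul] at this

/-- Differentiating under the integral gives the partial integral of `fderivFst Φ`, whose values are
linear maps; the induction therefore runs over all target spaces at once. -/
theorem contDiff_partialInt (hm : Measurable a)
    (ha : Integrable fun h => ‖a h‖ * ((1 + ‖h‖) ^ q)⁻¹) (n : ℕ) :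
    ∀ {F : Type} [NormedAddCommGroup F] [NormedSpace ℝ F] (Φ : 𝓢(E3 × E3, F)),
      ContDiff ℝ n (partialInt a Φ) := by
  induction n with
  | zero =>
    intro F _ _ Φ
    refine contDiff_zero.mpr (continuous_iff_continuousAt.mpr fun y => ?_)
    exact (hasFDerivAt_partialInt hm ha Φ y).continuousAt
  | succ n ih =>
    intro F _ _ Φ
    push_cast
    refine contDiff_succ_iff_fderiv.mpr ⟨fun y => (hasFDerivAt_partialInt hm ha Φ
      y).differentiableAt, by simp, ?_⟩
    have : fderiv ℝ (partialInt a Φ) = partialInt a (fderivFst Φ) :=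
      funext fun y => (hasFDerivAt_partialInt hm ha Φ y).fderiv
    rw [this]
    exact ih (fderivFst Φ)

theorem integrable_norm_iteratedFDeriv (hm : Measurable a)
    (ha : Integrable fun h => ‖a h‖ * ((1 + ‖h‖) ^ q)⁻¹) (Φ : 𝓢(E3 × E3, F)) (n : ℕ) (y : E3) :
    Integrable fun h => ‖a h‖ * ‖iteratedFDeriv ℝ n Φ (y, h)‖ := by
  refine (ha.const_mul (pairBound ℝ (0 + q) n Φ)).mono' ?_ (Eventually.of_forall fun h => ?_)
  · have hc : Continuous (iteratedFDeriv ℝ n Φ) :=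
      (Φ.smooth n).continuous_iteratedFDeriv le_rfl
    exact hm.aestronglyMeasurable.norm.mul
      (hc.norm.comp (by fun_prop : Continuous fun h : E3 => (y, h))).aestronglyMeasurable
  · have := norm_kernel_smul_le ℝ a Φ 0 q n y h
    rwa [pow_zero, one_mul, ← Real.norm_of_nonneg (by positivity :
      0 ≤ ‖a h‖ * ‖iteratedFDeriv ℝ n Φ (y, h)‖)] at this

theorem norm_iteratedFDeriv_partialInt_le (hm : Measurable a)
    (ha : Integrable fun h => ‖a h‖ * ((1 + ‖h‖) ^ q)⁻¹) (n : ℕ) :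
    ∀ {F : Type} [NormedAddCommGroup F] [NormedSpace ℝ F] (Φ : 𝓢(E3 × E3, F)) (y : E3),
      ‖iteratedFDeriv ℝ n (partialInt a Φ) y‖ ≤ ∫ h, ‖a h‖ * ‖iteratedFDeriv ℝ n Φ (y, h)‖ := by
  induction n with
  | zero =>
    intro F _ _ Φ y
    simp only [norm_iteratedFDeriv_zero, ← norm_smul]
    exact norm_integral_le_integral_norm _
  | succ n ih =>
    intro F _ _ Φ y
    have : fderiv ℝ (partialInt a Φ) = partialInt a (fderivFst Φ) :=
      funext fun y => (hasFDerivAt_partialInt hm ha Φ y).fderiv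
    rw [← norm_iteratedFDeriv_fderiv, this]
    refine (ih (fderivFst Φ) y).trans ?_
    refine integral_mono (integrable_norm_iteratedFDeriv hm ha (fderivFst Φ) n y)
      (integrable_norm_iteratedFDeriv hm ha Φ (n + 1) y) fun h => ?_
    exact mul_le_mul_of_nonneg_left (norm_iteratedFDeriv_fderivFst_le Φ n (y, h)) (norm_nonneg _)

/-- `Φ ↦ (y ↦ ∫ a(h) Φ(y, h) dh)`, as an operator on Schwartz functions. -/
def partialIntCLM (hm : Measurable a) (ha : Integrable fun h => ‖a h‖ * ((1 + ‖h‖) ^ q)⁻¹) :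
    𝓢(E3 × E3, ℂ) →L[ℂ] 𝓢(E3, ℂ) :=
  SchwartzMap.mkCLM (fun Φ => partialInt a Φ)
    (fun Φ Ψ y => by
      simp only [partialInt, add_apply, smul_add]
      exact integral_add (integrable_partialInt hm ha Φ y) (integrable_partialInt hm ha Ψ y))
    (fun c Φ y => by
      simp only [partialInt, smul_apply, RingHom.id_apply, smul_comm _ c]
      exact integral_smul c _)
    (fun Φ => contDiff_infty.mpr fun n => contDiff_partialInt hm ha n Φ)
    (fun m => ⟨Finset.Iic (m.1 + q, m.2),
      2 ^ (m.1 + q) * ∫ h, ‖a h‖ * ((1 + ‖h‖) ^ q)⁻¹,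
      mul_nonneg (by positivity) (integral_nonneg fun h => by positivity), fun Φ y => by
        refine (mul_le_mul_of_nonneg_left (norm_iteratedFDeriv_partialInt_le hm ha m.2 Φ y)
          (by positivity)).trans ?_
        rw [← integral_const_mul, mul_right_comm, ← integral_const_mul]
        refine integral_mono ((integrable_norm_iteratedFDeriv hm ha Φ m.2 y).const_mul _)
          (ha.const_mul _) fun h => ?_
        have := norm_kernel_smul_le ℂ a Φ m.1 q m.2 y h
        rw [mul_left_comm] at this
        exact this⟩)

end PartialIntegral

/-! ### The operators `D*` and `C*` with values in two-point distributions -/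

section TwoPoint

variable {F : Type} [NormedAddCommGroup F] [InnerProductSpace ℂ F] [CompleteSpace F]

/-- The `j`-th component of `α` as a function of `h = y - x`. -/
def kern (s : ℝ) (j : Fin 3) (h : E3) : ℝ := alpha s 0 h j

theorem alpha_eq_kern (s : ℝ) (x y : E3) (j : Fin 3) : alpha s x y j = kern s j (y - x) := by
  simp [kern, alpha]

theorem kern_eq (s : ℝ) (j : Fin 3) (h : E3) :
    kern s j h = Real.sqrt (fracConst s) / Real.sqrt 2 / ‖h‖ ^ (3 / 2 + s + 1) * h j := by
  simp [kern, alpha]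

theorem measurable_kern (s : ℝ) (j : Fin 3) : Measurable (kern s j) := by
  have : kern s j = fun h => Real.sqrt (fracConst s) / Real.sqrt 2 / ‖h‖ ^ (3 / 2 + s + 1) * h j :=
    funext (kern_eq s j)
  rw [this]
  fun_prop

theorem norm_kern_le (s : ℝ) (j : Fin 3) (h : E3) :
    ‖kern s j h‖ ≤ Real.sqrt (fracConst s) / Real.sqrt 2 * ‖h‖ ^ (-(3 / 2 + s)) := by
  rcases eq_or_ne h 0 with rfl | hh
  · simp [kern_eq]
    positivity
  have h0 : 0 < ‖h‖ := norm_pos_iff.mpr hh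
  have hj : ‖h j‖ ≤ ‖h‖ := PiLp.norm_apply_le h j
  rw [kern_eq, norm_mul, Real.norm_of_nonneg (by positivity), div_mul_eq_mul_div, div_eq_mul_inv,
    ← Real.rpow_neg h0.le, mul_assoc]
  gcongr
  calc ‖h j‖ * ‖h‖ ^ (-(3 / 2 + s + 1)) ≤ ‖h‖ * ‖h‖ ^ (-(3 / 2 + s + 1)) := by gcongr
    _ = ‖h‖ ^ (-(3 / 2 + s)) := by
      rw [mul_comm, ← Real.rpow_add_one h0.ne']
      congr 1
      ring

theorem kern_decay (s : ℝ) (j : Fin 3) (h : E3) : ‖kern s j h‖ * ((1 + ‖h‖) ^ 4)⁻¹ ≤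
    Real.sqrt (fracConst s) / Real.sqrt 2 * decay (3 / 2 + s) 4 h := by
  rw [decay, ← mul_assoc, Real.rpow_neg (by positivity : 0 ≤ 1 + ‖h‖)]
  have : (1 + ‖h‖) ^ (4 : ℝ) = (1 + ‖h‖) ^ 4 := by norm_cast
  rw [this]
  gcongr
  exact norm_kern_le s j h

/-- `kern` is of size `‖h‖^{-(3/2+s)}` and `3/2 + s < 3`. So `α` alone is integrable against
two-point test functions, without help from the difference of `w`. -/
theorem integrable_kern {s : ℝ} (hs : 0 < s) (hs1 : s < 1) (j : Fin 3) :
    Integrable fun h => ‖kern s j h‖ * ((1 + ‖h‖) ^ 4)⁻¹ := by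
  refine ((integrable_decay (p := 3 / 2 + s) (q := 4) (by norm_num) (by linarith)
    (by linarith)).const_mul (Real.sqrt (fracConst s) / Real.sqrt 2)).mono' ?_
    (Eventually.of_forall fun h => ?_)
  · have := measurable_kern s j
    fun_prop
  · rw [Real.norm_of_nonneg (by positivity)]
    exact kern_decay s j h

/-- `(y, h) ↦ (y, y + h)`. -/
def shearRight : (E3 × E3) ≃L[ℝ] E3 × E3 :=
  ContinuousLinearEquiv.equivOfInverse
    ((ContinuousLinearMap.fst ℝ E3 E3).prod
      (ContinuousLinearMap.fst ℝ E3 E3 + ContinuousLinearMap.snd ℝ E3 E3))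
    ((ContinuousLinearMap.fst ℝ E3 E3).prod
      (ContinuousLinearMap.snd ℝ E3 E3 - ContinuousLinearMap.fst ℝ E3 E3))
    (fun p => by simp) (fun p => by simp)

/-- `(y, h) ↦ (y - h, y)`. -/
def shearLeft : (E3 × E3) ≃L[ℝ] E3 × E3 :=
  ContinuousLinearEquiv.equivOfInverse
    ((ContinuousLinearMap.fst ℝ E3 E3 - ContinuousLinearMap.snd ℝ E3 E3).prod
      (ContinuousLinearMap.fst ℝ E3 E3))
    ((ContinuousLinearMap.snd ℝ E3 E3).prod
      (ContinuousLinearMap.snd ℝ E3 E3 - ContinuousLinearMap.fst ℝ E3 E3))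
    (fun p => by simp) (fun p => by simp)

/-- The two marginals `∫ αⱼ(x,y) Φ(x,y) dx` and `∫ αⱼ(x,y) Φ(x,y) dy`, subtracted. -/
def marginal {s : ℝ} (hs : 0 < s) (hs1 : s < 1) (j : Fin 3) : 𝓢(E3 × E3, ℂ) →L[ℂ] 𝓢(E3, ℂ) :=
  (partialIntCLM (measurable_kern s j) (integrable_kern hs hs1 j)).comp
    (SchwartzMap.compCLMOfContinuousLinearEquiv ℂ shearLeft -
      SchwartzMap.compCLMOfContinuousLinearEquiv ℂ shearRight)

theorem marginal_apply {s : ℝ} (hs : 0 < s) (hs1 : s < 1) (j : Fin 3) (Φ : 𝓢(E3 × E3, ℂ))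
    (y : E3) :
    marginal hs hs1 j Φ y = ∫ h, kern s j h • (Φ (y - h, y) - Φ (y, y + h)) := rfl

theorem integrable_kern_shearLeft {s : ℝ} (hs : 0 < s) (hs1 : s < 1) (j : Fin 3)
    (Φ : 𝓢(E3 × E3, ℂ)) (y : E3) : Integrable fun h => kern s j h • Φ (y - h, y) :=
  integrable_partialInt (measurable_kern s j) (integrable_kern hs hs1 j)
    (SchwartzMap.compCLMOfContinuousLinearEquiv ℂ shearLeft Φ) y

theorem integrable_kern_shearRight {s : ℝ} (hs : 0 < s) (hs1 : s < 1) (j : Fin 3)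
    (Φ : 𝓢(E3 × E3, ℂ)) (y : E3) : Integrable fun h => kern s j h • Φ (y, y + h) :=
  integrable_partialInt (measurable_kern s j) (integrable_kern hs hs1 j)
    (SchwartzMap.compCLMOfContinuousLinearEquiv ℂ shearRight Φ) y

theorem schwartz_pair_decay (Φ : 𝓢(E3 × E3, ℂ)) : ∃ C, 0 ≤ C ∧ ∀ x z,
    ‖Φ (x, x + z)‖ ≤ C * ((1 + ‖x‖) ^ (-4 : ℝ) * (1 + ‖z‖) ^ (-4 : ℝ)) := by
  obtain ⟨C, hC, h⟩ := schwartz_decay (SchwartzMap.compCLMOfContinuousLinearEquiv ℂ shearRight Φ) 8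
  refine ⟨C, hC, fun x z => (h (x, z)).trans ?_⟩
  have h1 : ‖x‖ ≤ ‖(x, z)‖ := norm_fst_le (x, z)
  have h2 : ‖z‖ ≤ ‖(x, z)‖ := norm_snd_le (x, z)
  rw [show (-8 : ℝ) = -4 + -4 by norm_num, Real.rpow_add (by positivity)]
  gcongr C * (?_ * ?_)
  · exact Real.rpow_le_rpow_of_nonpos (by positivity) (by linarith) (by norm_num)
  · exact Real.rpow_le_rpow_of_nonpos (by positivity) (by linarith) (by norm_num)

theorem integrable_kern_pair {s : ℝ} (hs : 0 < s) (hs1 : s < 1) (j : Fin 3) (Φ : 𝓢(E3 × E3, ℂ))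
    {g : E3 × E3 → F} (hg : Continuous g) {M : ℝ} (hM : ∀ p, ‖g p‖ ≤ M) :
    Integrable fun p : E3 × E3 => (kern s j (p.2 - p.1) • Φ p) • g p := by
  obtain ⟨C, hC, h⟩ := schwartz_pair_decay Φ
  have hM0 : 0 ≤ M := (norm_nonneg _).trans (hM 0)
  refine integrable_of_shear ?_
    (A := fun x => M * C * (Real.sqrt (fracConst s) / Real.sqrt 2) * (1 + ‖x‖) ^ (-4 : ℝ))
    (B := decay (3 / 2 + s) 4) ?_ (integrable_decay (by norm_num) (by linarith) (by linarith)) ?_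
  · have h1 : Measurable fun p : E3 × E3 => kern s j (p.2 - p.1) :=
      (measurable_kern s j).comp (measurable_snd.sub measurable_fst)
    exact (h1.aestronglyMeasurable.smul Φ.continuous.aestronglyMeasurable).smul
      hg.aestronglyMeasurable
  · exact (integrable_one_add_norm (by simp; norm_num)).const_mul _
  · intro x z
    rw [norm_smul, norm_smul, add_sub_cancel_left]
    calc ‖kern s j z‖ * ‖Φ (x, x + z)‖ * ‖g (x, x + z)‖
        ≤ (Real.sqrt (fracConst s) / Real.sqrt 2 * ‖z‖ ^ (-(3 / 2 + s))) *
          (C * ((1 + ‖x‖) ^ (-4 : ℝ) * (1 + ‖z‖) ^ (-4 : ℝ))) * M := by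
          gcongr
          · exact norm_kern_le s j z
          · exact h x z
          · exact hM _
      _ = _ := by rw [decay]; ring

/-- `marginal` is the transpose of `w ↦ αⱼ(x,y) (w(y) - w(x))`. The terms with `w(y)` and `w(x)` are
separately integrable, so Fubini applies to each: the first is integrated over `x`, the second over
`y`. As `marginal` maps into Schwartz functions, the operator extends by duality to every `H^t`. -/
theorem integral_marginal {s : ℝ} (hs : 0 < s) (hs1 : s < 1) (j : Fin 3) (Φ : 𝓢(E3 × E3, ℂ))
    (w : 𝓢(E3, F)) :
    Integrable (fun p : E3 × E3 => (kern s j (p.2 - p.1) • Φ p) • (w p.2 - w p.1)) ∧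
      ∫ y, marginal hs hs1 j Φ y • w y =
        ∫ p : E3 × E3, (kern s j (p.2 - p.1) • Φ p) • (w p.2 - w p.1) := by
  have hw : ∀ x, ‖w x‖ ≤ SchwartzMap.seminorm ℝ 0 0 w := SchwartzMap.norm_le_seminorm ℝ w
  have i1 := integrable_kern_pair hs hs1 j Φ (w.continuous.comp continuous_snd) fun p => hw p.2
  have i2 := integrable_kern_pair hs hs1 j Φ (w.continuous.comp continuous_fst) fun p => hw p.1
  simp only [Function.comp_apply] at i1 i2
  simp only [smul_sub]
  refine ⟨i1.sub i2, ?_⟩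
  have e1 : ∀ y, ∫ x, (kern s j (y - x) • Φ (x, y)) • w y =
      (∫ h, kern s j h • Φ (y - h, y)) • w y := by
    intro y
    rw [integral_smul_const, ← integral_sub_left_eq_self _ volume y]
    simp only [sub_sub_cancel]
  have e2 : ∀ x, ∫ y, (kern s j (y - x) • Φ (x, y)) • w x =
      (∫ h, kern s j h • Φ (x, x + h)) • w x := by
    intro x
    rw [integral_smul_const, ← integral_add_left_eq_self _ x]
    simp only [add_sub_cancel_left]
  have j1 := i1.integral_prod_right
  have j2 := i2.integral_prod_left
  simp only [e1, e2] at j1 j2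
  rw [integral_sub i1 i2, Measure.volume_eq_prod, integral_prod_symm _ i1, integral_prod _ i2]
  simp only [e1, e2]
  rw [← integral_sub j1 j2]
  refine integral_congr_ae (Eventually.of_forall fun y => ?_)
  simp only [marginal_apply, ← sub_smul]
  rw [← integral_sub (integrable_kern_shearLeft hs hs1 j Φ y)
    (integrable_kern_shearRight hs hs1 j Φ y)]
  simp only [smul_sub]

variable (F) in
/-- The inclusion of `H^t` in the tempered distributions. -/
def distCLM (t : ℝ) : Sob F t →L[ℂ] 𝓢'(E3, F) :=
  ((besselPotential E3 F (-t)).comp (Lp.toTemperedDistributionCLM F volume 2)).comp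
    (sobEquiv F t).toLinearIsometry.toContinuousLinearMap

theorem distCLM_apply {t : ℝ} (u : Sob F t) : distCLM F t u = u.dist := by
  have h : u.dist = besselPotential E3 F (-t) (besselPotential E3 F t u.dist) := by simp
  rw [h, u.toL2_spec]
  rfl

/-- The extension of `w ↦ ∑ⱼ αⱼ(x,y) Bⱼ (w(y) - w(x))` to `H^t`. -/
def starDist (B : Fin 3 → F →L[ℂ] V3) {s : ℝ} (hs : 0 < s) (hs1 : s < 1) (t : ℝ) :
    Sob F t →L[ℂ] 𝓢'(E3 × E3, V3) :=
  ∑ j : Fin 3, ((PointwiseConvergenceCLM.postcomp 𝓢(E3 × E3, ℂ) (B j)).comp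
    (PointwiseConvergenceCLM.precomp F (marginal hs hs1 j))).comp (distCLM F t)

theorem starDist_apply (B : Fin 3 → F →L[ℂ] V3) {s : ℝ} (hs : 0 < s) (hs1 : s < 1) {t : ℝ}
    (u : Sob F t) (Φ : 𝓢(E3 × E3, ℂ)) :
    starDist B hs hs1 t u Φ = ∑ j : Fin 3, B j (u.dist (marginal hs hs1 j Φ)) := by
  simp only [← distCLM_apply, starDist, sum_apply]
  rfl

theorem extendsTwo_starDist (B : Fin 3 → F →L[ℂ] V3) {s : ℝ} (hs : 0 < s) (hs1 : s < 1) (t : ℝ) :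
    ExtendsTwo (starB B s) (starDist B hs hs1 t) := by
  intro w _ Φ
  have h := fun j => integral_marginal hs hs1 j Φ w
  have i : ∀ j : Fin 3, Integrable fun p : E3 × E3 =>
      B j ((kern s j (p.2 - p.1) • Φ p) • (w p.2 - w p.1)) := fun j =>
    (B j).integrable_comp (h j).1
  have e : (fun p : E3 × E3 => Φ p • starB B s w p.1 p.2) = fun p =>
      ∑ j : Fin 3, B j ((kern s j (p.2 - p.1) • Φ p) • (w p.2 - w p.1)) := by
    ext p : 1
    simp only [starB, Finset.smul_sum, map_smul, alpha_eq_kern, smul_smul, Complex.real_smul,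
      mul_comm]
  rw [e]
  refine ⟨integrable_finsetSum Finset.univ fun j _ => i j, ?_⟩
  rw [integral_finsetSum _ fun j _ => i j, starDist_apply]
  refine Finset.sum_congr rfl fun j _ => ?_
  rw [(B j).integral_comp_comm (h j).1, ← (h j).2]
  exact congrArg (B j) (isFun_schwartz w _).2

theorem ExtendsTwo.unique {t : ℝ} {P : (E3 → F) → E3 → E3 → V3}
    {S T : Sob F t →L[ℂ] 𝓢'(E3 × E3, V3)} (hS : ExtendsTwo P S) (hT : ExtendsTwo P T) : S = T :=
  sob_clm_ext fun w hw => (hS w hw).eq_of_ae (hT w hw) (ae_eq_refl _)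

theorem DStar_eq {s : ℝ} (hs : 0 < s) (hs1 : s < 1) (t : ℝ) :
    DStar s t = starDist (fun j => -embedCLM j) hs hs1 t := by
  have h := extendsTwo_starDist (fun j => -embedCLM j) hs hs1 t
  rw [← dStar_eq_starB] at h
  exact ExtendsTwo.unique (Classical.epsilon_spec ⟨_, h⟩) h

theorem CStar_eq {s : ℝ} (hs : 0 < s) (hs1 : s < 1) (t : ℝ) :
    CStar s t = starDist crossCLM hs hs1 t := by
  have h := extendsTwo_starDist crossCLM hs hs1 t
  rw [← cStar_eq_starB] at h
  exact ExtendsTwo.unique (Classical.epsilon_spec ⟨_, h⟩) h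

theorem extendsTwo_dStar_iff {s : ℝ} (hs : 0 < s) (hs1 : s < 1) (t : ℝ)
    (T : Sob ℂ t →L[ℂ] 𝓢'(E3 × E3, V3)) : ExtendsTwo (dStar s) T ↔ T = DStar s t := by
  have h := extendsTwo_starDist (fun j => -embedCLM j) hs hs1 t
  rw [← dStar_eq_starB] at h
  rw [DStar_eq hs hs1]
  exact ⟨fun hT => hT.unique h, fun hT => hT ▸ h⟩

theorem extendsTwo_cStar_iff {s : ℝ} (hs : 0 < s) (hs1 : s < 1) (t : ℝ)
    (T : Sob V3 t →L[ℂ] 𝓢'(E3 × E3, V3)) : ExtendsTwo (cStar s) T ↔ T = CStar s t := by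
  have h := extendsTwo_starDist crossCLM hs hs1 t
  rw [← cStar_eq_starB] at h
  rw [CStar_eq hs hs1]
  exact ⟨fun hT => hT.unique h, fun hT => hT ▸ h⟩

end TwoPoint

/-! ### The two-point field determines its potentials -/

section Injectivity

variable {F : Type} [NormedAddCommGroup F] [InnerProductSpace ℂ F] [CompleteSpace F]

/-- The plane wave `e^{2πi h·ξ}`. -/
def planeWave (h ξ : E3) : ℂ := Complex.exp ((2 * Real.pi * inner ℝ h ξ : ℝ) * Complex.I)

theorem norm_planeWave (h ξ : E3) : ‖planeWave h ξ‖ = 1 := Complex.norm_exp_ofReal_mul_I _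

theorem planeWave_add (x h ξ : E3) : planeWave (x + h) ξ = planeWave h ξ * planeWave x ξ := by
  rw [planeWave, planeWave, planeWave, ← Complex.exp_add, inner_add_left]
  congr 1
  push_cast
  ring

theorem continuous_planeWave : Continuous fun p : E3 × E3 => planeWave p.1 p.2 := by
  unfold planeWave
  fun_prop

theorem continuous_planeWave_left (ξ : E3) : Continuous fun h => planeWave h ξ :=
  continuous_planeWave.comp (by fun_prop : Continuous fun h : E3 => (h, ξ))

theorem continuous_planeWave_right (h : E3) : Continuous fun ξ => planeWave h ξ :=
  continuous_planeWave.comp (by fun_prop : Continuous fun ξ : E3 => (h, ξ))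

theorem norm_planeWave_sub_one_le (h ξ : E3) : ‖planeWave h ξ - 1‖ ≤ 2 := by
  refine (norm_sub_le _ _).trans ?_
  rw [norm_planeWave, norm_one]
  norm_num

theorem fourierInv_schwartz_apply (ρ : 𝓢(E3, ℂ)) (ξ : E3) :
    (𝓕⁻ ρ) ξ = ∫ y, planeWave y ξ * ρ y := by
  rw [SchwartzMap.fourierInv_coe, Real.fourierInv_eq']
  rfl

theorem integral_planeWave_shift (ρ : 𝓢(E3, ℂ)) (h ξ : E3) :
    ∫ y, planeWave y ξ * ρ (y - h) = planeWave h ξ * (𝓕⁻ ρ) ξ := by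
  rw [fourierInv_schwartz_apply, ← integral_const_mul, ← integral_add_right_eq_self _ h]
  simp only [planeWave_add, add_sub_cancel_right, mul_assoc]

theorem integrable_planeWave_mul {f : E3 → ℂ} (hf : Integrable f) (ξ : E3) :
    Integrable fun y => planeWave y ξ * f y :=
  hf.bdd_mul (c := 1) (continuous_planeWave_left ξ).aestronglyMeasurable
    (Eventually.of_forall fun y => (norm_planeWave y ξ).le)

/-- The Fourier transform of an average of differences. -/
theorem fourierInv_average {b : E3 → ℝ} (hb : Integrable b) {ρ ψ : 𝓢(E3, ℂ)}
    (hψ : ∀ y, ψ y = ∫ h, b h • (ρ (y - h) - ρ y)) (ξ : E3) :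
    (𝓕⁻ ψ) ξ = ∫ h, b h • ((planeWave h ξ - 1) * (𝓕⁻ ρ) ξ) := by
  have i1 : Integrable fun p : E3 × E3 => b p.1 • (planeWave p.2 ξ * ρ (p.2 - p.1)) := by
    refine integrable_of_shear (A := fun h => ‖b h‖) (B := fun z => ‖ρ z‖) ?_ hb.norm
      ρ.integrable.norm fun h z => ?_
    · have h1 : Continuous fun p : E3 × E3 => planeWave p.2 ξ * ρ (p.2 - p.1) :=
        ((continuous_planeWave_left ξ).comp continuous_snd).mul
          (ρ.continuous.comp (by fun_prop))
      exact hb.1.comp_fst.smul h1.aestronglyMeasurable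
    · simp only [norm_smul, norm_mul, norm_planeWave, one_mul, add_sub_cancel_left, le_refl]
  have i2 : Integrable fun p : E3 × E3 => b p.1 • (planeWave p.2 ξ * ρ p.2) :=
    hb.smul_prod (integrable_planeWave_mul ρ.integrable ξ)
  have i3 : Integrable fun p : E3 × E3 =>
      b p.1 • (planeWave p.2 ξ * (ρ (p.2 - p.1) - ρ p.2)) := by
    refine (i1.sub i2).congr (Eventually.of_forall fun p => ?_)
    simp only [Pi.sub_apply, mul_sub, smul_sub]
  rw [fourierInv_schwartz_apply]
  have e1 : ∀ y, planeWave y ξ * ψ y = ∫ h, b h • (planeWave y ξ * (ρ (y - h) - ρ y)) := by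
    intro y
    rw [hψ, ← integral_const_mul]
    simp only [mul_smul_comm]
  simp only [e1]
  rw [← integral_integral_swap i3]
  refine integral_congr_ae (Eventually.of_forall fun h => ?_)
  simp only [mul_sub]
  rw [integral_smul, integral_sub (integrable_planeWave_mul (ρ.integrable.comp_sub_right h) ξ)
    (integrable_planeWave_mul ρ.integrable ξ), integral_planeWave_shift,
    ← fourierInv_schwartz_apply, sub_mul, one_mul]

/-- The pairing of `u` with `ρ(· - h) - ρ`. -/
def diffPairing {t : ℝ} (u : Sob F t) (ρ : 𝓢(E3, ℂ)) (h : E3) : F :=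
  ∫ ξ, (planeWave h ξ - 1) • (𝓕⁻ ρ) ξ • u.hat ξ

/-- Continuity upgrades identities valid for almost every `h` to all `h`, which allows evaluation at
the basis vectors. -/
theorem continuous_diffPairing {t : ℝ} (u : Sob F t) (ρ : 𝓢(E3, ℂ)) :
    Continuous (diffPairing u ρ) := by
  have hi := (u.isFun_hat (𝓕⁻ ρ)).1
  refine continuous_of_dominated (bound := fun ξ => 2 * ‖(𝓕⁻ ρ) ξ • u.hat ξ‖) (fun h => ?_)
    (fun h => Eventually.of_forall fun ξ => ?_) (hi.norm.const_mul 2)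
    (Eventually.of_forall fun ξ => ?_)
  · exact ((continuous_planeWave_right h).sub continuous_const).aestronglyMeasurable.smul hi.1
  · rw [norm_smul]
    gcongr
    exact norm_planeWave_sub_one_le h ξ
  · exact ((continuous_planeWave_left ξ).sub continuous_const).smul continuous_const

/-- The pairing with `u` passes through the average over `h` by Fubini on the Fourier side, where
`û` times the transform of `ρ` is integrable and the plane-wave factor is bounded by 2. -/
theorem dist_average {t : ℝ} (u : Sob F t) {b : E3 → ℝ} (hb : Integrable b) {ρ ψ : 𝓢(E3, ℂ)}
    (hψ : ∀ y, ψ y = ∫ h, b h • (ρ (y - h) - ρ y)) :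
    u.dist ψ = ∫ h, b h • diffPairing u ρ h := by
  have hi := (u.isFun_hat (𝓕⁻ ρ)).1
  rw [isFun_dist_apply u.isFun_hat]
  have i : Integrable fun p : E3 × E3 =>
      b p.1 • (planeWave p.1 p.2 - 1) • (𝓕⁻ ρ) p.2 • u.hat p.2 := by
    have i0 : Integrable fun p : E3 × E3 => b p.1 • (𝓕⁻ ρ) p.2 • u.hat p.2 := hb.smul_prod hi
    have hp : AEStronglyMeasurable (fun p : E3 × E3 => planeWave p.1 p.2 - 1) volume :=
      (continuous_planeWave.sub continuous_const).aestronglyMeasurable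
    refine (i0.bdd_smul 2 hp (Eventually.of_forall fun p =>
      norm_planeWave_sub_one_le p.1 p.2)).congr (Eventually.of_forall fun p => ?_)
    exact smul_comm (planeWave p.1 p.2 - 1) (b p.1) _
  have e : ∀ ξ, (𝓕⁻ ψ) ξ • u.hat ξ = ∫ h, b h • (planeWave h ξ - 1) • (𝓕⁻ ρ) ξ • u.hat ξ := by
    intro ξ
    rw [fourierInv_average hb hψ, ← integral_smul_const]
    simp only [smul_assoc, mul_smul]
  simp only [e]
  rw [← integral_integral_swap i]
  simp only [integral_smul, diffPairing]

/-- The test function `κ(y - x) ρ(x)`. -/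
def tensorTest {κ : E3 → ℝ} (hκ : ContDiff ℝ (⊤ : ℕ∞) κ) (hκc : HasCompactSupport κ) {ρ : 𝓢(E3, ℂ)}
    (hρ : HasCompactSupport ρ) : 𝓢(E3 × E3, ℂ) :=
  have h1 : HasCompactSupport fun p : E3 × E3 => κ p.2 • ρ p.1 :=
    HasCompactSupport.intro (hρ.isCompact.prod hκc.isCompact) fun p hp => by
      rw [Set.mem_prod, not_and_or] at hp
      rcases hp with hp | hp
      · rw [image_eq_zero_of_notMem_tsupport hp, smul_zero]
      · rw [image_eq_zero_of_notMem_tsupport hp, zero_smul]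
  have h2 : ContDiff ℝ (⊤ : ℕ∞) fun p : E3 × E3 => κ p.2 • ρ p.1 :=
    (hκ.comp contDiff_snd).smul ((ρ.smooth ⊤).comp contDiff_fst)
  SchwartzMap.compCLMOfContinuousLinearEquiv ℂ shearRight.symm (h1.toSchwartzMap h2)

theorem tensorTest_apply {κ : E3 → ℝ} (hκ : ContDiff ℝ (⊤ : ℕ∞) κ) (hκc : HasCompactSupport κ)
    {ρ : 𝓢(E3, ℂ)} (hρ : HasCompactSupport ρ) (x y : E3) :
    tensorTest hκ hκc hρ (x, y) = κ (y - x) • ρ x := rfl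

theorem integrable_kern_smul {s : ℝ} (hs : 0 < s) (hs1 : s < 1) (j : Fin 3) :
    Integrable fun h => kern s j h * ((1 + ‖h‖) ^ 4)⁻¹ := by
  rw [← integrable_norm_iff]
  · refine (integrable_kern hs hs1 j).congr (Eventually.of_forall fun h => ?_)
    simp only [norm_mul]
    rw [Real.norm_of_nonneg (by positivity : 0 ≤ ((1 + ‖h‖) ^ 4)⁻¹)]
  · have := measurable_kern s j
    fun_prop

theorem locallyIntegrable_kern {s : ℝ} (hs : 0 < s) (hs1 : s < 1) (j : Fin 3) :
    LocallyIntegrable (kern s j) (volume : Measure E3) := by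
  have h1 := (integrable_kern_smul hs hs1 j).locallyIntegrable.smul_continuous
    (g := fun h : E3 => (1 + ‖h‖) ^ 4) (by fun_prop)
  refine h1.congr (Eventually.of_forall fun h => ?_)
  simp only [smul_eq_mul]
  rw [mul_assoc, inv_mul_cancel₀ (by positivity), mul_one]

/-- For a test function `κ(y-x) ρ(x)` the marginal is an average over `h` of the differences `ρ(· -
h) - ρ` with the integrable weight `κ(h) kern(h)`, so that `κ` probes each shift separately. -/
theorem dist_marginal_tensorTest {s : ℝ} (hs : 0 < s) (hs1 : s < 1) (j : Fin 3) {t : ℝ}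
    (u : Sob F t) {κ : E3 → ℝ} (hκ : ContDiff ℝ (⊤ : ℕ∞) κ) (hκc : HasCompactSupport κ) {ρ : 𝓢(E3, ℂ)}
    (hρ : HasCompactSupport ρ) :
    u.dist (marginal hs hs1 j (tensorTest hκ hκc hρ)) =
      ∫ h, κ h • kern s j h • diffPairing u ρ h := by
  have hb : Integrable fun h => κ h • kern s j h :=
    (locallyIntegrable_kern hs hs1 j).integrable_smul_left_of_hasCompactSupport hκ.continuous hκc
  rw [dist_average u hb (ρ := ρ)]
  · simp only [smul_assoc]
  · intro y
    rw [marginal_apply]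
    refine integral_congr_ae (Eventually.of_forall fun h => ?_)
    simp only [tensorTest_apply, sub_sub_cancel, add_sub_cancel_left]
    rw [← smul_sub, smul_smul, smul_eq_mul, mul_comm]

/-- Since `κ` is arbitrary, the sum with coefficients `kern s j h` vanishes almost everywhere. The
common positive radial factor is divided out, leaving `hⱼ`, and continuity of the `G j` extends the
identity to all `h`. -/
theorem sum_coord_smul_eq_zero {s : ℝ} (hs : 0 < s) (hs1 : s < 1) {G : Fin 3 → E3 → V3}
    (hG : ∀ j, Continuous (G j))
    (h0 : ∀ κ : E3 → ℝ, ContDiff ℝ (⊤ : ℕ∞) κ → HasCompactSupport κ →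
      ∑ j : Fin 3, ∫ h, κ h • kern s j h • G j h = 0) (h : E3) :
    ∑ j : Fin 3, h j • G j h = 0 := by
  have hl : ∀ j, LocallyIntegrable (fun h => kern s j h • G j h) (volume : Measure E3) := fun j =>
    (locallyIntegrable_kern hs hs1 j).smul_continuous (hG j)
  have h1 : ∀ᵐ h : E3, ∑ j : Fin 3, kern s j h • G j h = 0 := by
    refine ae_eq_zero_of_integral_contDiff_smul_eq_zero ?_ fun κ hκ hκc => ?_
    · simp only [Fin.sum_univ_three]
      exact ((hl 0).add (hl 1)).add (hl 2)
    · rw [← h0 κ hκ hκc, ← integral_finsetSum]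
      · simp only [Finset.smul_sum]
      · exact fun j _ => (hl j).integrable_smul_left_of_hasCompactSupport hκ.continuous hκc
  have h2 : (fun h : E3 => ∑ j : Fin 3, h j • G j h) =ᵐ[volume] fun _ => 0 := by
    filter_upwards [h1, ae_ne_zero] with h hh hne
    have hC := Real.sqrt_pos.mpr (fracConst_pos hs hs1)
    have hn : 0 < ‖h‖ := norm_pos_iff.mpr hne
    have hp : 0 < Real.sqrt (fracConst s) / Real.sqrt 2 / ‖h‖ ^ (3 / 2 + s + 1) := by positivity
    simp only [kern_eq, mul_smul, ← Finset.smul_sum] at hh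
    exact (smul_eq_zero.mp hh).resolve_left hp.ne'
  have h3 := Measure.eq_of_ae_eq h2
    (continuous_finsetSum _ fun j _ =>
      Continuous.smul (by fun_prop : Continuous fun h : E3 => h j) (hG j)) continuous_const
  exact congrFun h3 h

/-- The difference quotients of the potentials, from a vanishing two-point field. -/
theorem apply_diffPairing_basisE {F' : Type} [NormedAddCommGroup F'] [InnerProductSpace ℂ F']
    [CompleteSpace F'] {B : Fin 3 → F →L[ℂ] V3} {B' : Fin 3 → F' →L[ℂ] V3} {s : ℝ} (hs : 0 < s)
    (hs1 : s < 1) {t : ℝ} {u : Sob F t} {u' : Sob F' t}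
    (h0 : starDist B hs hs1 t u + starDist B' hs hs1 t u' = 0) {ρ : 𝓢(E3, ℂ)}
    (hρ : HasCompactSupport ρ) (k : Fin 3) :
    B k (diffPairing u ρ (basisE k)) + B' k (diffPairing u' ρ (basisE k)) = 0 := by
  have hc := continuous_diffPairing u ρ
  have hc' := continuous_diffPairing u' ρ
  have h1 := sum_coord_smul_eq_zero hs hs1
    (G := fun j h => B j (diffPairing u ρ h) + B' j (diffPairing u' ρ h))
    (fun j => ((B j).continuous.comp hc).add ((B' j).continuous.comp hc')) ?_ (basisE k)
  · fin_cases k <;> simpa [basisE, Fin.sum_univ_three] using h1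
  · intro κ hκ hκc
    have h2 := DFunLike.congr_fun h0 (tensorTest hκ hκc hρ)
    rw [add_apply, starDist_apply, starDist_apply, ← Finset.sum_add_distrib] at h2
    refine Eq.trans ?_ h2
    refine Finset.sum_congr rfl fun j _ => ?_
    have i := ((locallyIntegrable_kern hs hs1 j).smul_continuous
      hc).integrable_smul_left_of_hasCompactSupport hκ.continuous hκc
    have i' := ((locallyIntegrable_kern hs hs1 j).smul_continuous
      hc').integrable_smul_left_of_hasCompactSupport hκ.continuous hκc
    rw [dist_marginal_tensorTest, dist_marginal_tensorTest, ← (B j).integral_comp_comm i,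
      ← (B' j).integral_comp_comm i', ← integral_add ((B j).integrable_comp i)
      ((B' j).integrable_comp i')]
    simp only [smul_add, ContinuousLinearMap.map_smul_of_tower]

/-- If `L (u(· + h) - u) = 0`, then `(e^{2πi h·ξ} - 1) L û = 0`. -/
theorem ae_eq_zero_of_diffPairing {t : ℝ} (u : Sob F t) (L : F →L[ℂ] V3) (h : E3)
    (h0 : ∀ ρ : 𝓢(E3, ℂ), HasCompactSupport ρ → L (diffPairing u ρ h) = 0) :
    ∀ᵐ ξ, (planeWave h ξ - 1) • L (u.hat ξ) = 0 := by
  have hm : MemLp (fun ξ => (planeWave h ξ - 1) • L) ∞ (volume : Measure E3) := by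
    refine memLp_top_of_bound (C := 2 * ‖L‖) ?_ (Eventually.of_forall fun ξ => ?_)
    · exact (((continuous_planeWave_right h).sub continuous_const).smul
        continuous_const).aestronglyMeasurable
    · rw [norm_smul]
      gcongr
      exact norm_planeWave_sub_one_le h ξ
  -- The multiplier is bounded, so the product is again the transform of an element of `H^t`. This
  -- element annihilates all compactly supported test functions, which are dense, and is therefore
  -- 0.
  set v : Sob V3 t := (fourierSob V3 t).symm (opMul hm (fourierSob F t u)) with hv
  have hv1 : v.hat =ᵐ[volume] fun ξ => (planeWave h ξ - 1) • L (u.hat ξ) := by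
    have e : (𝓕 v.toL2 : Lp V3 2 (volume : Measure E3)) = opMul hm (𝓕 u.toL2) :=
      (fourierSob V3 t).apply_symm_apply _
    filter_upwards [coeFn_opMul hm (𝓕 u.toL2)] with ξ hξ
    simp only [Sob.hat]
    rw [e, hξ, smul_apply, map_smul, smul_comm]
  have hv2 : ∀ ρ : 𝓢(E3, ℂ), HasCompactSupport ρ → v.dist ρ = 0 := by
    intro ρ hρ
    rw [isFun_dist_apply v.isFun_hat, ← h0 ρ hρ, diffPairing, ← L.integral_comp_comm]
    · refine integral_congr_ae ?_
      filter_upwards [hv1] with ξ hξ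
      rw [hξ, map_smul, map_smul, smul_comm]
    · exact (u.isFun_hat (𝓕⁻ ρ)).1.bdd_smul (𝕜 := ℂ) 2
        ((continuous_planeWave_right h).sub continuous_const).aestronglyMeasurable
        (Eventually.of_forall fun ξ => norm_planeWave_sub_one_le h ξ)
  have hv3 : v = 0 := by
    refine Sob.dist_injective ?_
    rw [map_zero]
    have : (v.dist : 𝓢(E3, ℂ) → V3) = fun _ => 0 :=
      Continuous.ext_on (dense_hasCompactSupport (E := E3) (F := ℂ)) v.dist.continuous
        continuous_const fun ρ hρ => hv2 ρ hρ
    ext ρ : 1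
    exact congrFun this ρ
  rw [hv3] at hv1
  filter_upwards [hv1, Sob.hat_zero (F := V3) (r := t)] with ξ h1 h2
  rw [← h1, h2]

end Injectivity

/-! ### The operator `Π` on fields with a fractional Helmholtz decomposition -/

section Helmholtz

variable {F : Type} [NormedAddCommGroup F] [InnerProductSpace ℂ F] [CompleteSpace F]

theorem ae_coord_ne (k : Fin 3) (c : ℝ) : ∀ᵐ ξ : E3, ξ k ≠ c :=
  (PiLp.volume_preserving_ofLp (Fin 3)).quasiMeasurePreserving.ae
    (Measure.ae_eval_ne (μ := fun _ : Fin 3 => (volume : Measure ℝ)) k c)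

/-- The zeros lie on the countably many hyperplanes `ξ k = n`, `n ∈ ℤ`, each of measure zero. -/
theorem ae_planeWave_sub_one_ne_zero (k : Fin 3) : ∀ᵐ ξ, planeWave (basisE k) ξ - 1 ≠ 0 := by
  have h : ∀ᵐ ξ : E3, ∀ n : ℤ, ξ k ≠ n := ae_all_iff.mpr fun n => ae_coord_ne k n
  filter_upwards [h] with ξ hξ h0
  rw [sub_eq_zero, planeWave, real_inner_comm, inner_basisE, Complex.exp_eq_one_iff] at h0
  obtain ⟨n, hn⟩ := h0
  refine hξ n ?_
  have hpi : (2 * Real.pi * Complex.I : ℂ) ≠ 0 := by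
    simp [Real.pi_ne_zero]
  have : ((ξ k : ℝ) : ℂ) = ((n : ℝ) : ℂ) := by
    refine mul_right_cancel₀ hpi ?_
    push_cast at hn ⊢
    linear_combination hn
  exact_mod_cast this

/-- The first term is parallel to `e_k` and the second orthogonal to it, so the `k`-th component
isolates `a`. -/
theorem eq_zero_of_embed_add_cross {k : Fin 3} {a : ℂ} {b : V3}
    (h : (-embedCLM k) a + crossCLM k b = 0) : embedCLM k a = 0 ∧ crossCLM k b = 0 := by
  have hk : a = 0 := by
    have := congrArg (fun v : V3 => v k) h
    fin_cases k <;> simpa [embedCLM, crossCLM, cross, toV3, basisE] using this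
  subst hk
  simpa using h

theorem eq_zero_of_crossCLM {b : V3} (h : ∀ k, crossCLM k b = 0) : b = 0 := by
  have h0 := h 0
  have h1 := h 1
  ext i
  have e1 := congrArg (fun v : V3 => v 1) h0
  have e2 := congrArg (fun v : V3 => v 2) h0
  have e3 := congrArg (fun v : V3 => v 2) h1
  simp [crossCLM, cross, toV3, basisE] at e1 e2 e3
  fin_cases i <;> simp [e1, e2, e3]

/-- Shifts by `e_k` separate the two potentials. For `φ` one direction suffices. For `A` a single
`k` loses the component along `e_k`, so all three are used. The divergence condition plays no role.
-/
theorem potentials_eq_zero {s : ℝ} (hs : 0 < s) (hs1 : s < 1) {t : ℝ} {φ : Sob ℂ t} {A : Sob V3 t}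
    (h : DStar s t φ + CStar s t A = 0) : φ = 0 ∧ A = 0 := by
  rw [DStar_eq hs hs1, CStar_eq hs hs1] at h
  have h1 : ∀ (k : Fin 3) (ρ : 𝓢(E3, ℂ)), HasCompactSupport ρ → _ := fun k ρ hρ =>
    eq_zero_of_embed_add_cross (apply_diffPairing_basisE hs hs1 h hρ k)
  have h2 := fun k => ae_eq_zero_of_diffPairing φ (embedCLM k) (basisE k) fun ρ hρ => (h1 k ρ hρ).1
  have h3 := fun k => ae_eq_zero_of_diffPairing A (crossCLM k) (basisE k) fun ρ hρ => (h1 k ρ hρ).2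
  constructor
  · refine Sob.ext_hat ?_
    filter_upwards [h2 0, ae_planeWave_sub_one_ne_zero 0, Sob.hat_zero (F := ℂ) (r := t)]
      with ξ e1 e2 e3
    have e4 := congrArg (fun v : V3 => v 0) ((smul_eq_zero.mp e1).resolve_left e2)
    rw [e3]
    simpa [embedCLM, toV3, basisE] using e4
  · refine Sob.ext_hat ?_
    filter_upwards [ae_all_iff.mpr h3, ae_all_iff.mpr ae_planeWave_sub_one_ne_zero,
      Sob.hat_zero (F := V3) (r := t)] with ξ e1 e2 e3
    rw [e3]
    exact eq_zero_of_crossCLM fun k => (smul_eq_zero.mp (e1 k)).resolve_left (e2 k)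

theorem IsPotential.unique {s : ℝ} (hs : 0 < s) (hs1 : s < 1) {r : ℝ} {φ φ' : Sob ℂ (r + s)}
    {A A' : Sob V3 (r + s)} {W : 𝓢'(E3 × E3, V3)} (h : IsPotential s r φ A W)
    (h' : IsPotential s r φ' A' W) : φ = φ' ∧ A = A' := by
  have e : DStar s (r + s) (φ - φ') + CStar s (r + s) (A - A') = 0 := by
    rw [map_sub, map_sub, sub_add_sub_comm, ← h.2, ← h'.2, sub_self]
  obtain ⟨h1, h2⟩ := potentials_eq_zero hs hs1 e
  exact ⟨sub_eq_zero.mp h1, sub_eq_zero.mp h2⟩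

theorem IsPotential.add {s r : ℝ} {φ φ' : Sob ℂ (r + s)} {A A' : Sob V3 (r + s)}
    {W W' : 𝓢'(E3 × E3, V3)} (h : IsPotential s r φ A W) (h' : IsPotential s r φ' A' W') :
    IsPotential s r (φ + φ') (A + A') (W + W') := by
  refine ⟨?_, ?_⟩
  · rw [map_add, divergence_add, h.1, h'.1, add_zero]
  · rw [h.2, h'.2, map_add, map_add]
    abel

theorem IsPotential.smul {s r : ℝ} {φ : Sob ℂ (r + s)} {A : Sob V3 (r + s)}
    {W : 𝓢'(E3 × E3, V3)} (c : ℂ) (h : IsPotential s r φ A W) :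
    IsPotential s r (c • φ) (c • A) (c • W) := by
  refine ⟨?_, ?_⟩
  · rw [map_smul, divergence_smul, h.1]
    ext φ
    exact smul_zero c
  · rw [h.2, map_smul, map_smul, smul_add]

theorem IsRieszPotential.add {σ : ℝ} {u u' v v' : 𝓢'(E3, F)} (h : IsRieszPotential σ u v)
    (h' : IsRieszPotential σ u' v') : IsRieszPotential σ (u + u') (v + v') := by
  obtain ⟨g, h1, h2⟩ := h
  obtain ⟨g', h1', h2'⟩ := h'
  refine ⟨fun ξ => g ξ + g' ξ, ?_, ?_⟩
  · rw [FourierTransform.fourier_add]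
    exact h1.add h1'
  · rw [FourierTransform.fourier_add]
    simpa only [smul_add] using h2.add h2'

/-- The identity `H^a → H^b` for `a = b`. -/
def sobCast {a b : ℝ} (h : a = b) : Sob F a →ₗ[ℂ] Sob F b := h ▸ LinearMap.id

theorem dist_sobCast {a b : ℝ} (h : a = b) (u : Sob F a) : (sobCast h u).dist = u.dist := by
  subst h
  rfl

theorem norm_sobCast {a b : ℝ} (h : a = b) (u : Sob F a) : ‖sobCast h u‖ = ‖u‖ := by
  subst h
  rfl

/-- The scalar potential of a field in `H^r_{fHd}`. -/
def scalarPotential {s r : ℝ} (W : fHd s r) : Sob ℂ (r + s) := W.2.choose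

/-- The vector potential of a field in `H^r_{fHd}`. -/
def vectorPotential {s r : ℝ} (W : fHd s r) : Sob V3 (r + s) := W.2.choose_spec.choose

theorem isPotential_potential {s r : ℝ} (W : fHd s r) :
    IsPotential s r (scalarPotential W) (vectorPotential W) (W : 𝓢'(E3 × E3, V3)) :=
  W.2.choose_spec.choose_spec

/-- `Π` on `H^r_{fHd}`, through the unique potentials. -/
def piHelmholtz {s : ℝ} (hs : 0 < s) (hs1 : s < 1) (r : ℝ) : fHd s r →ₗ[ℂ] Sob V3 r where
  toFun W := sobCast (add_sub_cancel_right r s)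
    (PiD s (r + s) (scalarPotential W) + PiC s (r + s) (vectorPotential W))
  map_add' W W' := by
    obtain ⟨h1, h2⟩ := IsPotential.unique hs hs1 (isPotential_potential (W + W'))
      ((isPotential_potential W).add (isPotential_potential W'))
    rw [h1, h2, ← map_add]
    congr 1
    rw [map_add, map_add]
    abel
  map_smul' c W := by
    obtain ⟨h1, h2⟩ := IsPotential.unique hs hs1 (isPotential_potential (c • W))
      ((isPotential_potential W).smul c)
    rw [h1, h2, map_smul, map_smul, ← smul_add, map_smul, RingHom.id_apply]

theorem piHelmholtz_eq {s : ℝ} (hs : 0 < s) (hs1 : s < 1) {r : ℝ} {W : fHd s r}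
    {φ : Sob ℂ (r + s)} {A : Sob V3 (r + s)} (h : IsPotential s r φ A (W : 𝓢'(E3 × E3, V3))) :
    piHelmholtz hs hs1 r W =
      sobCast (add_sub_cancel_right r s) (PiD s (r + s) φ + PiC s (r + s) A) := by
  obtain ⟨rfl, rfl⟩ := IsPotential.unique hs hs1 h (isPotential_potential W)
  rfl

theorem isRieszPotential_piD {s : ℝ} (hs : 0 < s) (hs1 : s < 1) {r : ℝ} (f : Sob ℂ r) :
    IsRieszPotential (1 - s) (-grad f.dist) (PiD s r f).dist := by
  rw [piD_eq hs hs1, grad_eq_gradB]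
  exact isRieszPotential_rieszGradB _ hs hs1.le f

theorem isRieszPotential_piC {s : ℝ} (hs : 0 < s) (hs1 : s < 1) {r : ℝ} (f : Sob V3 r) :
    IsRieszPotential (1 - s) (curl f.dist) (PiC s r f).dist := by
  rw [piC_eq hs hs1, curl_eq_gradB]
  exact isRieszPotential_rieszGradB _ hs hs1.le f

theorem piHelmholtz_spec {s : ℝ} (hs : 0 < s) (hs1 : s < 1) {r : ℝ} {W : fHd s r}
    {φ : Sob ℂ (r + s)} {A : Sob V3 (r + s)} (h : IsPotential s r φ A (W : 𝓢'(E3 × E3, V3))) :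
    (piHelmholtz hs hs1 r W).dist = (PiD s (r + s) φ).dist + (PiC s (r + s) A).dist ∧
      IsRieszPotential (1 - s) (-grad φ.dist + curl A.dist) (piHelmholtz hs hs1 r W).dist := by
  have e : (piHelmholtz hs hs1 r W).dist = (PiD s (r + s) φ).dist + (PiC s (r + s) A).dist := by
    rw [piHelmholtz_eq hs hs1 h, dist_sobCast, map_add]
  refine ⟨e, ?_⟩
  rw [e]
  exact (isRieszPotential_piD hs hs1 φ).add (isRieszPotential_piC hs hs1 A)

/-- By uniqueness of the potentials the infimum in `fHdNorm` runs over a single value, so the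
operator norms of `ΠD*` and `ΠC*` give the bound directly. -/
theorem norm_piHelmholtz_le {s : ℝ} (hs : 0 < s) (hs1 : s < 1) {r : ℝ} (W : fHd s r) :
    ‖piHelmholtz hs hs1 r W‖ ≤ (‖PiD s (r + s)‖ + ‖PiC s (r + s)‖) * fHdNorm s r W := by
  obtain ⟨φ, A, h⟩ := W.2
  have e : {ρ : ℝ | ∃ φ A, IsPotential s r φ A (W : 𝓢'(E3 × E3, V3)) ∧ ρ = ‖φ‖ + ‖A‖} =
      {‖φ‖ + ‖A‖} := by
    ext ρ
    refine ⟨?_, fun hρ => ⟨φ, A, h, hρ⟩⟩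
    rintro ⟨φ', A', h', rfl⟩
    obtain ⟨rfl, rfl⟩ := IsPotential.unique hs hs1 h h'
    rfl
  rw [fHdNorm, e, csInf_singleton, piHelmholtz_eq hs hs1 h, norm_sobCast]
  refine (norm_add_le _ _).trans ?_
  have h1 := (PiD s (r + s)).le_opNorm φ
  have h2 := (PiC s (r + s)).le_opNorm A
  have h3 := mul_nonneg (norm_nonneg (PiD s (r + s))) (norm_nonneg A)
  have h4 := mul_nonneg (norm_nonneg (PiC s (r + s))) (norm_nonneg φ)
  linarith

end Helmholtz

end FracMaxwell

end

/-! ### The main theorem -/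

theorem mainTheorem6 :
    (∀ s : ℝ, 0 < s → s < 1 →
      -- pointwise formulas on compactly supported smooth functions
      (∀ f : 𝓢(E3, ℂ), HasCompactSupport f → ∀ x : E3,
        Integrable (piIntegrand s (dStar s f) x) ∧
        Integrable (rieszIntegrand (1 - s) (gradFun f) x) ∧
        piFun s (dStar s f) x = -rieszFun (1 - s) (gradFun f) x) ∧
      (∀ f : 𝓢(E3, V3), HasCompactSupport f → ∀ x : E3,
        Integrable (piIntegrand s (cStar s f) x) ∧
        Integrable (rieszIntegrand (1 - s) (curlFun f) x) ∧
        piFun s (cStar s f) x = rieszFun (1 - s) (curlFun f) x) ∧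
      ∀ r : ℝ,
        -- the extensions by density exist and are unique
        (∀ T, ExtendsOne (fun w => piFun s (dStar s w)) T ↔ T = PiD s r) ∧
        (∀ T, ExtendsOne (fun w => piFun s (cStar s w)) T ↔ T = PiC s r) ∧
        (∀ T, ExtendsTwo (dStar s) T ↔ T = DStar s r) ∧
        (∀ T, ExtendsTwo (cStar s) T ↔ T = CStar s r) ∧
        -- formulas in `H^{r-s}`
        (∀ f : Sob ℂ r, IsRieszPotential (1 - s) (-grad f.dist) (PiD s r f).dist) ∧
        (∀ f : Sob V3 r, IsRieszPotential (1 - s) (curl f.dist) (PiC s r f).dist) ∧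
        -- `ΠC*ΠD* = 0`
        (∀ f : Sob ℂ r, PiC s (r - s) (PiD s r f) = 0) ∧
        -- `Π : H^r_{fHd} → H^r` is well defined, linear and bounded
        (∃ P : fHd s r →ₗ[ℂ] Sob V3 r,
          (∀ (W : fHd s r) (φ : Sob ℂ (r + s)) (A : Sob V3 (r + s)),
            IsPotential s r φ A (W : 𝓢'(E3 × E3, V3)) →
              (P W).dist = (PiD s (r + s) φ).dist + (PiC s (r + s) A).dist ∧
              IsRieszPotential (1 - s) (-grad φ.dist + curl A.dist) (P W).dist) ∧
          ∃ K : ℝ, ∀ W : fHd s r, ‖P W‖ ≤ K * fHdNorm s r W) ∧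
        -- the adjoint `(ΠC*)* : H^{s-r} → H^{-r}` of `ΠC* : H^r → H^{r-s}` is `ΠC*`
        (∀ (f : Sob V3 r) (ψ : Sob V3 (s - r)),
          dualityPairing (by ring) (PiC s r f) ψ =
            dualityPairing (by ring) f (PiC s (s - r) ψ))) ∧
    -- limits in `H^{r-1}` as `s → 1⁻`
    (∀ (r : ℝ) (f : Sob ℂ r),
      Tendsto (fun s : ℝ => sobENorm (r - 1) ((PiD s r f).dist - (-grad f.dist)))
        (𝓝[<] 1) (𝓝 0)) ∧
    (∀ (r : ℝ) (f : Sob V3 r),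
      Tendsto (fun s : ℝ => sobENorm (r - 1) ((PiC s r f).dist - curl f.dist))
        (𝓝[<] 1) (𝓝 0)) := by
  refine ⟨fun s hs hs1 => ⟨fun f _ x => piFun_dStar hs hs1 f x, fun f _ x => piFun_cStar hs hs1 f x,
    fun r => ⟨extendsOne_piD_iff hs hs1 r, extendsOne_piC_iff hs hs1 r,
      extendsTwo_dStar_iff hs hs1 r, extendsTwo_cStar_iff hs hs1 r,
      isRieszPotential_piD hs hs1, isRieszPotential_piC hs hs1, piC_piD hs hs1 r,
      ⟨piHelmholtz hs hs1 r, fun W φ A h => piHelmholtz_spec hs hs1 h,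
        _, norm_piHelmholtz_le hs hs1⟩,
      fun f ψ => pairing_piC hs hs1 r f ψ _ _⟩⟩, fun r f => ?_, fun r f => ?_⟩
  · rw [grad_eq_gradB]
    exact tendsto_rieszGradB _ r f (fun s => PiD s r) fun s hs hs1 => piD_eq hs hs1 r
  · rw [curl_eq_gradB]
    exact tendsto_rieszGradB _ r f (fun s => PiC s r) fun s hs hs1 => piC_eq hs hs1 r
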